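/- Let $H$ be a real separable Hilbert space, $(e_i)_i$ a countable orthonormal family in $H$, $\lambda_i\ge 0$ with $\sum_i\lambda_i<\infty$, and let $(W^i)_i$ be independent standard real Brownian motions on a probability space $(\Omega,\mathcal A,\mathbb P)$. Let $F,G:H\times H\to H$ and $U_0:H\to H$ be (globally) Lipschitz. Consider the master equation $$\partial_t U(t,x)-\sum_i\lambda_i\,\partial_{ii}U(t,x)+\langle F(x,U),\nabla\rangle U(t,x)=G(x,U)\quad\text{in }(0,\infty)\times H,\qquad U(0,\cdot)=U_0. \tag{1}$$ For $0<T\le\infty$, a function $U:[0,T)\times H\to H$ is called a Lipschitz solution of (1) on $[0,T)$ if (a) for every $\alpha\in[0,T)$, $U(t,\cdot)$ is Lipschitz on $H$ uniformly in $t\in[0,\alpha]$; (b) for every $t\in[0,T)$ and $x\in H$, $$U(t,x)=\mathbb E\Big[\int_0^t G\big(X_s,U(t-s,X_s)\big)\,ds+U_0(X_t)\Big],$$ where $(X_s)_{0\le s\le t}$ is a strong solution with continuous paths of the stochastic differential equation in $H$ $$dX_s=-F\big(X_s,U(t-s,X_s)\big)\,ds+\sum_i\sqrt{2\lambda_i}\,dW^i_s\,e_i,\qquad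 X_0=x;$$ it is part of the requirement that such an $X$ exists and that the integrals in time and the expectation converge. Then: 1. There is a time $T>0$ such that (1) has exactly one Lipschitz solution on $[0,T)$. 2. There are a maximal time $T^c\in(0,\infty]$ and a Lipschitz solution $U$ of (1) on $[0,T^c)$ such that, for every $T\in(0,\infty]$ and every Lipschitz solution $V$ of (1) on $[0,T)$, one has $T\le T^c$ and $V$ is the restriction of $U$ to $[0,T)\times H$. 3. If $T^c<\infty$, then $\|D_xU(t,\cdot)\|_\infty\to\infty$ as $t\uparrow T^c$, where $\|D_xf\|_\infty:=\sup_{x\neq y}|f(x)-f(y)|/|x-y|$ denotes the Lipschitz seminorm of $f:H\to H$. -/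

import Mathlib

open MeasureTheory ProbabilityTheory Filter Topology
open scoped NNReal ENNReal

namespace HilbertMaster

section

variable {H : Type*} [NormedAddCommGroup H] [InnerProductSpace ℝ H]
  {Ω : Type*} [MeasurableSpace Ω] {ι : Type*}

/-- The `σ`-algebra generated by all the noises `W i` up to time `s`. -/
@[reducible] def noiseHistory (W : ι → ℝ≥0 → Ω → ℝ) (s : ℝ) : MeasurableSpace Ω :=
  ⨆ i, ⨆ r : ℝ≥0, ⨆ _ : (r : ℝ) ≤ s, MeasurableSpace.comap (W i r) inferInstance

/-- `X` is, on the time interval `[0, t]`, a strong solution with continuous paths, started at `x`,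
of the stochastic differential equation in `H`
`dX_s = b(s, X_s) ds + ∑ i, √(2 λ_i) dW^i_s e_i`.
Strong means adapted to the history of the noise, up to null sets. The equation is in integrated
form: the series of the noise converges in `H` and equals `X_s - x - ∫_0^s b(r, X_r) dr`. Its
`e_i`-component is `dX^i_s = b^i(s, X_s) ds + √(2 λ_i) dW^i_s`, and there is no noise in the
directions orthogonal to all the `e_i`. -/
structure IsStrongSolution (P : Measure Ω) (e : ι → H) (lam : ι → ℝ) (W : ι → ℝ≥0 → Ω → ℝ)
    (b : ℝ → H → H) (t : ℝ) (x : H) (X : ℝ → Ω → H) : Prop where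
  adapted : ∀ s ∈ Set.Icc 0 t, AEStronglyMeasurable[noiseHistory W s] (X s) P
  continuous_paths : ∀ᵐ ω ∂P, ContinuousOn (fun s => X s ω) (Set.Icc 0 t)
  integrable_drift : ∀ᵐ ω ∂P, IntervalIntegrable (fun s => b s (X s ω)) volume 0 t
  equation : ∀ᵐ ω ∂P, ∀ s ∈ Set.Icc 0 t,
    HasSum (fun i => (√(2 * lam i) * W i s.toNNReal ω) • e i)
      (X s ω - x - ∫ r in (0 : ℝ)..s, b r (X r ω))

/-- `V = Ψ(T, A, B, U₀)`: the function `V` is on `[0, T) × H` the solution, in the sense of the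
Feynman-Kac formula, of the linear equation
`∂_t V - ∑ i, λ_i ∂_ii V - ⟨B(t, x), ∇⟩ V = A(t, x)` with `V(0, ·) = U₀`. This means
`V(t, x) = 𝔼[∫_0^t A(t - s, X_s) ds + U₀(X_t)]`, where `X` solves
`dX_s = B(t - s, X_s) ds + ∑ i, √(2 λ_i) dW^i_s e_i` with `X_0 = x`; that the formula makes sense
(existence of `X`, convergence of the integrals) is part of the assertion. -/
def IsFeynmanKac (P : Measure Ω) (e : ι → H) (lam : ι → ℝ) (W : ι → ℝ≥0 → Ω → ℝ)
    (T : ℝ≥0∞) (A B : ℝ → H → H) (U₀ : H → H) (V : ℝ → H → H) : Prop :=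
  ∀ t : ℝ, 0 ≤ t → ENNReal.ofReal t < T → ∀ x : H, ∃ X : ℝ → Ω → H,
    IsStrongSolution P e lam W (fun s y => B (t - s) y) t x X ∧
    (∀ᵐ ω ∂P, IntervalIntegrable (fun s => A (t - s) (X s ω)) volume 0 t) ∧
    Integrable (fun ω => (∫ s in (0 : ℝ)..t, A (t - s) (X s ω)) + U₀ (X t ω)) P ∧
    V t x = ∫ ω, ((∫ s in (0 : ℝ)..t, A (t - s) (X s ω)) + U₀ (X t ω)) ∂P

/-- `U` is a Lipschitz solution on `[0, T)`, `0 < T ≤ ∞`, of the master equation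
`∂_t U - ∑ i, λ_i ∂_ii U + ⟨F(x, U), ∇⟩ U = G(x, U)` with `U(0, ·) = U₀`.
Only the values of `U` on `[0, T) × H` matter. -/
structure IsLipschitzSolution (P : Measure Ω) (e : ι → H) (lam : ι → ℝ) (W : ι → ℝ≥0 → Ω → ℝ)
    (F G : H × H → H) (U₀ : H → H) (T : ℝ≥0∞) (U : ℝ → H → H) : Prop where
  time_pos : 0 < T
  lipschitz : ∀ α : ℝ, 0 ≤ α → ENNReal.ofReal α < T →
    ∃ K : ℝ≥0, ∀ t ∈ Set.Icc 0 α, LipschitzWith K (U t)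
  feynmanKac : IsFeynmanKac P e lam W T
    (fun t x => G (x, U t x)) (fun t x => -F (x, U t x)) U₀ U

/-- `‖D_x f‖_∞`, i.e. the Lipschitz seminorm (best Lipschitz constant, possibly infinite) of `f`. -/
noncomputable def lipSeminorm (f : H → H) : ℝ≥0∞ :=
  ⨆ x : H, ⨆ y : H, edist (f x) (f y) / edist x y

end

end HilbertMaster

/-!
A Lipschitz solution is constructed pathwise in the noise. The noise `N = ∑ i, √(2 λ_i) W^i e_i` is
a random continuous path in `H` whose maxima on bounded time intervals are integrable
(`exists_noise`; the maximum of a Brownian motion is controlled by dyadic chaining,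
`ofReal_sq_le_chainingBound`). Since the noise is additive, the stochastic differential equation
is, for every fixed path `n` of the noise and every `U` that is jointly continuous and Lipschitz in
space, an ordinary differential equation. Its solution `flow F U t x n s` is continuous in all
arguments, including `n`, and so is the random variable `payoff F G U U₀ t x n` of the Feynman-Kac
formula. A mild solution (`IsMild`) is a `U` for which the formula holds along these
characteristics.

*Short times.* On the functions `U` with given Lipschitz constant and given bound at the origin, the
right-hand side of the Feynman-Kac formula is, for short times, a self-map. Grönwall's inequality
shows that it is a contraction for the distance with weight `e^{lt} (1 + |x|)`
(`exists_contraction`). The length of the time interval depends on the initial value only through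
its Lipschitz constant (`exists_isMild`).

*Uniqueness.* The comparison in `exists_contraction` allows one of the two functions to be an
arbitrary Lipschitz solution, which is not known to be continuous in time, with arbitrary strong
solutions of its characteristic equation. Such a solution is bounded at the origin, uniformly in
time, because its coefficients are integrable along a single path
(`exists_bound_of_hasRepresentation`); hence its weighted distance to a mild solution is finite,
and vanishes by the contraction property (`IsMild.eq_of_hasRepresentation`).

*Continuation.* A mild solution on `[0, α]` is continued by a mild solution `V` with initial value
`U α` (`IsMild.append`). The Feynman-Kac formula for the concatenation follows from the flow
property of the characteristics (`payoff_add`) and from the Markov property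
(`IsDrivingNoise.integral_payoff_shiftPath`): the increments of the noise after time `r` have the
law of the noise and are independent of the characteristic at time `r`, which is adapted to the
history of the noise (`IsDrivingNoise.aestronglyMeasurable_flow`).

*Maximality and blow-up.* The maximal time is the supremum of the `α` for which a mild solution on
`[0, α]` exists. A bound of the Lipschitz constants along a sequence of times that increases to a
finite maximal time would allow a continuation by a fixed length of time from each of them, hence
beyond the maximal time. This proves both the blow-up and that no Lipschitz solution lives longer.
-/

namespace HilbertMaster

/-! ### Fixed points in weighted uniform norms -/

/-- Banach's fixed point theorem in a weighted uniform distance, for a class `C` of functions that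
is closed under weighted uniform convergence. No function space is built: the weight only enters
through the pointwise bounds. -/
theorem exists_fixedPoint_of_weighted {α E : Type*} [NormedAddCommGroup E] [CompleteSpace E]
    (w : α → ℝ) (hw : ∀ a, 0 ≤ w a) (C : Set (α → E)) (Ψ : (α → E) → (α → E))
    (hΨ : ∀ u ∈ C, Ψ u ∈ C)
    (hclosed : ∀ (u : ℕ → α → E) (v : α → E), (∀ k, u k ∈ C) →
      (∀ ε > 0, ∀ᶠ k in atTop, ∀ a, ‖u k a - v a‖ ≤ ε * w a) → v ∈ C)
    (hcontr : ∀ u ∈ C, ∀ v ∈ C, ∀ c, 0 ≤ c → (∀ a, ‖u a - v a‖ ≤ c * w a) →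
      ∀ a, ‖Ψ u a - Ψ v a‖ ≤ c / 2 * w a)
    (u₀ : α → E) (hu₀ : u₀ ∈ C) (c₀ : ℝ) (hc₀ : 0 ≤ c₀)
    (h₀ : ∀ a, ‖Ψ u₀ a - u₀ a‖ ≤ c₀ * w a) :
    ∃ u ∈ C, Ψ u = u := by
  set u : ℕ → α → E := fun k => Ψ^[k] u₀ with hu
  have hsucc : ∀ k, u (k + 1) = Ψ (u k) := fun k => Function.iterate_succ_apply' Ψ k u₀
  have hmem : ∀ k, u k ∈ C := by
    intro k
    induction k with
    | zero => exact hu₀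
    | succ k ih => rw [hsucc]; exact hΨ _ ih
  have hstep : ∀ k a, ‖u (k + 1) a - u k a‖ ≤ c₀ / 2 ^ k * w a := by
    intro k
    induction k with
    | zero => intro a; simpa [hu] using h₀ a
    | succ k ih =>
      intro a
      rw [hsucc (k + 1)]
      nth_rewrite 2 [hsucc k]
      have := hcontr _ (hmem (k + 1)) _ (hmem k) (c₀ / 2 ^ k) (by positivity) ih a
      rwa [div_div, ← pow_succ] at this
  have hdist : ∀ a k, dist (u k a) (u (k + 1) a) ≤ (2 * c₀ * w a) / 2 / 2 ^ k := by
    intro a k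
    rw [dist_comm, dist_eq_norm]
    refine (hstep k a).trans (le_of_eq ?_)
    ring
  have hlim : ∀ a, ∃ y, Tendsto (fun k => u k a) atTop (𝓝 y) := fun a =>
    cauchySeq_tendsto_of_complete (cauchySeq_of_le_geometric_two (hdist a))
  choose v hv using hlim
  have hconv : ∀ k a, ‖u k a - v a‖ ≤ 2 * c₀ / 2 ^ k * w a := by
    intro k a
    have := dist_le_of_le_geometric_two_of_tendsto (hdist a) (hv a) k
    rw [dist_eq_norm] at this
    refine this.trans (le_of_eq ?_)
    ring
  have hpow : Tendsto (fun k : ℕ => 2 * c₀ / 2 ^ k) atTop (𝓝 0) :=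
    tendsto_const_nhds.div_atTop (tendsto_pow_atTop_atTop_of_one_lt (by norm_num))
  have hsmall : ∀ ε > 0, ∀ᶠ k in atTop, ∀ a, ‖u k a - v a‖ ≤ ε * w a := by
    intro ε hε
    filter_upwards [hpow.eventually (gt_mem_nhds hε)] with k hk a
    exact (hconv k a).trans (mul_le_mul_of_nonneg_right hk.le (hw a))
  have hvC : v ∈ C := hclosed u v hmem hsmall
  refine ⟨v, hvC, funext fun a => ?_⟩
  have h1 : Tendsto (fun k => u (k + 1) a) atTop (𝓝 (Ψ v a)) := by
    rw [tendsto_iff_norm_sub_tendsto_zero]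
    have hz : Tendsto (fun k : ℕ => 2 * c₀ / 2 ^ k / 2 * w a) atTop (𝓝 0) := by
      simpa using (hpow.div_const 2).mul_const (w a)
    refine squeeze_zero (fun _ => norm_nonneg _) (fun k => ?_) hz
    rw [hsucc]
    exact hcontr _ (hmem k) _ hvC _ (by positivity) (hconv k) a
  exact tendsto_nhds_unique h1 ((tendsto_add_atTop_iff_nat 1).2 (hv a))

/-! ### Ordinary differential equations in integrated form -/

/-- Grönwall's inequality in integral form. -/
theorem le_mul_exp_of_le_add_integral {f : ℝ → ℝ} {S a L : ℝ} (hL : 0 ≤ L)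
    (hf : ContinuousOn f (Set.Icc 0 S))
    (h : ∀ s ∈ Set.Icc 0 S, f s ≤ a + L * ∫ r in (0 : ℝ)..s, f r) :
    ∀ s ∈ Set.Icc 0 S, f s ≤ a * Real.exp (L * s) := by
  intro s hs
  have hS : 0 ≤ S := hs.1.trans hs.2
  set g : ℝ → ℝ := Set.IccExtend hS (Set.domRestrict (Set.Icc 0 S) f) with hg
  have hgc : Continuous g := (hf.domRestrict).Icc_extend'
  have hgf : ∀ r ∈ Set.Icc 0 S, g r = f r := fun r hr => by
    rw [hg, Set.IccExtend_of_mem _ _ hr]; rfl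
  set φ : ℝ → ℝ := fun s => a + L * ∫ r in (0 : ℝ)..s, g r with hφ
  have hint : ∀ s ∈ Set.Icc 0 S, (∫ r in (0 : ℝ)..s, g r) = ∫ r in (0 : ℝ)..s, f r := by
    intro s hs
    refine intervalIntegral.integral_congr fun r hr => hgf r ?_
    rw [Set.uIcc_of_le hs.1] at hr
    exact ⟨hr.1, hr.2.trans hs.2⟩
  have hder : ∀ s, HasDerivAt φ (L * g s) s := fun s =>
    ((intervalIntegral.integral_hasDerivAt_right (hgc.intervalIntegrable _ _)
      (hgc.stronglyMeasurableAtFilter _ _) hgc.continuousAt).const_mul L).const_add a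
  have hle : ∀ s ∈ Set.Icc 0 S, g s ≤ φ s := fun s hs => by
    rw [hgf s hs]; simp only [hφ, hint s hs]; exact h s hs
  have key := le_gronwallBound_of_liminf_deriv_right_le (f := φ) (f' := fun s => L * g s)
    (δ := a) (K := L) (ε := 0) (a := 0) (b := S)
    (continuous_iff_continuousAt.2 fun s => (hder s).continuousAt).continuousOn
    (fun x _ r hr => ((hder x).hasDerivWithinAt (s := Set.Ici x)).liminf_right_slope_le hr)
    (by simp [hφ]) (fun x hx => by
      simpa using mul_le_mul_of_nonneg_left (hle x ⟨hx.1, hx.2.le⟩) hL) s hs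
  rw [gronwallBound_ε0, sub_zero] at key
  rw [← hgf s hs]
  exact (hle s hs).trans key

variable {H : Type*} [NormedAddCommGroup H] [NormedSpace ℝ H]

/-- A parametrised differential equation `Z' = β p s Z`, `Z 0 = 0`, whose right-hand side is jointly
continuous and uniformly Lipschitz in the last variable, has a solution for all positive times, and
the solution can be chosen jointly continuous in the parameter and the time. -/
theorem exists_continuous_flow [CompleteSpace H] {Λ : Type*} [TopologicalSpace Λ]
    (β : Λ → ℝ → H → H) (hβ : Continuous fun q : Λ × ℝ × H => β q.1 q.2.1 q.2.2)
    (L : ℝ≥0) (hL : ∀ p r, LipschitzWith L (β p r)) :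
    ∃ Z : Λ → ℝ → H, Continuous (fun q : Λ × ℝ => Z q.1 q.2) ∧
      ∀ p s, 0 ≤ s → Z p s = ∫ r in (0 : ℝ)..s, β p r (Z p r) := by
  -- Times are clamped to `[0, ∞)`, so that all the functions are defined on the whole line.
  have hsol : ∀ p, ∃ z : ℝ → H, Continuous z ∧
      ∀ s, z s = ∫ r in (0 : ℝ)..(max s 0), β p r (z r) := by
    intro p
    have hβp : Continuous fun q : ℝ × H => β p q.1 q.2 :=
      hβ.comp (continuous_const.prodMk continuous_id)
    have hb0 : Continuous fun r => ‖β p r 0‖ :=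
      (hβp.comp (continuous_id.prodMk continuous_const)).norm
    set m : ℝ → ℝ := fun s => 1 + ∫ r in (0 : ℝ)..(max s 0), ‖β p r 0‖ with hm
    have hm_cont : Continuous m := continuous_const.add
      ((intervalIntegral.continuous_primitive (fun _ _ => hb0.intervalIntegrable _ _) 0).comp
        (continuous_id.max continuous_const))
    have hm1 : ∀ s, 1 ≤ m s := fun s => by
      have := intervalIntegral.integral_nonneg (μ := volume) (le_max_right s 0)
        (fun r _ => norm_nonneg (β p r 0))
      simp only [hm]; linarith
    have hm_mono : ∀ r s, 0 ≤ r → r ≤ s → m r ≤ m s := fun r s h0 hrs => by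
      simp only [hm, max_eq_left h0, max_eq_left (h0.trans hrs)]
      have := intervalIntegral.integral_mono_interval (μ := volume) (f := fun r => ‖β p r 0‖)
        le_rfl h0 hrs (Eventually.of_forall fun r => norm_nonneg _) (hb0.intervalIntegrable 0 s)
      linarith
    set w : ℝ → ℝ := fun s => Real.exp (2 * L * max s 0) * m s with hw
    have hw_cont : Continuous w := by
      refine Continuous.mul ?_ hm_cont
      fun_prop
    have hw0 : ∀ s, 0 ≤ w s := fun s =>
      mul_nonneg (Real.exp_pos _).le (zero_le_one.trans (hm1 s))
    have hcomp : ∀ u : ℝ → H, Continuous u → Continuous fun r => β p r (u r) := fun u hu =>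
      hβp.comp (continuous_id.prodMk hu)
    obtain ⟨z, hz, hzfix⟩ := exists_fixedPoint_of_weighted w hw0 {u : ℝ → H | Continuous u}
      (fun u s => ∫ r in (0 : ℝ)..(max s 0), β p r (u r))
      (fun u hu => (intervalIntegral.continuous_primitive
        (fun _ _ => (hcomp u hu).intervalIntegrable _ _) 0).comp
          (continuous_id.max continuous_const))
      (by
        intro u v hu hconv
        refine continuous_of_locally_uniform_approx_of_continuousAt fun s U hU => ?_
        obtain ⟨ε, hε, hεU⟩ := Metric.mem_uniformity_dist.1 hU
        have hnear : ∀ᶠ r in 𝓝 s, w r < w s + 1 :=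
          hw_cont.continuousAt.eventually (gt_mem_nhds (lt_add_one _))
        have hpos : 0 < w s + 1 := by linarith [hw0 s]
        obtain ⟨k, hk⟩ := (hconv (ε / (w s + 1)) (by positivity)).exists
        refine ⟨_, hnear, u k, (hu k).continuousAt, fun r hr => hεU ?_⟩
        rw [dist_comm, dist_eq_norm]
        calc ‖u k r - v r‖ ≤ ε / (w s + 1) * w r := hk r
          _ < ε / (w s + 1) * (w s + 1) := by
            gcongr
            exact hr
          _ = ε := div_mul_cancel₀ _ hpos.ne')
      (by
        intro u hu v hv c hc huv s
        set s' := max s 0 with hs'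
        have hs0 : 0 ≤ s' := le_max_right _ _
        have hms : m s' = m s := by simp [hm, hs']
        rw [← intervalIntegral.integral_sub ((hcomp u hu).intervalIntegrable _ _)
          ((hcomp v hv).intervalIntegrable _ _)]
        have hexp : ∀ r, HasDerivAt (fun r : ℝ => c * m s / 2 * Real.exp (2 * L * r))
            (c * m s * L * Real.exp (2 * L * r)) r := by
          intro r
          have h1 : HasDerivAt (fun r : ℝ => 2 * L * r) (2 * (L : ℝ)) r := by
            simpa using (hasDerivAt_id r).const_mul (2 * (L : ℝ))
          have h2 := (h1.exp).const_mul (c * m s / 2)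
          rwa [show c * m s / 2 * (Real.exp (2 * L * r) * (2 * L)) =
            c * m s * L * Real.exp (2 * L * r) by ring] at h2
        have hcont : Continuous fun r : ℝ => c * m s * L * Real.exp (2 * L * r) := by fun_prop
        calc ‖∫ r in (0 : ℝ)..s', (β p r (u r) - β p r (v r))‖
            ≤ ∫ r in (0 : ℝ)..s', c * m s * L * Real.exp (2 * L * r) := by
              refine intervalIntegral.norm_integral_le_of_norm_le hs0
                (Eventually.of_forall fun r hr => ?_) (hcont.intervalIntegrable _ _)
              have h1 := (hL p r).norm_sub_le (u r) (v r)
              have h2 := huv r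
              have h3 : m r ≤ m s := hms ▸ hm_mono r s' hr.1.le hr.2
              have h4 : w r ≤ Real.exp (2 * L * r) * m s := by
                simp only [hw, max_eq_left hr.1.le]
                gcongr
              calc ‖β p r (u r) - β p r (v r)‖ ≤ L * ‖u r - v r‖ := h1
                _ ≤ L * (c * (Real.exp (2 * L * r) * m s)) := by
                  gcongr
                  exact h2.trans (by gcongr)
                _ = _ := by ring
          _ = c * m s / 2 * Real.exp (2 * L * s') - c * m s / 2 * Real.exp (2 * L * 0) :=
              intervalIntegral.integral_eq_sub_of_hasDerivAt (fun r _ => hexp r)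
                (hcont.intervalIntegrable _ _)
          _ ≤ c / 2 * w s := by
              have : 0 ≤ c * m s / 2 * Real.exp (2 * L * 0) := by
                have := zero_le_one.trans (hm1 s)
                positivity
              have h2 : c / 2 * w s = c * m s / 2 * Real.exp (2 * L * s') := by
                simp only [hw, hs']; ring
              linarith)
      (fun _ => 0) continuous_const 1 zero_le_one
      (by
        intro s
        have h1 : ‖∫ r in (0 : ℝ)..(max s 0), β p r 0‖ ≤ m s :=
          (intervalIntegral.norm_integral_le_integral_norm (le_max_right _ _)).trans
            (by simp only [hm]; linarith)
        have h2 : m s ≤ w s := by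
          have : 1 ≤ Real.exp (2 * L * max s 0) := Real.one_le_exp (by positivity)
          simp only [hw]
          nlinarith [hm1 s]
        simpa using h1.trans h2)
    exact ⟨z, hz, fun s => (congrFun hzfix s).symm⟩
  choose Z hZc hZ using hsol
  have hZ' : ∀ p s, 0 ≤ s → Z p s = ∫ r in (0 : ℝ)..s, β p r (Z p r) := fun p s hs => by
    conv_lhs => rw [hZ, max_eq_left hs]
  have hclamp : ∀ p s, Z p s = Z p (max s 0) := fun p s => by
    rw [hZ p s, hZ p (max s 0), max_eq_left (le_max_right s 0)]
  have hcomp : ∀ p, ∀ u : ℝ → H, Continuous u → Continuous fun r => β p r (u r) := fun p u hu =>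
    hβ.comp (continuous_const.prodMk (continuous_id.prodMk hu))
  refine ⟨Z, ?_, hZ'⟩
  rw [continuous_iff_continuousAt]
  rintro ⟨p₀, s₀⟩
  set S := max s₀ 0 + 1 with hS
  -- The distance of the solutions is controlled by that of the right-hand sides along one of them.
  set d : Λ → ℝ := fun p => ∫ r in (0 : ℝ)..S, ‖β p r (Z p₀ r) - β p₀ r (Z p₀ r)‖ with hd
  have hdc : Continuous d := by
    refine intervalIntegral.continuous_parametric_intervalIntegral_of_continuous' ?_ 0 S
    have h1 : Continuous fun q : Λ × ℝ => β q.1 q.2 (Z p₀ q.2) :=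
      hβ.comp (continuous_fst.prodMk (continuous_snd.prodMk ((hZc p₀).comp continuous_snd)))
    exact (h1.sub ((hcomp p₀ _ (hZc p₀)).comp continuous_snd)).norm
  have hd0 : d p₀ = 0 := by simp [hd]
  have hbound : ∀ p, ∀ s ∈ Set.Icc 0 S, ‖Z p s - Z p₀ s‖ ≤ d p * Real.exp (L * s) := by
    intro p
    have hcont : ∀ q, Continuous fun r => ‖β p r (Z q r) - β p₀ r (Z p₀ r)‖ := fun q =>
      ((hcomp p _ (hZc q)).sub (hcomp p₀ _ (hZc p₀))).norm
    refine le_mul_exp_of_le_add_integral L.2 ((hZc p).sub (hZc p₀)).norm.continuousOn ?_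
    intro s hs
    have h1 : d p ≥ ∫ r in (0 : ℝ)..s, ‖β p r (Z p₀ r) - β p₀ r (Z p₀ r)‖ :=
      intervalIntegral.integral_mono_interval le_rfl hs.1 hs.2
        (Eventually.of_forall fun r => norm_nonneg _) ((hcont p₀).intervalIntegrable _ _)
    have hn : Continuous fun r => ‖Z p r - Z p₀ r‖ := ((hZc p).sub (hZc p₀)).norm
    rw [hZ' p s hs.1, hZ' p₀ s hs.1, ← intervalIntegral.integral_sub
      ((hcomp p _ (hZc p)).intervalIntegrable _ _) ((hcomp p₀ _ (hZc p₀)).intervalIntegrable _ _)]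
    calc ‖∫ r in (0 : ℝ)..s, (β p r (Z p r) - β p₀ r (Z p₀ r))‖
        ≤ ∫ r in (0 : ℝ)..s, (‖β p r (Z p₀ r) - β p₀ r (Z p₀ r)‖ + L * ‖Z p r - Z p₀ r‖) := by
          refine intervalIntegral.norm_integral_le_of_norm_le hs.1
            (Eventually.of_forall fun r _ => ?_)
            (((hcont p₀).add (continuous_const.mul hn)).intervalIntegrable _ _)
          have := (hL p r).norm_sub_le (Z p r) (Z p₀ r)
          calc _ = ‖(β p r (Z p₀ r) - β p₀ r (Z p₀ r)) + (β p r (Z p r) - β p r (Z p₀ r))‖ := by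
                congr 1; abel
            _ ≤ _ := (norm_add_le _ _).trans (by gcongr)
      _ = (∫ r in (0 : ℝ)..s, ‖β p r (Z p₀ r) - β p₀ r (Z p₀ r)‖) +
            L * ∫ r in (0 : ℝ)..s, ‖Z p r - Z p₀ r‖ := by
          rw [intervalIntegral.integral_add ((hcont p₀).intervalIntegrable _ _)
            ((hn.intervalIntegrable _ _).const_mul _), intervalIntegral.integral_const_mul]
      _ ≤ _ := by gcongr
  have hlim : Tendsto (fun q : Λ × ℝ => d q.1 * Real.exp (L * S) + ‖Z p₀ q.2 - Z p₀ s₀‖)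
      (𝓝 (p₀, s₀)) (𝓝 0) := by
    have h : Continuous fun q : Λ × ℝ => d q.1 * Real.exp (L * S) + ‖Z p₀ q.2 - Z p₀ s₀‖ :=
      ((hdc.comp continuous_fst).mul continuous_const).add
        (((hZc p₀).comp continuous_snd).sub continuous_const).norm
    simpa [hd0] using h.tendsto (p₀, s₀)
  refine tendsto_iff_norm_sub_tendsto_zero.2 (squeeze_zero' (Eventually.of_forall fun _ =>
    norm_nonneg _) ?_ hlim)
  have hnear : ∀ᶠ q : Λ × ℝ in 𝓝 (p₀, s₀), max q.2 0 < S :=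
    (continuous_snd.max continuous_const).continuousAt.eventually
      (gt_mem_nhds (by simp [hS]))
  filter_upwards [hnear] with q hq
  have hdp : 0 ≤ d q.1 := intervalIntegral.integral_nonneg (by positivity) fun _ _ => norm_nonneg _
  have h1 := hbound q.1 (max q.2 0) ⟨le_max_right _ _, hq.le⟩
  rw [← hclamp, ← hclamp] at h1
  calc ‖Z q.1 q.2 - Z p₀ s₀‖ = ‖(Z q.1 q.2 - Z p₀ q.2) + (Z p₀ q.2 - Z p₀ s₀)‖ := by
        congr 1; abel
    _ ≤ _ := (norm_add_le _ _).trans (by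
      gcongr
      exact h1.trans (by gcongr))

/-! ### Characteristics driven by a fixed noise path -/

section Flow

variable {H : Type*} [NormedAddCommGroup H] [NormedSpace ℝ H]

/-- `X` solves on `[0, S]` the characteristic equation of the master equation,
`X_s = x + n_s - ∫_0^s F(X_r, U(t - r, X_r)) dr`, for one fixed noise path `n`. The function `U`
is not required to be measurable in time; integrability of the drift is part of the definition. -/
structure IsPath (F : H × H → H) (U : ℝ → H → H) (t : ℝ) (x : H) (n : C(ℝ≥0, H)) (S : ℝ)
    (X : ℝ → H) : Prop where
  continuousOn : ContinuousOn X (Set.Icc 0 S)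
  integrable : IntervalIntegrable (fun s => -F (X s, U (t - s) (X s))) volume 0 S
  eq : ∀ s ∈ Set.Icc 0 S,
    X s = x + n s.toNNReal + ∫ r in (0 : ℝ)..s, -F (X r, U (t - r) (X r))

/-- The random variable inside the expectation of the Feynman-Kac formula, along a given path. -/
noncomputable def reward (G : H × H → H) (U : ℝ → H → H) (U₀ : H → H) (t : ℝ) (X : ℝ → H) : H :=
  (∫ s in (0 : ℝ)..t, G (X s, U (t - s) (X s))) + U₀ (X t)

/-- `U` is jointly continuous and, at all times, `K`-Lipschitz in space. -/
structure IsRegular (K : ℝ≥0) (U : ℝ → H → H) : Prop where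
  continuous : Continuous fun q : ℝ × H => U q.1 q.2
  lipschitz : ∀ t, LipschitzWith K (U t)

theorem norm_sub_le_of_lipschitz_prod {H : Type*} [NormedAddCommGroup H] {F : H × H → H}
    {L : ℝ≥0} (hF : LipschitzWith L F)
    (y z u v : H) : ‖F (y, u) - F (z, v)‖ ≤ L * (‖y - z‖ + ‖u - v‖) := by
  refine (hF.norm_sub_le _ _).trans ?_
  gcongr
  rw [Prod.mk_sub_mk, Prod.norm_mk]
  exact max_le_add_of_nonneg (norm_nonneg _) (norm_nonneg _)

/-- Dependence of a Lipschitz coefficient on the position and on the function `U`. -/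
theorem norm_coeff_sub_le {H : Type*} [NormedAddCommGroup H] {F : H × H → H} {L : ℝ≥0}
    (hF : LipschitzWith L F) {f g : H → H}
    {K : ℝ≥0} (hf : LipschitzWith K f) (y z : H) :
    ‖F (y, f y) - F (z, g z)‖ ≤ L * ((1 + K) * ‖y - z‖ + ‖f z - g z‖) := by
  refine (norm_sub_le_of_lipschitz_prod hF _ _ _ _).trans ?_
  have h1 := hf.norm_sub_le y z
  have h2 : ‖f y - g z‖ ≤ ‖f y - f z‖ + ‖f z - g z‖ := norm_sub_le_norm_sub_add_norm_sub _ _ _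
  exact mul_le_mul_of_nonneg_left (by linarith) L.2

theorem norm_coeff_le {H : Type*} [NormedAddCommGroup H] {F : H × H → H} {L : ℝ≥0}
    (hF : LipschitzWith L F) {f : H → H}
    {K : ℝ≥0} (hf : LipschitzWith K f) (y : H) :
    ‖F (y, f y)‖ ≤ ‖F (0, f 0)‖ + L * (1 + K) * ‖y‖ := by
  have h1 := norm_coeff_sub_le hF (g := f) hf y 0
  have h2 := norm_le_norm_add_norm_sub' (F (y, f y)) (F (0, f 0))
  simp only [sub_zero, sub_self, norm_zero, add_zero] at h1
  linarith

/-- Stability of the characteristics: dependence on the starting point, on the noise path and on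
the function `U`. -/
theorem IsPath.norm_sub_le {F : H × H → H} {L : ℝ≥0} (hF : LipschitzWith L F) {U V : ℝ → H → H}
    {t t' : ℝ} {x y : H} {n m : C(ℝ≥0, H)} {S : ℝ} {X Y : ℝ → H} (hX : IsPath F U t x n S X)
    (hY : IsPath F V t' y m S Y) {K : ℝ≥0} (hU : ∀ r ∈ Set.Icc 0 S, LipschitzWith K (U (t - r)))
    {a : ℝ} (ha : ∀ s ∈ Set.Icc 0 S, ‖(x + n s.toNNReal) - (y + m s.toNNReal)‖ ≤ a) {D : ℝ → ℝ}
    (hD : IntervalIntegrable D volume 0 S)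
    (hUV : ∀ r ∈ Set.Icc 0 S, ‖U (t - r) (Y r) - V (t' - r) (Y r)‖ ≤ D r) :
    ∀ s ∈ Set.Icc 0 S,
      ‖X s - Y s‖ ≤ (a + L * ∫ r in (0 : ℝ)..S, D r) * Real.exp (L * (1 + K) * s) := by
  have hcont : ContinuousOn (fun s => ‖X s - Y s‖) (Set.Icc 0 S) :=
    (hX.continuousOn.sub hY.continuousOn).norm
  refine le_mul_exp_of_le_add_integral (by positivity) hcont fun s hs => ?_
  have hS : 0 ≤ S := hs.1.trans hs.2
  have hsub : Set.uIcc 0 s ⊆ Set.uIcc 0 S := by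
    rw [Set.uIcc_of_le hs.1, Set.uIcc_of_le hS]; exact Set.Icc_subset_Icc_right hs.2
  have hci : IntervalIntegrable (fun s => ‖X s - Y s‖) volume 0 s := by
    refine (hcont.mono ?_).intervalIntegrable
    rw [Set.uIcc_of_le hs.1]; exact Set.Icc_subset_Icc_right hs.2
  have hDs := hD.mono_set hsub
  rw [hX.eq s hs, hY.eq s hs, add_sub_add_comm,
    ← intervalIntegral.integral_sub (hX.integrable.mono_set hsub) (hY.integrable.mono_set hsub)]
  refine (norm_add_le _ _).trans ?_
  have h1 : ‖∫ r in (0 : ℝ)..s, (-F (X r, U (t - r) (X r)) - -F (Y r, V (t' - r) (Y r)))‖ ≤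
      ∫ r in (0 : ℝ)..s, (L * (1 + K) * ‖X r - Y r‖ + L * D r) := by
    refine intervalIntegral.norm_integral_le_of_norm_le hs.1 (Eventually.of_forall fun r hr => ?_)
      ((hci.const_mul _).add (hDs.const_mul _))
    have hr' : r ∈ Set.Icc 0 S := ⟨hr.1.le, hr.2.trans hs.2⟩
    rw [neg_sub_neg, norm_sub_rev]
    refine (norm_coeff_sub_le hF (hU r hr') _ _).trans ?_
    rw [mul_add, mul_assoc]
    gcongr
    exact hUV r hr'
  rw [intervalIntegral.integral_add (hci.const_mul _) (hDs.const_mul _),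
    intervalIntegral.integral_const_mul, intervalIntegral.integral_const_mul] at h1
  have h2 : ∫ r in (0 : ℝ)..s, D r ≤ ∫ r in (0 : ℝ)..S, D r :=
    intervalIntegral.integral_mono_interval le_rfl hs.1 hs.2
      ((ae_restrict_iff' measurableSet_Ioc).2 (Eventually.of_forall fun r hr =>
        (norm_nonneg _).trans (hUV r ⟨hr.1.le, hr.2⟩))) hD
  have h3 := mul_le_mul_of_nonneg_left h2 L.2
  have h4 := ha s hs
  simp only [NNReal.val_eq_coe] at h3
  linarith

/-- Linear growth of the characteristics. -/
theorem IsPath.norm_le {F : H × H → H} {L : ℝ≥0} (hF : LipschitzWith L F) {U : ℝ → H → H}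
    {t : ℝ} {x : H} {n : C(ℝ≥0, H)} {S : ℝ} {X : ℝ → H} (hX : IsPath F U t x n S X)
    {K : ℝ≥0} (hU : ∀ r ∈ Set.Icc 0 S, LipschitzWith K (U (t - r)))
    {m : ℝ} (hm : ∀ s ∈ Set.Icc 0 S, ‖n s.toNNReal‖ ≤ m) {φ : ℝ → ℝ}
    (hφ : IntervalIntegrable φ volume 0 S)
    (hUφ : ∀ r ∈ Set.Icc 0 S, ‖F (0, U (t - r) 0)‖ ≤ φ r) :
    ∀ s ∈ Set.Icc 0 S,
      ‖X s‖ ≤ (‖x‖ + m + ∫ r in (0 : ℝ)..S, φ r) * Real.exp (L * (1 + K) * s) := by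
  have hcont : ContinuousOn (fun s => ‖X s‖) (Set.Icc 0 S) := hX.continuousOn.norm
  refine le_mul_exp_of_le_add_integral (by positivity) hcont fun s hs => ?_
  have hS : 0 ≤ S := hs.1.trans hs.2
  have hsub : Set.uIcc 0 s ⊆ Set.uIcc 0 S := by
    rw [Set.uIcc_of_le hs.1, Set.uIcc_of_le hS]; exact Set.Icc_subset_Icc_right hs.2
  have hci : IntervalIntegrable (fun s => ‖X s‖) volume 0 s := by
    refine (hcont.mono ?_).intervalIntegrable
    rw [Set.uIcc_of_le hs.1]; exact Set.Icc_subset_Icc_right hs.2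
  have hφs := hφ.mono_set hsub
  rw [hX.eq s hs]
  refine (norm_add_le _ _).trans ?_
  have h1 : ‖∫ r in (0 : ℝ)..s, -F (X r, U (t - r) (X r))‖ ≤
      ∫ r in (0 : ℝ)..s, (L * (1 + K) * ‖X r‖ + φ r) := by
    refine intervalIntegral.norm_integral_le_of_norm_le hs.1 (Eventually.of_forall fun r hr => ?_)
      ((hci.const_mul _).add hφs)
    have hr' : r ∈ Set.Icc 0 S := ⟨hr.1.le, hr.2.trans hs.2⟩
    rw [norm_neg]
    have := norm_coeff_le hF (hU r hr') (X r)
    have := hUφ r hr'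
    linarith
  rw [intervalIntegral.integral_add (hci.const_mul _) hφs,
    intervalIntegral.integral_const_mul] at h1
  have h2 : ∫ r in (0 : ℝ)..s, φ r ≤ ∫ r in (0 : ℝ)..S, φ r :=
    intervalIntegral.integral_mono_interval le_rfl hs.1 hs.2
      ((ae_restrict_iff' measurableSet_Ioc).2 (Eventually.of_forall fun r hr =>
        (norm_nonneg _).trans (hUφ r ⟨hr.1.le, hr.2⟩))) hφ
  have h3 := hm s hs
  have h4 := norm_add_le x (n s.toNNReal)
  linarith

/-- Dependence of the payoff on the path and on the function `U`. -/
theorem norm_reward_sub_le {G : H × H → H} {L : ℝ≥0} (hG : LipschitzWith L G) {U₀ : H → H}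
    {K₀ : ℝ≥0} (hU₀ : LipschitzWith K₀ U₀) {U V : ℝ → H → H} {t : ℝ} (ht : 0 ≤ t)
    {X Y : ℝ → H} {K : ℝ≥0} (hU : ∀ r ∈ Set.Icc 0 t, LipschitzWith K (U (t - r)))
    (hXi : IntervalIntegrable (fun s => G (X s, U (t - s) (X s))) volume 0 t)
    (hYi : IntervalIntegrable (fun s => G (Y s, V (t - s) (Y s))) volume 0 t)
    {ρ : ℝ} (hρ : ∀ s ∈ Set.Icc 0 t, ‖X s - Y s‖ ≤ ρ) {D : ℝ → ℝ}
    (hD : IntervalIntegrable D volume 0 t)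
    (hUV : ∀ r ∈ Set.Icc 0 t, ‖U (t - r) (Y r) - V (t - r) (Y r)‖ ≤ D r) :
    ‖reward G U U₀ t X - reward G V U₀ t Y‖ ≤
      L * ((1 + K) * ρ * t + ∫ r in (0 : ℝ)..t, D r) + K₀ * ρ := by
  rw [reward, reward, add_sub_add_comm, ← intervalIntegral.integral_sub hXi hYi]
  refine (norm_add_le _ _).trans (add_le_add ?_ ?_)
  · have h1 : ‖∫ s in (0 : ℝ)..t, (G (X s, U (t - s) (X s)) - G (Y s, V (t - s) (Y s)))‖ ≤
        ∫ s in (0 : ℝ)..t, (L * ((1 + K) * ρ) + L * D s) := by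
      refine intervalIntegral.norm_integral_le_of_norm_le ht (Eventually.of_forall fun r hr => ?_)
        (intervalIntegrable_const.add (hD.const_mul _))
      have hr' : r ∈ Set.Icc 0 t := ⟨hr.1.le, hr.2⟩
      refine (norm_coeff_sub_le hG (hU r hr') _ _).trans ?_
      rw [mul_add]
      gcongr
      · exact hρ r hr'
      · exact hUV r hr'
    rw [intervalIntegral.integral_add intervalIntegrable_const (hD.const_mul _),
      intervalIntegral.integral_const, intervalIntegral.integral_const_mul, smul_eq_mul] at h1
    linarith
  · exact (hU₀.norm_sub_le _ _).trans (by gcongr; exact hρ t ⟨ht, le_rfl⟩)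

/-- Linear growth of the payoff. -/
theorem norm_reward_le {G : H × H → H} {L : ℝ≥0} (hG : LipschitzWith L G) {U₀ : H → H}
    {K₀ : ℝ≥0} (hU₀ : LipschitzWith K₀ U₀) {U : ℝ → H → H} {t : ℝ} (ht : 0 ≤ t)
    {X : ℝ → H} {K : ℝ≥0} (hU : ∀ r ∈ Set.Icc 0 t, LipschitzWith K (U (t - r)))
    {ρ : ℝ} (hρ : ∀ s ∈ Set.Icc 0 t, ‖X s‖ ≤ ρ) {γ : ℝ → ℝ}
    (hγ : IntervalIntegrable γ volume 0 t)
    (hUγ : ∀ r ∈ Set.Icc 0 t, ‖G (0, U (t - r) 0)‖ ≤ γ r) :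
    ‖reward G U U₀ t X‖ ≤
      (∫ r in (0 : ℝ)..t, γ r) + L * (1 + K) * ρ * t + (‖U₀ 0‖ + K₀ * ρ) := by
  rw [reward]
  refine (norm_add_le _ _).trans (add_le_add ?_ ?_)
  · have h1 : ‖∫ s in (0 : ℝ)..t, G (X s, U (t - s) (X s))‖ ≤
        ∫ s in (0 : ℝ)..t, (γ s + L * (1 + K) * ρ) := by
      refine intervalIntegral.norm_integral_le_of_norm_le ht (Eventually.of_forall fun r hr => ?_)
        (hγ.add intervalIntegrable_const)
      have hr' : r ∈ Set.Icc 0 t := ⟨hr.1.le, hr.2⟩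
      refine (norm_coeff_le hG (hU r hr') _).trans (add_le_add (hUγ r hr') ?_)
      gcongr
      exact hρ r hr'
    rw [intervalIntegral.integral_add hγ intervalIntegrable_const,
      intervalIntegral.integral_const, smul_eq_mul] at h1
    linarith
  · have h1 := hU₀.norm_sub_le (X t) 0
    have h2 := norm_le_norm_add_norm_sub' (U₀ (X t)) (U₀ 0)
    have h3 : (K₀ : ℝ) * ‖X t‖ ≤ K₀ * ρ := by gcongr; exact hρ t ⟨ht, le_rfl⟩
    rw [sub_zero] at h1
    linarith

/-- For a regular `U` the characteristics exist for all times, and depend continuously on the final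
time, the starting point, the noise path and the current time. -/
theorem exists_flow [CompleteSpace H] {F : H × H → H} {L : ℝ≥0} (hF : LipschitzWith L F) {K : ℝ≥0}
    {U : ℝ → H → H} (hU : IsRegular K U) :
    ∃ X : ℝ → H → C(ℝ≥0, H) → ℝ → H,
      Continuous (fun q : ℝ × H × C(ℝ≥0, H) × ℝ => X q.1 q.2.1 q.2.2.1 q.2.2.2) ∧
      ∀ t x n S, IsPath F U t x n S (X t x n) := by
  -- Subtracting `x + n` from the characteristic leaves a differential equation without noise.
  set β : (ℝ × H × C(ℝ≥0, H)) → ℝ → H → H := fun p r z =>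
    -F (p.2.1 + p.2.2 r.toNNReal + z, U (p.1 - r) (p.2.1 + p.2.2 r.toNNReal + z)) with hβ
  have heval : ∀ {A : Type _} [TopologicalSpace A] (f : A → C(ℝ≥0, H)) (g : A → ℝ),
      Continuous f → Continuous g → Continuous fun a => f a (g a).toNNReal := fun f g hf hg =>
    continuous_eval.comp (hf.prodMk (continuous_real_toNNReal.comp hg))
  have hβc : Continuous fun q : (ℝ × H × C(ℝ≥0, H)) × ℝ × H => β q.1 q.2.1 q.2.2 := by
    have h1 : Continuous fun q : (ℝ × H × C(ℝ≥0, H)) × ℝ × H =>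
        q.1.2.1 + q.1.2.2 q.2.1.toNNReal + q.2.2 :=
      ((by fun_prop : Continuous fun q : (ℝ × H × C(ℝ≥0, H)) × ℝ × H => q.1.2.1).add
        (heval (fun q : (ℝ × H × C(ℝ≥0, H)) × ℝ × H => q.1.2.2) (fun q => q.2.1)
          (by fun_prop) (by fun_prop))).add (by fun_prop)
    exact (hF.continuous.comp (h1.prodMk (hU.continuous.comp
      ((by fun_prop : Continuous fun q : (ℝ × H × C(ℝ≥0, H)) × ℝ × H => q.1.1 - q.2.1).prodMk
        h1)))).neg
  have hβL : ∀ p r, LipschitzWith (L * (1 + K)) (β p r) := by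
    intro p r
    refine LipschitzWith.of_dist_le_mul fun y z => ?_
    rw [dist_eq_norm, dist_eq_norm, hβ]
    simp only [neg_sub_neg]
    rw [norm_sub_rev]
    refine (norm_coeff_sub_le hF (g := U (p.1 - r)) (hU.lipschitz _) _ _).trans (le_of_eq ?_)
    rw [add_sub_add_left_eq_sub, sub_self, norm_zero]
    push_cast
    ring
  obtain ⟨Z, hZc, hZ⟩ := exists_continuous_flow β hβc _ hβL
  have hXc : Continuous fun q : ℝ × H × C(ℝ≥0, H) × ℝ =>
      q.2.1 + q.2.2.1 q.2.2.2.toNNReal + Z (q.1, q.2.1, q.2.2.1) q.2.2.2 :=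
    ((by fun_prop : Continuous fun q : ℝ × H × C(ℝ≥0, H) × ℝ => q.2.1).add
      (heval (fun q : ℝ × H × C(ℝ≥0, H) × ℝ => q.2.2.1) (fun q => q.2.2.2)
        (by fun_prop) (by fun_prop))).add
      (hZc.comp ((by fun_prop : Continuous fun q : ℝ × H × C(ℝ≥0, H) × ℝ =>
        ((q.1, q.2.1, q.2.2.1), q.2.2.2))))
  refine ⟨fun t x n s => x + n s.toNNReal + Z (t, x, n) s, hXc, fun t x n S => ?_⟩
  have hc : Continuous fun s => x + n s.toNNReal + Z (t, x, n) s :=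
    hXc.comp (by fun_prop : Continuous fun s : ℝ => (t, x, n, s))
  refine ⟨hc.continuousOn, Continuous.intervalIntegrable ?_ _ _, fun s hs => ?_⟩
  · exact (hF.continuous.comp (hc.prodMk (hU.continuous.comp
      ((by fun_prop : Continuous fun r : ℝ => t - r).prodMk hc)))).neg
  · simp only [hZ _ s hs.1, hβ]

open Classical in
/-- The characteristics of the master equation for the function `U`, as a function of the final
time `t`, the starting point `x`, the noise path and the current time. Only meaningful if `U` is
regular and `F` is Lipschitz (and `0` otherwise). -/
noncomputable def flow (F : H × H → H) (U : ℝ → H → H) : ℝ → H → C(ℝ≥0, H) → ℝ → H :=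
  if h : ∃ X : ℝ → H → C(ℝ≥0, H) → ℝ → H,
      Continuous (fun q : ℝ × H × C(ℝ≥0, H) × ℝ => X q.1 q.2.1 q.2.2.1 q.2.2.2) ∧
      ∀ t x n S, IsPath F U t x n S (X t x n)
  then h.choose else fun _ _ _ _ => 0

/-- The payoff of the Feynman-Kac formula as a function of the noise path. -/
noncomputable def payoff (F G : H × H → H) (U : ℝ → H → H) (U₀ : H → H) (t : ℝ) (x : H)
    (n : C(ℝ≥0, H)) : H :=
  reward G U U₀ t (flow F U t x n)

section

variable [CompleteSpace H] {F G : H × H → H} {LF LG K K₀ : ℝ≥0} {U V : ℝ → H → H} {U₀ : H → H}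

theorem continuous_flow (hF : LipschitzWith LF F) (hU : IsRegular K U) :
    Continuous (fun q : ℝ × H × C(ℝ≥0, H) × ℝ => flow F U q.1 q.2.1 q.2.2.1 q.2.2.2) := by
  have h := exists_flow hF hU
  rw [flow, dif_pos h]
  exact h.choose_spec.1

theorem isPath_flow (hF : LipschitzWith LF F) (hU : IsRegular K U) (t : ℝ) (x : H)
    (n : C(ℝ≥0, H)) (S : ℝ) : IsPath F U t x n S (flow F U t x n) := by
  have h := exists_flow hF hU
  rw [flow, dif_pos h]
  exact h.choose_spec.2 t x n S

theorem continuous_flow_apply (hF : LipschitzWith LF F) (hU : IsRegular K U) (t : ℝ) (x : H)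
    (n : C(ℝ≥0, H)) : Continuous (flow F U t x n) :=
  (continuous_flow hF hU).comp (by fun_prop : Continuous fun s : ℝ => (t, x, n, s))

theorem continuous_coeff_flow (hF : LipschitzWith LF F) (hG : LipschitzWith LG G)
    (hU : IsRegular K U) (t : ℝ) (x : H) (n : C(ℝ≥0, H)) :
    Continuous fun s => G (flow F U t x n s, U (t - s) (flow F U t x n s)) := by
  have h := continuous_flow_apply hF hU t x n
  exact hG.continuous.comp (h.prodMk (hU.continuous.comp
    ((by fun_prop : Continuous fun r : ℝ => t - r).prodMk h)))

/-- Paths are determined by `U` on the relevant times. -/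
theorem IsPath.eq_flow (hF : LipschitzWith LF F) (hU : IsRegular K U) {t : ℝ} {x : H}
    {n m : C(ℝ≥0, H)} {S : ℝ} {X : ℝ → H} (hX : IsPath F V t x m S X)
    (hnm : ∀ s ∈ Set.Icc 0 S, n s.toNNReal = m s.toNNReal)
    (hUV : ∀ r ∈ Set.Icc 0 S, ∀ y, U (t - r) y = V (t - r) y) :
    ∀ s ∈ Set.Icc 0 S, X s = flow F U t x n s := by
  intro s hs
  have := (isPath_flow hF hU t x n S).norm_sub_le hF hX (fun r _ => hU.lipschitz _) (a := 0)
    (fun s hs => by simp [hnm s hs]) (D := fun _ => 0) intervalIntegrable_const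
    (fun r hr => by simp [hUV r hr]) s hs
  simp only [intervalIntegral.integral_zero, mul_zero, add_zero, zero_mul] at this
  exact (sub_eq_zero.1 (norm_le_zero_iff.1 this)).symm

theorem continuous_payoff (hF : LipschitzWith LF F) (hG : LipschitzWith LG G)
    (hU₀ : LipschitzWith K₀ U₀) (hU : IsRegular K U) :
    Continuous fun q : ℝ × H × C(ℝ≥0, H) => payoff F G U U₀ q.1 q.2.1 q.2.2 := by
  have hX := continuous_flow hF hU
  unfold payoff reward
  refine Continuous.add ?_ (hU₀.continuous.comp (hX.comp
    (by fun_prop : Continuous fun q : ℝ × H × C(ℝ≥0, H) => (q.1, q.2.1, q.2.2, q.1))))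
  refine intervalIntegral.continuous_parametric_intervalIntegral_of_continuous ?_ continuous_fst
  have h1 : Continuous fun q : (ℝ × H × C(ℝ≥0, H)) × ℝ => flow F U q.1.1 q.1.2.1 q.1.2.2 q.2 :=
    hX.comp (by fun_prop : Continuous fun q : (ℝ × H × C(ℝ≥0, H)) × ℝ =>
      (q.1.1, q.1.2.1, q.1.2.2, q.2))
  exact hG.continuous.comp (h1.prodMk (hU.continuous.comp
    ((by fun_prop : Continuous fun q : (ℝ × H × C(ℝ≥0, H)) × ℝ => q.1.1 - q.2).prodMk h1)))

theorem norm_payoff_sub_le (hF : LipschitzWith LF F) (hG : LipschitzWith LG G)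
    (hU₀ : LipschitzWith K₀ U₀) (hU : IsRegular K U) {t : ℝ} (ht : 0 ≤ t) (x y : H)
    (n : C(ℝ≥0, H)) :
    ‖payoff F G U U₀ t x n - payoff F G U U₀ t y n‖ ≤
      (LG * (1 + K) * t + K₀) * Real.exp (LF * (1 + K) * t) * ‖x - y‖ := by
  have h1 : ∀ s ∈ Set.Icc 0 t, ‖flow F U t x n s - flow F U t y n s‖ ≤
      ‖x - y‖ * Real.exp (LF * (1 + K) * t) := by
    intro s hs
    have := (isPath_flow hF hU t x n t).norm_sub_le hF (isPath_flow hF hU t y n t)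
      (fun r _ => hU.lipschitz _) (a := ‖x - y‖) (fun s _ => by simp) (D := fun _ => 0)
      intervalIntegrable_const (fun r _ => by simp) s hs
    simp only [intervalIntegral.integral_zero, mul_zero, add_zero] at this
    refine this.trans ?_
    gcongr
    exact hs.2
  refine (norm_reward_sub_le hG hU₀ ht (fun r _ => hU.lipschitz _)
    ((continuous_coeff_flow hF hG hU t x n).intervalIntegrable _ _)
    ((continuous_coeff_flow hF hG hU t y n).intervalIntegrable _ _) h1 (D := fun _ => 0)
    intervalIntegrable_const (fun r _ => by simp)).trans (le_of_eq ?_)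
  simp only [intervalIntegral.integral_zero, add_zero]
  ring

theorem norm_flow_le (hF : LipschitzWith LF F) (hU : IsRegular K U) {t c₀ : ℝ} (ht : 0 ≤ t)
    (hc₀ : ∀ r ∈ Set.Icc 0 t, ‖U r 0‖ ≤ c₀) (x : H) {n : C(ℝ≥0, H)} {m : ℝ}
    (hm : ∀ s ∈ Set.Icc 0 t, ‖n s.toNNReal‖ ≤ m) :
    ∀ s ∈ Set.Icc 0 t, ‖flow F U t x n s‖ ≤
      (‖x‖ + m + t * (‖F 0‖ + LF * c₀)) * Real.exp (LF * (1 + K) * t) := by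
  intro s hs
  have hc : 0 ≤ c₀ := (norm_nonneg _).trans (hc₀ t ⟨ht, le_rfl⟩)
  have hm0 : 0 ≤ m := (norm_nonneg _).trans (hm t ⟨ht, le_rfl⟩)
  refine ((isPath_flow hF hU t x n t).norm_le hF (fun r _ => hU.lipschitz _) hm
    (φ := fun _ => ‖F 0‖ + LF * c₀) intervalIntegrable_const (fun r hr => ?_) s hs).trans ?_
  · have h1 := norm_sub_le_of_lipschitz_prod hF 0 0 (U (t - r) 0) 0
    have h2 := norm_le_norm_add_norm_sub' (F (0, U (t - r) 0)) (F (0, 0))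
    have h3 : (LF : ℝ) * ‖U (t - r) 0‖ ≤ LF * c₀ := by
      gcongr
      exact hc₀ _ ⟨by linarith [hr.2], by linarith [hr.1]⟩
    simp only [sub_self, norm_zero, zero_add, sub_zero] at h1
    have h4 : ‖F (0, 0)‖ = ‖F 0‖ := rfl
    linarith
  · rw [intervalIntegral.integral_const, smul_eq_mul, sub_zero]
    gcongr
    exact hs.2

theorem norm_payoff_le (hF : LipschitzWith LF F) (hG : LipschitzWith LG G)
    (hU₀ : LipschitzWith K₀ U₀) (hU : IsRegular K U) {t c₀ : ℝ} (ht : 0 ≤ t)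
    (hc₀ : ∀ r ∈ Set.Icc 0 t, ‖U r 0‖ ≤ c₀) (x : H) {n : C(ℝ≥0, H)} {m : ℝ}
    (hm : ∀ s ∈ Set.Icc 0 t, ‖n s.toNNReal‖ ≤ m) :
    ‖payoff F G U U₀ t x n‖ ≤ t * (‖G 0‖ + LG * c₀) + ‖U₀ 0‖ + (LG * (1 + K) * t + K₀) *
      ((‖x‖ + m + t * (‖F 0‖ + LF * c₀)) * Real.exp (LF * (1 + K) * t)) := by
  refine (norm_reward_le hG hU₀ ht (fun r _ => hU.lipschitz _) (norm_flow_le hF hU ht hc₀ x hm)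
    (γ := fun _ => ‖G 0‖ + LG * c₀) intervalIntegrable_const (fun r hr => ?_)).trans (le_of_eq ?_)
  · have h1 := norm_sub_le_of_lipschitz_prod hG 0 0 (U (t - r) 0) 0
    have h2 := norm_le_norm_add_norm_sub' (G (0, U (t - r) 0)) (G (0, 0))
    have h3 : (LG : ℝ) * ‖U (t - r) 0‖ ≤ LG * c₀ := by
      gcongr
      exact hc₀ _ ⟨by linarith [hr.2], by linarith [hr.1]⟩
    simp only [sub_self, norm_zero, zero_add, sub_zero] at h1
    have h4 : ‖G (0, 0)‖ = ‖G 0‖ := rfl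
    linarith
  · rw [intervalIntegral.integral_const, smul_eq_mul, sub_zero]
    ring

end

/-- The exponential weight in time turns the comparison of payoffs into a contraction: if `U` and
`V` differ at time `r` by at most `c e^{lr} (1 + |y|)`, the payoffs along paths bounded by `ρ`
differ by a multiple of `c e^{lt} (1 + ρ) / l`. -/
theorem norm_reward_sub_le_exp {F G : H × H → H} {LF LG K K₀ : ℝ≥0} {U V : ℝ → H → H}
    {U₀ : H → H} (hF : LipschitzWith LF F) (hG : LipschitzWith LG G)
    (hU₀ : LipschitzWith K₀ U₀) {t T c l ρ : ℝ} (ht : 0 ≤ t) (htT : t ≤ T) (hc : 0 ≤ c) (hl : 0 < l)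
    (hU : ∀ r ∈ Set.Icc 0 t, LipschitzWith K (U r)) {x : H} {n : C(ℝ≥0, H)} {X Y : ℝ → H}
    (hX : IsPath F U t x n t X) (hY : IsPath F V t x n t Y)
    (hXi : IntervalIntegrable (fun s => G (X s, U (t - s) (X s))) volume 0 t)
    (hYi : IntervalIntegrable (fun s => G (Y s, V (t - s) (Y s))) volume 0 t)
    (hρ : ∀ s ∈ Set.Icc 0 t, ‖Y s‖ ≤ ρ)
    (hUV : ∀ r ∈ Set.Icc 0 t, ∀ y, ‖U r y - V r y‖ ≤ c * (Real.exp (l * r) * (1 + ‖y‖))) :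
    ‖reward G U U₀ t X - reward G V U₀ t Y‖ ≤
      (LG * ((1 + K) * (LF * Real.exp (LF * (1 + K) * T)) * T + 1) +
        K₀ * (LF * Real.exp (LF * (1 + K) * T))) * (c * Real.exp (l * t) / l * (1 + ρ)) := by
  have hρ0 : 0 ≤ ρ := (norm_nonneg _).trans (hρ t ⟨ht, le_rfl⟩)
  have hmem : ∀ r ∈ Set.Icc 0 t, t - r ∈ Set.Icc 0 t := fun r hr =>
    ⟨by linarith [hr.2], by linarith [hr.1]⟩
  set D : ℝ → ℝ := fun r => c * (1 + ρ) * Real.exp (l * (t - r)) with hD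
  have hDc : Continuous D := by fun_prop
  have hUVD : ∀ r ∈ Set.Icc 0 t, ‖U (t - r) (Y r) - V (t - r) (Y r)‖ ≤ D r := by
    intro r hr
    refine (hUV _ (hmem r hr) (Y r)).trans ?_
    have h := hρ r hr
    calc c * (Real.exp (l * (t - r)) * (1 + ‖Y r‖))
        ≤ c * (Real.exp (l * (t - r)) * (1 + ρ)) := by gcongr
      _ = D r := by simp only [hD]; ring
  have hDint : ∫ r in (0 : ℝ)..t, D r ≤ c * Real.exp (l * t) / l * (1 + ρ) := by
    have hder : ∀ r, HasDerivAt (fun r => -(c * (1 + ρ) / l) * Real.exp (l * (t - r))) (D r) r := by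
      intro r
      have h1 : HasDerivAt (fun r : ℝ => l * (t - r)) (-l) r := by
        simpa using ((hasDerivAt_id r).const_sub t).const_mul l
      have h2 := h1.exp.const_mul (-(c * (1 + ρ) / l))
      rwa [show -(c * (1 + ρ) / l) * (Real.exp (l * (t - r)) * -l) = D r by
        simp only [hD]; field_simp] at h2
    rw [intervalIntegral.integral_eq_sub_of_hasDerivAt (fun r _ => hder r)
      (hDc.intervalIntegrable _ _)]
    have : 0 ≤ c * (1 + ρ) / l := by positivity
    simp only [sub_self, mul_zero, Real.exp_zero, sub_zero]
    calc _ ≤ c * (1 + ρ) / l * Real.exp (l * t) := by linarith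
      _ = _ := by ring
  set I := c * Real.exp (l * t) / l * (1 + ρ) with hI
  have hI0 : 0 ≤ I := by positivity
  set E := LF * Real.exp (LF * (1 + K) * T) with hE
  have hdist : ∀ s ∈ Set.Icc 0 t, ‖X s - Y s‖ ≤ E * I := by
    intro s hs
    refine (hX.norm_sub_le hF hY (fun r hr => hU _ (hmem r hr)) (a := 0) (fun s _ => by simp)
      (hDc.intervalIntegrable _ _) hUVD s hs).trans ?_
    calc (0 + LF * ∫ r in (0 : ℝ)..t, D r) * Real.exp (LF * (1 + K) * s)
        ≤ (0 + LF * I) * Real.exp (LF * (1 + K) * T) := by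
          gcongr
          exact hs.2.trans htT
      _ = E * I := by simp only [hE]; ring
  refine (norm_reward_sub_le hG hU₀ ht (fun r hr => hU _ (hmem r hr)) hXi hYi hdist
    (hDc.intervalIntegrable _ _) hUVD).trans ?_
  have hE0 : 0 ≤ E := by positivity
  calc (LG : ℝ) * ((1 + K) * (E * I) * t + ∫ r in (0 : ℝ)..t, D r) + K₀ * (E * I)
      ≤ LG * ((1 + K) * (E * I) * T + I) + K₀ * (E * I) := by gcongr
    _ = _ := by ring

end Flow

/-! ### Mild solutions and their existence for short times -/

section Mild

variable {H : Type*} [NormedAddCommGroup H] [NormedSpace ℝ H] {Ω : Type*} [MeasurableSpace Ω]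

/-- A random continuous path in `H` whose maximum on bounded time intervals is dominated by an
integrable random variable. -/
structure IsIntegrableNoise (P : Measure Ω) (N : Ω → C(ℝ≥0, H)) : Prop where
  aestronglyMeasurable : AEStronglyMeasurable N P
  bound : ∀ T : ℝ, ∃ M : Ω → ℝ, Integrable M P ∧ (∀ ω, 0 ≤ M ω) ∧
    ∀ᵐ ω ∂P, ∀ s ∈ Set.Icc 0 T, ‖N ω s.toNNReal‖ ≤ M ω

/-- `U` is regular on the whole real line and satisfies on `[0, α]` the Feynman-Kac formula along
the characteristics constructed pathwise from the noise `N`. -/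
structure IsMild (P : Measure Ω) (N : Ω → C(ℝ≥0, H)) (F G : H × H → H) (U₀ : H → H) (α : ℝ)
    (K : ℝ≥0) (U : ℝ → H → H) : Prop where
  regular : IsRegular K U
  eq : ∀ t ∈ Set.Icc 0 α, ∀ x, U t x = ∫ ω, payoff F G U U₀ t x (N ω) ∂P

theorem integral_const_add_const_mul {P : Measure Ω} [IsProbabilityMeasure P] {M : Ω → ℝ}
    (hM : Integrable M P) (a b : ℝ) : ∫ ω, (a + b * M ω) ∂P = a + b * ∫ ω, M ω ∂P := by
  rw [integral_add (integrable_const _) (hM.const_mul b), integral_const_mul]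
  simp

variable [CompleteSpace H] {P : Measure Ω} [IsProbabilityMeasure P] {N : Ω → C(ℝ≥0, H)}
  {F G : H × H → H} {LF LG K K₀ : ℝ≥0} {U V : ℝ → H → H} {U₀ : H → H}

theorem IsRegular.exists_bound {H : Type*} [NormedAddCommGroup H] {K : ℝ≥0} {U : ℝ → H → H}
    (hU : IsRegular K U) (T : ℝ) :
    ∃ c₀, 0 ≤ c₀ ∧ ∀ r ∈ Set.Icc 0 T, ‖U r 0‖ ≤ c₀ := by
  have hc : Continuous fun r => U r 0 :=
    hU.continuous.comp (by fun_prop : Continuous fun r : ℝ => (r, (0 : H)))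
  obtain ⟨c, hc⟩ := isCompact_Icc.exists_bound_of_continuousOn (s := Set.Icc 0 T) hc.continuousOn
  exact ⟨max c 0, le_max_right _ _, fun r hr => (hc r hr).trans (le_max_left _ _)⟩

/-- Linear growth of characteristics and payoff, with a constant that is uniform over the functions
`U` with a given Lipschitz constant and a given bound at the origin. -/
theorem exists_growth_bound (hF : LipschitzWith LF F) (hG : LipschitzWith LG G)
    (hU₀ : LipschitzWith K₀ U₀) (K : ℝ≥0) {T c₀ : ℝ} (hT : 0 ≤ T) (hc₀ : 0 ≤ c₀) :
    ∃ R, 0 ≤ R ∧ ∀ U, IsRegular K U → (∀ r ∈ Set.Icc 0 T, ‖U r 0‖ ≤ c₀) →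
      ∀ t ∈ Set.Icc 0 T, ∀ (x : H) (n : C(ℝ≥0, H)) (m : ℝ),
        (∀ s ∈ Set.Icc 0 T, ‖n s.toNNReal‖ ≤ m) →
        (∀ s ∈ Set.Icc 0 t, ‖flow F U t x n s‖ ≤ R * (1 + ‖x‖ + m)) ∧
        ‖payoff F G U U₀ t x n‖ ≤ R * (1 + ‖x‖ + m) := by
  set E := Real.exp (LF * (1 + K) * T) with hE
  set f := T * (‖F 0‖ + LF * c₀) with hf
  set g := T * (‖G 0‖ + LG * c₀) + ‖U₀ 0‖ with hg
  have hf0 : 0 ≤ f := by positivity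
  have hg0 : 0 ≤ g := by positivity
  have hE0 : 0 ≤ E := (Real.exp_pos _).le
  set Q := (LG * (1 + K) * T + K₀ : ℝ) with hQ
  have hQ0 : 0 ≤ Q := by positivity
  refine ⟨g + (Q + 1) * ((1 + f) * E), by positivity, fun U hU hUc t ht x n m hm => ?_⟩
  have hm0 : 0 ≤ m := (norm_nonneg _).trans (hm 0 ⟨le_rfl, hT⟩)
  have hUc' : ∀ r ∈ Set.Icc 0 t, ‖U r 0‖ ≤ c₀ := fun r hr => hUc r ⟨hr.1, hr.2.trans ht.2⟩
  have hm' : ∀ s ∈ Set.Icc 0 t, ‖n s.toNNReal‖ ≤ m := fun r hr => hm r ⟨hr.1, hr.2.trans ht.2⟩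
  have hx := norm_nonneg x
  have ht0 := ht.1
  have hflow : (‖x‖ + m + t * (‖F 0‖ + LF * c₀)) * Real.exp (LF * (1 + K) * t) ≤
      (1 + f) * E * (1 + ‖x‖ + m) := by
    have h1 : t * (‖F 0‖ + LF * c₀) ≤ f := mul_le_mul_of_nonneg_right ht.2 (by positivity)
    have h2 : Real.exp (LF * (1 + K) * t) ≤ E := by
      rw [hE]; gcongr; exact ht.2
    calc _ ≤ ((1 + f) * (1 + ‖x‖ + m)) * E := by
          refine mul_le_mul ?_ h2 (Real.exp_pos _).le (by positivity)
          nlinarith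
      _ = _ := by ring
  refine ⟨fun s hs => ((norm_flow_le hF hU ht.1 hUc' x hm' s hs).trans hflow).trans ?_, ?_⟩
  · gcongr
    have : 0 ≤ Q * ((1 + f) * E) := by positivity
    linarith
  · refine (norm_payoff_le hF hG hU₀ hU ht.1 hUc' x hm').trans ?_
    have h1 : t * (‖G 0‖ + LG * c₀) ≤ T * (‖G 0‖ + LG * c₀) :=
      mul_le_mul_of_nonneg_right ht.2 (by positivity)
    have h2 : (LG * (1 + K) * t + K₀ : ℝ) ≤ Q := by
      rw [hQ]; gcongr; exact ht.2
    have h3 := mul_le_mul h2 hflow (by positivity) hQ0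
    have h4 : g ≤ g * (1 + ‖x‖ + m) := by nlinarith
    have h5 : 0 ≤ (1 + f) * E * (1 + ‖x‖ + m) := by positivity
    nlinarith

theorem aestronglyMeasurable_payoff {P : Measure Ω} (hN : IsIntegrableNoise P N)
    (hF : LipschitzWith LF F) (hG : LipschitzWith LG G) (hU₀ : LipschitzWith K₀ U₀)
    (hU : IsRegular K U)
    (t : ℝ) (x : H) :
    AEStronglyMeasurable (fun ω => payoff F G U U₀ t x (N ω)) P :=
  ((continuous_payoff hF hG hU₀ hU).comp (by fun_prop : Continuous fun n : C(ℝ≥0, H) =>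
    (t, x, n))).comp_aestronglyMeasurable hN.aestronglyMeasurable

theorem integrable_payoff (hN : IsIntegrableNoise P N) (hF : LipschitzWith LF F)
    (hG : LipschitzWith LG G) (hU₀ : LipschitzWith K₀ U₀) (hU : IsRegular K U) {t : ℝ}
    (ht : 0 ≤ t) (x : H) : Integrable (fun ω => payoff F G U U₀ t x (N ω)) P := by
  obtain ⟨c₀, hc₀, hUc⟩ := hU.exists_bound t
  obtain ⟨R, hR, hb⟩ := exists_growth_bound hF hG hU₀ K ht hc₀
  obtain ⟨M, hM, -, hMN⟩ := hN.bound t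
  refine Integrable.mono' (g := fun ω => R * (1 + ‖x‖ + M ω))
    (((integrable_const _).add hM).const_mul R)
    (aestronglyMeasurable_payoff hN hF hG hU₀ hU t x) ?_
  filter_upwards [hMN] with ω hω
  exact (hb U hU hUc t ⟨ht, le_rfl⟩ x (N ω) (M ω) hω).2

/-- The map whose fixed points are the mild solutions. The time is clamped to `[0, h]`. -/
noncomputable def mildMap (P : Measure Ω) (N : Ω → C(ℝ≥0, H)) (F G : H × H → H) (U₀ : H → H)
    (h : ℝ) (u : ℝ × H → H) (q : ℝ × H) : H :=
  ∫ ω, payoff F G (fun t x => u (t, x)) U₀ (max 0 (min q.1 h)) q.2 (N ω) ∂P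

theorem continuous_mildMap (hN : IsIntegrableNoise P N) (hF : LipschitzWith LF F)
    (hG : LipschitzWith LG G) (hU₀ : LipschitzWith K₀ U₀) {h : ℝ} (hh : 0 ≤ h) {u : ℝ × H → H}
    (hu : IsRegular K fun t x => u (t, x)) : Continuous (mildMap P N F G U₀ h u) := by
  obtain ⟨c₀, hc₀, hUc⟩ := hu.exists_bound h
  obtain ⟨R, hR, hb⟩ := exists_growth_bound hF hG hU₀ K hh hc₀
  obtain ⟨M, hM, -, hMN⟩ := hN.bound h
  rw [continuous_iff_continuousAt]
  rintro ⟨t, x⟩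
  refine continuousAt_of_dominated (bound := fun ω => R * (1 + (‖x‖ + 1) + M ω))
    (Eventually.of_forall fun q => aestronglyMeasurable_payoff hN hF hG hU₀ hu _ _) ?_
    (((integrable_const _).add hM).const_mul R) ?_
  · have hnear : ∀ᶠ q : ℝ × H in 𝓝 (t, x), ‖q.2‖ < ‖x‖ + 1 :=
      continuous_snd.norm.continuousAt.eventually (gt_mem_nhds (lt_add_one _))
    filter_upwards [hnear] with q hq
    filter_upwards [hMN] with ω hω
    refine (hb _ hu hUc _ ⟨le_max_left _ _, max_le hh (min_le_right _ _)⟩ q.2 (N ω) (M ω)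
      hω).2.trans ?_
    gcongr
  · refine Eventually.of_forall fun ω => Continuous.continuousAt ?_
    exact (continuous_payoff hF hG hU₀ hu).comp (by fun_prop :
      Continuous fun q : ℝ × H => (max 0 (min q.1 h), q.2, N ω))

/-- Comparison of the expected payoffs of two functions, one of them regular and the other one
arbitrary, in the distance with weight `e^{lt} (1 + |x|)`. For large `l` it is a contraction. The
paths and the payoff of the arbitrary function are given. -/
theorem exists_contraction (hN : IsIntegrableNoise P N) (hF : LipschitzWith LF F)
    (hG : LipschitzWith LG G) (hU₀ : LipschitzWith K₀ U₀) (K K' : ℝ≥0) {T c₀ : ℝ} (hT : 0 ≤ T)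
    (hc₀ : 0 ≤ c₀) :
    ∃ l : ℝ, 0 ≤ l ∧ ∀ U V : ℝ → H → H, ∀ t ∈ Set.Icc 0 T,
      (∀ r ∈ Set.Icc 0 t, LipschitzWith K (U r)) → IsRegular K' V →
      (∀ r ∈ Set.Icc 0 T, ‖V r 0‖ ≤ c₀) → ∀ (x : H) (X : ℝ → Ω → H),
      (∀ᵐ ω ∂P, IsPath F U t x (N ω) t (fun s => X s ω)) →
      (∀ᵐ ω ∂P, IntervalIntegrable (fun s => G (X s ω, U (t - s) (X s ω))) volume 0 t) →
      Integrable (fun ω => reward G U U₀ t (fun s => X s ω)) P → ∀ c, 0 ≤ c →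
      (∀ r ∈ Set.Icc 0 t, ∀ y, ‖U r y - V r y‖ ≤ c * (Real.exp (l * r) * (1 + ‖y‖))) →
      ‖(∫ ω, reward G U U₀ t (fun s => X s ω) ∂P) - ∫ ω, payoff F G V U₀ t x (N ω) ∂P‖ ≤
        c / 2 * (Real.exp (l * t) * (1 + ‖x‖)) := by
  obtain ⟨R, hR, hb⟩ := exists_growth_bound hF hG hU₀ K' hT hc₀
  obtain ⟨M, hM, hM0, hMN⟩ := hN.bound T
  set μ := ∫ ω, M ω ∂P with hμ
  have hμ0 : 0 ≤ μ := integral_nonneg hM0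
  set C := (LG * ((1 + K) * (LF * Real.exp (LF * (1 + K) * T)) * T + 1) +
        K₀ * (LF * Real.exp (LF * (1 + K) * T)) : ℝ) with hC
  have hC0 : 0 ≤ C := by positivity
  set l := 2 * C * (1 + R) * (1 + μ) + 1 with hl
  have hl0 : 0 < l := by positivity
  refine ⟨l, hl0.le, fun U V t ht hU hV hVc x X hX hXi hXint c hc hUV => ?_⟩
  rw [← integral_sub hXint (integrable_payoff hN hF hG hU₀ hV ht.1 x)]
  have hx := norm_nonneg x
  calc _ ≤ ∫ ω, C * (c * Real.exp (l * t) / l) * (1 + R * (1 + ‖x‖ + M ω)) ∂P := by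
        refine norm_integral_le_of_norm_le (((integrable_const _).add
          (((integrable_const _).add hM).const_mul R)).const_mul _) ?_
        filter_upwards [hX, hXi, hMN] with ω h1 h2 h3
        have := norm_reward_sub_le_exp hF hG hU₀ ht.1 ht.2 hc hl0 hU h1
          (isPath_flow hF hV t x (N ω) t) h2
          ((continuous_coeff_flow hF hG hV t x (N ω)).intervalIntegrable _ _)
          (hb V hV hVc t ht x (N ω) (M ω) h3).1 hUV
        rw [mul_assoc]
        exact this
    _ = C * (c * Real.exp (l * t) / l) * (1 + R * (1 + ‖x‖ + μ)) := by
        rw [integral_const_mul, show (fun ω => 1 + R * (1 + ‖x‖ + M ω)) =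
          fun ω => (1 + R * (1 + ‖x‖)) + R * M ω by ext; ring, integral_const_add_const_mul hM]
        ring
    _ ≤ C * (c * Real.exp (l * t) / l) * ((1 + R) * (1 + μ) * (1 + ‖x‖)) := by
        gcongr
        nlinarith [mul_nonneg hR hμ0, mul_nonneg hμ0 hx, mul_nonneg (mul_nonneg hR hμ0) hx]
    _ = c * Real.exp (l * t) * (1 + ‖x‖) * (C * (1 + R) * (1 + μ) / l) := by ring
    _ ≤ c * Real.exp (l * t) * (1 + ‖x‖) * (1 / 2) := by
        have h2 : C * (1 + R) * (1 + μ) / l ≤ 1 / 2 := by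
          rw [div_le_div_iff₀ hl0 two_pos, hl]
          linarith
        gcongr
    _ = _ := by ring

/-- The class of functions in which mild solutions are sought is closed. -/
theorem isRegular_of_weighted_limit {H : Type*} [NormedAddCommGroup H] {K : ℝ≥0} {h l : ℝ}
    {u : ℕ → ℝ × H → H} {v : ℝ × H → H}
    (hu : ∀ k, IsRegular K fun t x => u k (t, x))
    (huv : ∀ ε > 0, ∀ᶠ k in atTop, ∀ q : ℝ × H,
      ‖u k q - v q‖ ≤ ε * (Real.exp (l * max 0 (min q.1 h)) * (1 + ‖q.2‖))) :
    IsRegular K (fun t x => v (t, x)) ∧ ∀ q, Tendsto (fun k => u k q) atTop (𝓝 (v q)) := by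
  set w : ℝ × H → ℝ := fun q => Real.exp (l * max 0 (min q.1 h)) * (1 + ‖q.2‖) with hw
  have hwc : Continuous w := by fun_prop
  have hw0 : ∀ q, 0 ≤ w q := fun q => by positivity
  have hsmall : ∀ q : ℝ × H, ∀ ε > 0, ∀ᶠ r in 𝓝 q, ∀ᶠ k in atTop, ‖u k r - v r‖ < ε := by
    intro q ε hε
    have hnear : ∀ᶠ r in 𝓝 q, w r < w q + 1 :=
      hwc.continuousAt.eventually (gt_mem_nhds (lt_add_one _))
    have hpos : 0 < w q + 1 := by linarith [hw0 q]
    filter_upwards [hnear] with r hr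
    filter_upwards [huv (ε / (w q + 1)) (by positivity)] with k hk
    calc ‖u k r - v r‖ ≤ ε / (w q + 1) * w r := hk r
      _ < ε / (w q + 1) * (w q + 1) := by
        gcongr
      _ = ε := div_mul_cancel₀ _ hpos.ne'
  have htend : ∀ q, Tendsto (fun k => u k q) atTop (𝓝 (v q)) := by
    intro q
    refine Metric.tendsto_nhds.2 fun ε hε => ?_
    filter_upwards [(hsmall q ε hε).self_of_nhds] with k hk
    rwa [dist_eq_norm]
  refine ⟨⟨?_, fun t => LipschitzWith.of_dist_le_mul fun x y => ?_⟩, htend⟩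
  · refine continuous_of_locally_uniform_approx_of_continuousAt fun q A hA => ?_
    obtain ⟨ε, hε, hεA⟩ := Metric.mem_uniformity_dist.1 hA
    have hnear : ∀ᶠ r in 𝓝 q, w r < w q + 1 :=
      hwc.continuousAt.eventually (gt_mem_nhds (lt_add_one _))
    have hpos : 0 < w q + 1 := by linarith [hw0 q]
    obtain ⟨k, hk⟩ := (huv (ε / (w q + 1)) (by positivity)).exists
    refine ⟨_, hnear, u k, (hu k).continuous.continuousAt, fun r hr => hεA ?_⟩
    rw [dist_comm, dist_eq_norm]
    calc ‖u k r - v r‖ ≤ ε / (w q + 1) * w r := hk r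
      _ < ε / (w q + 1) * (w q + 1) := by
        gcongr
        exact hr
      _ = ε := div_mul_cancel₀ _ hpos.ne'
  · exact le_of_tendsto ((htend (t, x)).dist (htend (t, y)))
      (Eventually.of_forall fun k => ((hu k).lipschitz t).dist_le_mul x y)

/-- Existence of mild solutions on a time interval whose length depends on the initial value only
through its Lipschitz constant. -/
theorem exists_isMild (hN : IsIntegrableNoise P N) (hF : LipschitzWith LF F)
    (hG : LipschitzWith LG G) (K₀ : ℝ≥0) :
    ∃ h : ℝ, 0 < h ∧ ∀ U₀ : H → H, LipschitzWith K₀ U₀ →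
      ∃ U, IsMild P N F G U₀ h (2 * K₀ + 2) U := by
  set K : ℝ≥0 := 2 * K₀ + 2 with hK
  obtain ⟨M, hM, hM0, hMN⟩ := hN.bound 1
  set μ := ∫ ω, M ω ∂P with hμ
  have hμ0 : 0 ≤ μ := integral_nonneg hM0
  set E := Real.exp (LF * (1 + K)) with hE
  set B := (LG + (LG * (1 + K) + K₀) * LF * E : ℝ) with hB
  -- The first condition preserves the Lipschitz constant `K`, the last one the bound at the origin.
  obtain ⟨h, ⟨hLip, h1, hhB⟩, hh⟩ : ∃ h : ℝ, (((LG * (1 + K) * h + K₀) *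
      Real.exp (LF * (1 + K) * h) < K) ∧ h < 1 ∧ h * B < 1 / 2) ∧ 0 < h := by
    have c1 : Continuous fun h : ℝ => (LG * (1 + K) * h + K₀ : ℝ) *
      Real.exp (LF * (1 + K) * h) := by fun_prop
    have e1 : ∀ᶠ h : ℝ in 𝓝 0, (LG * (1 + K) * h + K₀) * Real.exp (LF * (1 + K) * h) < K := by
      refine c1.continuousAt.eventually (gt_mem_nhds ?_)
      simp only [mul_zero, zero_add, Real.exp_zero, mul_one, hK]
      push_cast
      linarith [K₀.2, NNReal.coe_nonneg K₀]
    have e2 : ∀ᶠ h : ℝ in 𝓝 0, h < 1 := gt_mem_nhds one_pos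
    have e3 : ∀ᶠ h : ℝ in 𝓝 0, h * B < 1 / 2 := by
      refine (by fun_prop : Continuous fun h : ℝ => h * B).continuousAt.eventually (gt_mem_nhds ?_)
      simp
    have := ((e1.and (e2.and e3)).filter_mono nhdsWithin_le_nhds).and
      (self_mem_nhdsWithin (a := (0 : ℝ)) (s := Set.Ioi 0))
    exact this.exists
  refine ⟨h, hh, fun U₀ hU₀ => ?_⟩
  set A := ‖G 0‖ + ‖U₀ 0‖ + (LG * (1 + K) + K₀) * ((μ + ‖F 0‖) * E) with hA
  have hA0 : 0 ≤ A := by positivity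
  set c₀ := 2 * A with hc₀
  have hc₀0 : 0 ≤ c₀ := by positivity
  have hclamp : ∀ t, max 0 (min t h) ∈ Set.Icc 0 h := fun t =>
    ⟨le_max_left _ _, max_le hh.le (min_le_right _ _)⟩
  have hclamp' : ∀ t ∈ Set.Icc 0 h, max 0 (min t h) = t := fun t ht => by
    rw [min_eq_left ht.2, max_eq_right ht.1]
  obtain ⟨l, hl0, hcontr⟩ := exists_contraction hN hF hG hU₀ K K hh.le hc₀0
  obtain ⟨R, hR, hb⟩ := exists_growth_bound hF hG hU₀ K hh.le hc₀0
  have hMN' : ∀ᵐ ω ∂P, ∀ s ∈ Set.Icc 0 h, ‖N ω s.toNNReal‖ ≤ M ω := by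
    filter_upwards [hMN] with ω hω s hs using hω s ⟨hs.1, hs.2.trans h1.le⟩
  set C : Set (ℝ × H → H) := {u | IsRegular K (fun t x => u (t, x)) ∧
    ∀ t ∈ Set.Icc 0 h, ‖u (t, 0)‖ ≤ c₀} with hC
  have hlipC : ∀ u ∈ C, ∀ t, LipschitzWith K (fun x => mildMap P N F G U₀ h u (t, x)) := by
    intro u hu t
    refine LipschitzWith.of_dist_le_mul fun x y => ?_
    have ht := hclamp t
    rw [dist_eq_norm, dist_eq_norm, mildMap, mildMap,
      ← integral_sub (integrable_payoff hN hF hG hU₀ hu.1 ht.1 x)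
        (integrable_payoff hN hF hG hU₀ hu.1 ht.1 y)]
    refine (norm_integral_le_of_norm_le_const (C := K * ‖x - y‖)
      (Eventually.of_forall fun ω => ?_)).trans (by simp)
    refine (norm_payoff_sub_le hF hG hU₀ hu.1 ht.1 x y (N ω)).trans ?_
    gcongr
    refine le_trans ?_ hLip.le
    have := ht.2
    gcongr
  have horigC : ∀ u ∈ C, ∀ t ∈ Set.Icc 0 h, ‖mildMap P N F G U₀ h u (t, 0)‖ ≤ c₀ := by
    intro u hu t ht
    simp only [mildMap, hclamp' t ht]
    set Q := (LG * (1 + K) + K₀ : ℝ) with hQ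
    have hQ0 : 0 ≤ Q := by positivity
    have hE0 : 0 ≤ E := (Real.exp_pos _).le
    have ht1 : t ≤ 1 := ht.2.trans h1.le
    have ht0 := ht.1
    have hth := ht.2
    calc _ ≤ ∫ ω, (‖G 0‖ + h * (LG * c₀) + ‖U₀ 0‖ +
          Q * ((M ω + (‖F 0‖ + h * (LF * c₀))) * E)) ∂P := by
          refine norm_integral_le_of_norm_le ((integrable_const _).add
            (((hM.add (integrable_const _)).mul_const E).const_mul Q)) ?_
          filter_upwards [hMN'] with ω hω
          have := norm_payoff_le hF hG hU₀ hu.1 ht.1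
            (fun r hr => hu.2 r ⟨hr.1, hr.2.trans ht.2⟩) 0
            (fun s hs => hω s ⟨hs.1, hs.2.trans ht.2⟩)
          refine this.trans ?_
          rw [norm_zero, zero_add]
          have hMω := hM0 ω
          have i1 : t * (‖G 0‖ + LG * c₀) ≤ ‖G 0‖ + h * (LG * c₀) := by
            rw [mul_add]
            gcongr
            exact mul_le_of_le_one_left (norm_nonneg _) ht1
          have i2 : t * (‖F 0‖ + LF * c₀) ≤ ‖F 0‖ + h * (LF * c₀) := by
            rw [mul_add]
            gcongr
            exact mul_le_of_le_one_left (norm_nonneg _) ht1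
          have i3 : (LG * (1 + K) * t + K₀ : ℝ) ≤ Q := by
            rw [hQ]
            exact add_le_add_left (mul_le_of_le_one_right (by positivity) ht1) _
          have i4 : Real.exp (LF * (1 + K) * t) ≤ E := by
            rw [hE]
            exact Real.exp_le_exp.2 (mul_le_of_le_one_right (by positivity) ht1)
          gcongr
      _ = ‖G 0‖ + h * (LG * c₀) + ‖U₀ 0‖ + Q * ((μ + (‖F 0‖ + h * (LF * c₀))) * E) := by
          rw [show (fun ω => ‖G 0‖ + h * (LG * c₀) + ‖U₀ 0‖ +
            Q * ((M ω + (‖F 0‖ + h * (LF * c₀))) * E)) = fun ω => (‖G 0‖ + h * (LG * c₀) + ‖U₀ 0‖ +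
            Q * ((‖F 0‖ + h * (LF * c₀)) * E)) + Q * E * M ω by ext; ring,
            integral_const_add_const_mul hM]
          ring
      _ = A + (h * B) * c₀ := by
          simp only [hA, hB, hQ]
          ring
      _ ≤ A + 1 / 2 * c₀ := by gcongr
      _ = c₀ := by rw [hc₀]; ring
  obtain ⟨u, huC, hu⟩ := exists_fixedPoint_of_weighted
    (fun q : ℝ × H => Real.exp (l * max 0 (min q.1 h)) * (1 + ‖q.2‖)) (fun q => by positivity)
    C (mildMap P N F G U₀ h)
    (fun u hu => ⟨⟨continuous_mildMap hN hF hG hU₀ hh.le hu.1, hlipC u hu⟩, horigC u hu⟩)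
    (fun u v hu huv => by
      obtain ⟨hv, hlim⟩ := isRegular_of_weighted_limit (fun k => (hu k).1) huv
      exact ⟨hv, fun t ht => le_of_tendsto (hlim (t, 0)).norm
        (Eventually.of_forall fun k => (hu k).2 t ht)⟩)
    (fun u hu v hv c hc huv q => by
      have ht := hclamp q.1
      refine hcontr (fun t x => u (t, x)) (fun t x => v (t, x)) _ ht
        (fun r _ => hu.1.lipschitz r) hv.1 hv.2 q.2
        (fun s ω => flow F (fun t x => u (t, x)) (max 0 (min q.1 h)) q.2 (N ω) s)
        (Eventually.of_forall fun ω => isPath_flow hF hu.1 _ _ _ _)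
        (Eventually.of_forall fun ω =>
          (continuous_coeff_flow hF hG hu.1 _ _ _).intervalIntegrable _ _)
        (integrable_payoff hN hF hG hU₀ hu.1 ht.1 q.2) c hc (fun r hr y => ?_)
      have := huv (r, y)
      rwa [hclamp' r ⟨hr.1, hr.2.trans ht.2⟩] at this)
    (fun q => U₀ q.2)
    ⟨⟨hU₀.continuous.comp continuous_snd, fun t => hU₀.weaken (by
        rw [hK, ← NNReal.coe_le_coe]; push_cast; linarith [NNReal.coe_nonneg K₀])⟩, fun t _ => by
      have h2 : 0 ≤ ‖G 0‖ + (LG * (1 + K) + K₀) * ((μ + ‖F 0‖) * E) := by positivity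
      have h3 := norm_nonneg (U₀ 0)
      simp only [hc₀, hA]
      linarith⟩
    (R * (1 + μ) + ‖U₀ 0‖ + K₀) (by positivity)
    (fun q => by
      have ht := hclamp q.1
      have hu₀ : IsRegular K (fun (_ : ℝ) x => U₀ x) :=
        ⟨hU₀.continuous.comp continuous_snd, fun t => hU₀.weaken (by
          rw [hK, ← NNReal.coe_le_coe]; push_cast; linarith [NNReal.coe_nonneg K₀])⟩
      have h2 : ‖U₀ 0‖ ≤ c₀ := by
        have h2 : 0 ≤ ‖G 0‖ + (LG * (1 + K) + K₀) * ((μ + ‖F 0‖) * E) := by positivity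
        have h3 := norm_nonneg (U₀ 0)
        simp only [hc₀, hA]
        linarith
      have i1 : ‖mildMap P N F G U₀ h (fun q => U₀ q.2) q‖ ≤ R * (1 + ‖q.2‖ + μ) := by
        calc _ ≤ ∫ ω, R * (1 + ‖q.2‖ + M ω) ∂P := by
              refine norm_integral_le_of_norm_le (((integrable_const _).add hM).const_mul R) ?_
              filter_upwards [hMN'] with ω hω
              exact (hb _ hu₀ (fun _ _ => h2) _ ht q.2 (N ω) (M ω) hω).2
          _ = _ := by
              rw [show (fun ω => R * (1 + ‖q.2‖ + M ω)) =
                fun ω => R * (1 + ‖q.2‖) + R * M ω by ext; ring, integral_const_add_const_mul hM]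
              ring
      have i2 : ‖U₀ q.2‖ ≤ ‖U₀ 0‖ + K₀ * ‖q.2‖ := by
        have h1 := hU₀.norm_sub_le q.2 0
        have h2 := norm_le_norm_add_norm_sub' (U₀ q.2) (U₀ 0)
        rw [sub_zero] at h1
        linarith
      have i3 : 1 ≤ Real.exp (l * max 0 (min q.1 h)) := Real.one_le_exp (mul_nonneg hl0 ht.1)
      have hq := norm_nonneg q.2
      calc _ ≤ R * (1 + ‖q.2‖ + μ) + (‖U₀ 0‖ + K₀ * ‖q.2‖) :=
            (norm_sub_le _ _).trans (add_le_add i1 i2)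
        _ ≤ (R * (1 + μ) + ‖U₀ 0‖ + K₀) * (1 * (1 + ‖q.2‖)) := by
            have j1 := mul_nonneg (mul_nonneg hR hμ0) hq
            have j2 := mul_nonneg (norm_nonneg (U₀ 0)) hq
            have j3 := NNReal.coe_nonneg K₀
            nlinarith
        _ ≤ _ := by gcongr)
  refine ⟨fun t x => u (t, x), huC.1, fun t ht x => ?_⟩
  have := congrFun hu (t, x)
  simp only [mildMap, hclamp' t ht] at this
  exact this.symm

end Mild

/-! ### The Borel structure of the space of paths -/

/-- On a space of continuous maps the Borel sets of the compact-open topology are generated by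
the evaluations. -/
theorem borel_continuousMap_eq_iSup_comap {A E : Type*} [TopologicalSpace A]
    [SecondCountableTopology A] [LocallyCompactSpace A] [PseudoEMetricSpace E]
    [SecondCountableTopology E] [mE : MeasurableSpace E] [BorelSpace E] :
    borel C(A, E) = ⨆ a : A, MeasurableSpace.comap (fun f : C(A, E) => f a) mE := by
  apply le_antisymm
  · rw [borel_eq_generateFrom_of_subbasis (ContinuousMap.compactOpen_eq (X := A) (Y := E))]
    refine MeasurableSpace.generateFrom_le ?_
    rintro _ ⟨Q, hQ, O, hO, rfl⟩
    let mC : MeasurableSpace C(A, E) := ⨆ a : A, MeasurableSpace.comap (fun f : C(A, E) => f a) mE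
    have hev : ∀ a : A, Measurable fun f : C(A, E) => f a := fun a =>
      (comap_measurable _).mono (le_iSup (fun a : A =>
        MeasurableSpace.comap (fun f : C(A, E) => f a) mE) a) le_rfl
    obtain ⟨D, hDc, hD⟩ := TopologicalSpace.exists_countable_dense Q
    -- `f` maps the compact set `Q` into `O` iff its values stay at a positive distance from `Oᶜ`,
    -- which can be tested on a countable dense set.
    have hset : {f : C(A, E) | Set.MapsTo f Q O} =
        ⋃ n : ℕ, ⋂ d ∈ D, {f : C(A, E) | ((n : ℝ≥0∞) + 1)⁻¹ ≤ Metric.infEDist (f d) Oᶜ} := by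
      ext f
      simp only [Set.mem_ofPred_eq, Set.mem_iUnion, Set.mem_iInter]
      constructor
      · intro hf
        obtain ⟨δ, hδ, hδO⟩ := (hQ.image f.continuous).exists_thickening_subset_open hO
          (Set.image_subset_iff.2 hf)
        obtain ⟨n, hn⟩ := ENNReal.exists_inv_nat_lt (ENNReal.ofReal_pos.2 hδ).ne'
        refine ⟨n, fun d _ => le_of_not_gt fun hlt => ?_⟩
        obtain ⟨y, hy, hdy⟩ := Metric.infEDist_lt_iff.1 hlt
        refine hy (hδO ((Metric.mem_thickening_iff_exists_edist_lt _ _).2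
          ⟨f d, Set.mem_image_of_mem f d.2, ?_⟩))
        rw [edist_comm]
        exact hdy.trans ((ENNReal.inv_le_inv.2 le_self_add).trans_lt hn)
      · rintro ⟨n, hn⟩ q hq
        by_contra hqO
        have hcl : IsClosed {a : Q | ((n : ℝ≥0∞) + 1)⁻¹ ≤ Metric.infEDist (f a) Oᶜ} :=
          isClosed_le continuous_const
            (Metric.continuous_infEDist.comp (f.continuous.comp continuous_subtype_val))
        have hall : (⟨q, hq⟩ : Q) ∈ {a : Q | ((n : ℝ≥0∞) + 1)⁻¹ ≤ Metric.infEDist (f a) Oᶜ} :=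
          hcl.closure_subset_iff.2 (fun d hd => hn d hd) (hD _)
        have h0 : Metric.infEDist (f q) Oᶜ = 0 := Metric.infEDist_zero_of_mem hqO
        simp only [Set.mem_ofPred_eq, h0, nonpos_iff_eq_zero, ENNReal.inv_eq_zero] at hall
        exact absurd hall (by finiteness)
    change MeasurableSet {f : C(A, E) | Set.MapsTo f Q O}
    rw [hset]
    exact MeasurableSet.iUnion fun n => MeasurableSet.biInter hDc fun d _ =>
      measurableSet_le measurable_const (Metric.continuous_infEDist.measurable.comp (hev d))
  · refine iSup_le fun a => ?_
    have := (continuous_eval_const (F := C(A, E)) a).borel_measurable.comap_le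
    rwa [← BorelSpace.measurable_eq (α := E)] at this

section PathSpace

variable {H : Type*} [NormedAddCommGroup H]

/-- The space of paths carries the Borel sets of the topology of locally uniform convergence. -/
instance : MeasurableSpace C(ℝ≥0, H) := borel _

instance : BorelSpace C(ℝ≥0, H) := ⟨rfl⟩

variable [SecondCountableTopology H] [mH : MeasurableSpace H] [BorelSpace H]

/-- The measurable sets of paths are the traces of those of the product space. -/
theorem measurableSpace_path_eq_comap :
    (borel C(ℝ≥0, H)) =
      MeasurableSpace.comap (fun (f : C(ℝ≥0, H)) (s : ℝ≥0) => f s) inferInstance := by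
  rw [borel_continuousMap_eq_iSup_comap, MeasurableSpace.pi, MeasurableSpace.comap_iSup]
  simp only [MeasurableSpace.comap_comp]
  rfl

theorem measurable_path_iff {Ω : Type*} {m : MeasurableSpace Ω} {N : Ω → C(ℝ≥0, H)} :
    Measurable N ↔ ∀ s, Measurable fun ω => N ω s := by
  refine ⟨fun h s => (continuous_eval_const s).measurable.comp h, fun h => ?_⟩
  have h' := (measurable_comap_iff (g := fun (f : C(ℝ≥0, H)) (s : ℝ≥0) => f s)).2
    (measurable_pi_lambda _ h : Measurable fun ω (s : ℝ≥0) => N ω s)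
  rwa [← measurableSpace_path_eq_comap] at h'

/-- The law of a random continuous path is determined by its law as a process. -/
theorem map_path_eq {Ω : Type*} {m : MeasurableSpace Ω} {P : Measure Ω} {N N' : Ω → C(ℝ≥0, H)}
    (hN : Measurable N) (hN' : Measurable N')
    (h : P.map (fun ω (s : ℝ≥0) => N ω s) = P.map (fun ω (s : ℝ≥0) => N' ω s)) :
    P.map N = P.map N' := by
  have hc : Measurable fun (f : C(ℝ≥0, H)) (s : ℝ≥0) => f s :=
    measurable_pi_lambda _ fun s => (continuous_eval_const s).measurable
  ext A hA
  obtain ⟨B, hB, rfl⟩ : MeasurableSet[MeasurableSpace.comap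
      (fun (f : C(ℝ≥0, H)) (s : ℝ≥0) => f s) inferInstance] A := by
    rwa [← measurableSpace_path_eq_comap]
  rw [Measure.map_apply hN (hc hB), Measure.map_apply hN' (hc hB)]
  have e1 := Measure.map_apply (μ := P) (hc.comp hN) hB
  have e2 := Measure.map_apply (μ := P) (hc.comp hN') hB
  simp only [Function.comp_def] at e1 e2
  rw [h] at e1
  exact (e1.symm.trans e2)

end PathSpace

/-- Measurability up to null sets gives almost everywhere equality to a measurable function. -/
theorem aestronglyMeasurable_of_eventuallyMeasurable {E Ω : Type*} [NormedAddCommGroup E]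
    [CompleteSpace E] [SecondCountableTopology E] [MeasurableSpace E] [BorelSpace E]
    {m m₀ : MeasurableSpace Ω} {P : Measure[m₀] Ω} {f : Ω → E}
    (hf : Measurable[eventuallyMeasurableSpace m (ae P)] f) : AEStronglyMeasurable[m] f P := by
  let mb : MeasurableSpace Ω := eventuallyMeasurableSpace m (ae P)
  have hsm : StronglyMeasurable[mb] f := hf.stronglyMeasurable
  have hsimple : ∀ g : @SimpleFunc Ω mb E, ∃ g', StronglyMeasurable[m] g' ∧ g =ᵐ[P] g' := by
    classical
    intro g
    induction g using SimpleFunc.induction with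
    | const c hs =>
      rename_i s
      obtain ⟨t, ht, hst⟩ := hs
      refine ⟨t.indicator fun _ => c, stronglyMeasurable_const.indicator ht, ?_⟩
      filter_upwards [hst] with ω hω
      have hω' : ω ∈ s ↔ ω ∈ t := Iff.of_eq hω
      change Set.piecewise s (fun _ => c) (fun _ => 0) ω = t.indicator (fun _ => c) ω
      by_cases h : ω ∈ s
      · simp [h, hω'.1 h]
      · simp [h, mt hω'.2 h]
    | add _ hf hg =>
      obtain ⟨f', hf', hff'⟩ := hf
      obtain ⟨g', hg', hgg'⟩ := hg
      exact ⟨f' + g', StronglyMeasurable.add (mα := m) hf' hg', hff'.add hgg'⟩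
  choose g hg hfg using fun k => hsimple (hsm.approx k)
  refine ⟨fun ω => limUnder atTop fun k => g k ω,
    @StronglyMeasurable.limUnder _ _ _ m _ _ _ _ _ _ _ hg, ?_⟩
  filter_upwards [ae_all_iff.2 hfg] with ω hω
  refine (Tendsto.limUnder_eq ?_).symm
  simpa only [← hω] using hsm.tendsto_approx ω

/-! ### A square integrable bound for the maximum of a Brownian motion -/

/-- The sum of the fourth powers of the increments of `w` over the dyadic subintervals of `[0, T]`
of length `T / 2 ^ n`. -/
noncomputable def dyadicVariation (T : ℝ≥0) (w : ℝ≥0 → ℝ) (n : ℕ) : ℝ :=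
  ∑ k ∈ Finset.range (2 ^ n), (w (T * ((k + 1 : ℕ) / 2 ^ n)) - w (T * (k / 2 ^ n))) ^ 4

/-- A functional of `w` that dominates the squares of its values before time `T`, up to a constant.
The weights are chosen such that its expectation is finite if the fourth moments of the increments
of `w` are bounded by the squares of the lengths. -/
noncomputable def chainingBound (T : ℝ≥0) (w : ℝ≥0 → ℝ) : ℝ≥0∞ :=
  ∑' n : ℕ, ENNReal.ofReal ((33 / 40) ^ n + (22 / 15) ^ n * dyadicVariation T w n)

theorem dyadicVariation_nonneg (T : ℝ≥0) (w : ℝ≥0 → ℝ) (n : ℕ) : 0 ≤ dyadicVariation T w n :=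
  Finset.sum_nonneg fun _ _ => by positivity

/-- Passing from a dyadic point to one of its children in the next level. The square of the
increment is estimated by `a ^ 2 ≤ ε + a ^ 4 / ε` with `ε = (3 / 4) ^ (n + 1)`. -/
theorem sq_increment_le_dyadicVariation (T : ℝ≥0) (w : ℝ≥0 → ℝ) (n k k' : ℕ) (hk : k < 2 ^ n)
    (hk' : k' = 2 * k ∨ k' = 2 * k + 1) :
    (w (T * (k' / 2 ^ (n + 1))) - w (T * (k / 2 ^ n))) ^ 2 ≤
      (3 / 4) ^ (n + 1) + (4 / 3) ^ (n + 1) * dyadicVariation T w (n + 1) := by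
  have hcoe : (T * (k / 2 ^ n) : ℝ≥0) = T * ((2 * k : ℕ) / 2 ^ (n + 1)) := by
    congr 1
    push_cast
    rw [pow_succ', mul_div_mul_left _ _ two_ne_zero]
  have hB := dyadicVariation_nonneg T w (n + 1)
  rcases hk' with rfl | rfl
  · rw [hcoe, sub_self, zero_pow two_ne_zero]
    positivity
  · set a := w (T * ((2 * k + 1 : ℕ) / 2 ^ (n + 1))) - w (T * ((2 * k : ℕ) / 2 ^ (n + 1))) with ha
    have h4 : a ^ 4 ≤ dyadicVariation T w (n + 1) :=
      Finset.single_le_sum (f := fun k : ℕ =>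
        (w (T * ((k + 1 : ℕ) / 2 ^ (n + 1))) - w (T * (k / 2 ^ (n + 1)))) ^ 4)
        (fun _ _ => by positivity) (Finset.mem_range.2 (by rw [pow_succ]; omega))
    rw [hcoe]
    have hε : (0 : ℝ) < (3 / 4) ^ (n + 1) := by positivity
    have hinv : ((4 : ℝ) / 3) ^ (n + 1) = ((3 / 4) ^ (n + 1))⁻¹ := by
      rw [← inv_pow]; norm_num
    rw [hinv]
    set ε : ℝ := (3 / 4) ^ (n + 1)
    have h5 : a ^ 2 ≤ ε + ε⁻¹ * a ^ 4 := by
      have h6 : ε + ε⁻¹ * a ^ 4 - a ^ 2 = ε⁻¹ * ((ε - a ^ 2) ^ 2 + ε * a ^ 2) := by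
        field_simp
        ring
      have h7 : 0 ≤ ε⁻¹ * ((ε - a ^ 2) ^ 2 + ε * a ^ 2) := by positivity
      linarith
    refine h5.trans ?_
    gcongr

/-- Dyadic chaining: the values before time `T` of a continuous function vanishing at `0`. -/
theorem ofReal_sq_le_chainingBound {w : ℝ≥0 → ℝ} (hw : Continuous w) (hw0 : w 0 = 0) {T s : ℝ≥0}
    (hs : s < T) : ENNReal.ofReal (w s ^ 2) ≤ 10 * chainingBound T w := by
  have hT : 0 < T := pos_of_gt hs
  set u : ℝ≥0 := s / T with hu
  have hu1 : u < 1 := (div_lt_one hT).2 hs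
  -- `T * (κ n / 2 ^ n)` is the last dyadic point of level `n` before `s`.
  set κ : ℕ → ℕ := fun n => ⌊(2 ^ n : ℝ≥0) * u⌋₊ with hκ
  have hκlt : ∀ n, κ n < 2 ^ n := fun n => by
    refine (Nat.floor_lt (by positivity)).2 ?_
    push_cast
    exact mul_lt_of_lt_one_right (by positivity) hu1
  have hκsucc : ∀ n, κ (n + 1) = 2 * κ n ∨ κ (n + 1) = 2 * κ n + 1 := fun n => by
    have h1 : ((κ n : ℕ) : ℝ≥0) ≤ 2 ^ n * u := Nat.floor_le (by positivity)
    have h2 : 2 ^ n * u < (κ n : ℝ≥0) + 1 := Nat.lt_floor_add_one _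
    have h3 : 2 * κ n ≤ κ (n + 1) := Nat.le_floor (by push_cast; rw [pow_succ', mul_assoc]; gcongr)
    have h4 : κ (n + 1) < 2 * κ n + 2 := by
      refine (Nat.floor_lt (by positivity)).2 ?_
      push_cast
      rw [pow_succ', mul_assoc]
      calc 2 * (2 ^ n * u) < 2 * ((κ n : ℝ≥0) + 1) := by gcongr
        _ = _ := by ring
    omega
  set v : ℕ → ℝ := fun n => w (T * (κ n / 2 ^ n)) with hv
  have hlim : Tendsto v atTop (𝓝 (w s)) := by
    have h1 : Tendsto (fun n => ((κ n : ℝ≥0) / 2 ^ n)) atTop (𝓝 u) := by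
      have h2 := (tendsto_nat_floor_mul_div_atTop (R := ℝ) u.2).comp
        (tendsto_pow_atTop_atTop_of_one_lt (one_lt_two (α := ℝ)))
      rw [← NNReal.tendsto_coe]
      refine h2.congr fun n => ?_
      simp only [Function.comp_apply, hκ]
      push_cast
      rw [mul_comm]
      rfl
    have h2 := (hw.tendsto (T * u)).comp (h1.const_mul T)
    rw [hu, mul_div_cancel₀ _ hT.ne'] at h2
    exact h2
  have hv0 : v 0 = 0 := by
    have : κ 0 = 0 := by have := hκlt 0; simpa using this
    simp [hv, this, hw0]
  set b : ℕ → ℝ := fun n => (33 / 40) ^ n + (22 / 15) ^ n * dyadicVariation T w n with hb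
  have hb0 : ∀ n, 0 ≤ b n := fun n => by
    have := dyadicVariation_nonneg T w n
    positivity
  -- Cauchy-Schwarz with the geometric weights `(10 / 11) ^ n`.
  have hbound : ∀ n, v n ^ 2 ≤ 10 * ∑ k ∈ Finset.range n, b (k + 1) := by
    intro n
    have h1 : v n = ∑ k ∈ Finset.range n, (v (k + 1) - v k) := by
      rw [Finset.sum_range_sub, hv0, sub_zero]
    have h2 : ∀ k, (v (k + 1) - v k) ^ 2 ≤ (10 / 11) ^ (k + 1) * b (k + 1) := fun k => by
      refine (sq_increment_le_dyadicVariation T w k (κ k) (κ (k + 1)) (hκlt k)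
        (hκsucc k)).trans (le_of_eq ?_)
      simp only [hb]
      rw [mul_add, ← mul_assoc, ← mul_pow, ← mul_pow]
      norm_num
    have h3 : (∑ k ∈ Finset.range n, (v (k + 1) - v k)) ^ 2 ≤
        (∑ k ∈ Finset.range n, (10 / 11 : ℝ) ^ (k + 1)) * ∑ k ∈ Finset.range n, b (k + 1) := by
      refine Finset.sum_sq_le_sum_mul_sum_of_sq_le_mul _ (fun _ _ => by positivity)
        (fun k _ => hb0 _) fun k _ => h2 k
    have h4 : ∑ k ∈ Finset.range n, (10 / 11 : ℝ) ^ (k + 1) ≤ 10 := by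
      simp_rw [pow_succ', ← Finset.mul_sum]
      rw [geom_sum_eq (by norm_num)]
      have : (0 : ℝ) < (10 / 11) ^ n := by positivity
      rw [show (10 / 11 - 1 : ℝ) = -(1 / 11) by norm_num, div_neg, div_div_eq_mul_div]
      linarith
    rw [h1]
    refine h3.trans ?_
    gcongr
    exact Finset.sum_nonneg fun k _ => hb0 _
  have hbound' : ∀ n, ENNReal.ofReal (v n ^ 2) ≤ 10 * chainingBound T w := by
    intro n
    refine (ENNReal.ofReal_le_ofReal (hbound n)).trans ?_
    rw [ENNReal.ofReal_mul (by norm_num), ENNReal.ofReal_sum_of_nonneg fun k _ => hb0 _]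
    gcongr
    · simp
    · rw [← Finset.sum_image (s := Finset.range n) (g := fun k => k + 1)
        (f := fun k => ENNReal.ofReal (b k)) (by simp)]
      exact ENNReal.sum_le_tsum _
  exact le_of_tendsto (ENNReal.tendsto_ofReal (hlim.pow 2)) (Eventually.of_forall hbound')

/-- The fourth moment of the standard Gaussian law. -/
noncomputable def fourthMoment : ℝ≥0∞ := ∫⁻ x, ENNReal.ofReal (x ^ 4) ∂(gaussianReal 0 1)

theorem fourthMoment_lt_top : fourthMoment < ∞ := by
  have h : Integrable (fun x : ℝ => x ^ 4) (gaussianReal 0 1) := by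
    have := (memLp_id_gaussianReal (μ := 0) (v := 1) 4).integrable_norm_pow (by norm_num)
    simpa [Even.pow_abs (n := 4) (by decide)] using this
  exact h.lintegral_lt_top

theorem lintegral_increment {Ω : Type*} [MeasurableSpace Ω] {P : Measure Ω} {W : ℝ≥0 → Ω → ℝ}
    (hW : IsPreBrownianReal W P) {s t : ℝ≥0} (hst : s ≤ t) :
    ∫⁻ ω, ENNReal.ofReal ((W t ω - W s ω) ^ 4) ∂P =
      ENNReal.ofReal ((t - s) ^ 2) * fourthMoment := by
  have hlaw := hW.hasLaw_sub t s
  have hv : nndist t.1 s.1 = t - s := by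
    rw [← NNReal.coe_inj, coe_nndist, Real.dist_eq, NNReal.coe_sub hst, abs_of_nonneg]
    · rfl
    · exact sub_nonneg.2 (NNReal.coe_le_coe.2 hst)
  rw [hv] at hlaw
  have h1 : ∫⁻ ω, ENNReal.ofReal ((W t ω - W s ω) ^ 4) ∂P =
      ∫⁻ x, ENNReal.ofReal (x ^ 4) ∂(gaussianReal 0 (t - s)) := by
    rw [← hlaw.map_eq, lintegral_map' (by fun_prop) hlaw.aemeasurable]
    rfl
  -- The law is that of the standard Gaussian, scaled by the standard deviation.
  have h2 := gaussianReal_map_const_mul (μ := 0) (v := 1) (√((t - s : ℝ≥0) : ℝ))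
  have h3 : NNReal.mk (√((t - s : ℝ≥0) : ℝ) ^ 2) (sq_nonneg _) * 1 = t - s := by
    rw [mul_one, ← NNReal.coe_inj]
    exact Real.sq_sqrt (NNReal.coe_nonneg _)
  rw [mul_zero, h3] at h2
  rw [h1, ← h2, lintegral_map (by fun_prop) (by fun_prop), fourthMoment,
    ← lintegral_const_mul _ (by fun_prop)]
  refine lintegral_congr fun x => ?_
  rw [← ENNReal.ofReal_mul (by positivity), mul_pow]
  congr 2
  rw [show (4 : ℕ) = 2 * 2 from rfl, pow_mul, Real.sq_sqrt (NNReal.coe_nonneg _),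
    NNReal.coe_sub hst]

/-- The `2 ^ n` increments of level `n` have fourth moments of order `4 ^ (-n)`, which beats the
weight `(22 / 15) ^ n`. -/
theorem lintegral_chainingBound_le {Ω : Type*} [MeasurableSpace Ω] {P : Measure Ω}
    [IsProbabilityMeasure P] {W : ℝ≥0 → Ω → ℝ} (hWm : ∀ s, Measurable (W s))
    (hW : IsPreBrownianReal W P) (T : ℝ≥0) :
    ∫⁻ ω, chainingBound T (fun s => W s ω) ∂P ≤
      ∑' n : ℕ, (ENNReal.ofReal ((33 / 40) ^ n) +
        ENNReal.ofReal ((11 / 15) ^ n * T ^ 2) * fourthMoment) := by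
  have hD : ∀ n, Measurable fun ω => dyadicVariation T (fun s => W s ω) n := fun n => by
    unfold dyadicVariation
    fun_prop
  unfold chainingBound
  rw [lintegral_tsum fun n => (((hD n).const_mul _).const_add _).ennreal_ofReal.aemeasurable]
  refine ENNReal.tsum_le_tsum fun n => ?_
  have h1 : ∀ ω, ENNReal.ofReal ((33 / 40) ^ n + (22 / 15) ^ n *
      dyadicVariation T (fun s => W s ω) n) = ENNReal.ofReal ((33 / 40) ^ n) +
      ENNReal.ofReal ((22 / 15) ^ n) * ∑ k ∈ Finset.range (2 ^ n), ENNReal.ofReal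
        ((W (T * ((k + 1 : ℕ) / 2 ^ n)) ω - W (T * (k / 2 ^ n)) ω) ^ 4) := fun ω => by
    rw [ENNReal.ofReal_add (by positivity)
      (mul_nonneg (by positivity) (dyadicVariation_nonneg _ _ _)),
      ENNReal.ofReal_mul (by positivity), dyadicVariation,
      ENNReal.ofReal_sum_of_nonneg fun _ _ => by positivity]
  simp_rw [h1]
  rw [lintegral_add_left measurable_const, lintegral_const, measure_univ, mul_one,
    lintegral_const_mul _ (by fun_prop), lintegral_finsetSum _ fun k _ => by fun_prop]
  have h2 : ∀ k : ℕ, ∫⁻ ω, ENNReal.ofReal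
      ((W (T * ((k + 1 : ℕ) / 2 ^ n)) ω - W (T * (k / 2 ^ n)) ω) ^ 4) ∂P =
        ENNReal.ofReal ((T / 2 ^ n) ^ 2) * fourthMoment := fun k => by
    rw [lintegral_increment hW (by gcongr; simp)]
    congr 3
    push_cast
    ring
  simp_rw [h2]
  rw [Finset.sum_const, Finset.card_range, nsmul_eq_mul, ← mul_assoc, ← mul_assoc]
  gcongr
  rw [← ENNReal.ofReal_natCast, ← ENNReal.ofReal_mul (by positivity),
    ← ENNReal.ofReal_mul (by positivity)]
  refine ENNReal.ofReal_le_ofReal (le_of_eq ?_)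
  push_cast
  rw [div_pow (T : ℝ), show (11 / 15 : ℝ) = 22 / 15 / 2 by norm_num, div_pow (22 / 15 : ℝ)]
  field_simp

theorem tsum_chaining_lt_top (T : ℝ≥0) :
    ∑' n : ℕ, (ENNReal.ofReal ((33 / 40) ^ n) +
      ENNReal.ofReal ((11 / 15) ^ n * T ^ 2) * fourthMoment) < ∞ := by
  rw [ENNReal.tsum_add, ENNReal.tsum_mul_right]
  have h : ∀ x : ℝ, 0 ≤ x → x < 1 → ∀ c : ℝ, ∑' n : ℕ, ENNReal.ofReal (x ^ n * c) < ∞ :=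
    fun x hx hx1 c => ((summable_geometric_of_lt_one hx hx1).mul_right c).tsum_ofReal_lt_top
  have h1 := h (33 / 40) (by norm_num) (by norm_num) 1
  simp only [mul_one] at h1
  exact ENNReal.add_lt_top.2 ⟨h1, ENNReal.mul_lt_top
    (h (11 / 15) (by norm_num) (by norm_num) _) fourthMoment_lt_top⟩

/-! ### The noise as a random path in the Hilbert space -/

section Noise

variable {H : Type*} [NormedAddCommGroup H] [InnerProductSpace ℝ H]
  {ι : Type*} {e : ι → H}

theorem norm_sq_sum_smul_orthonormal (he : Orthonormal ℝ e) (c : ι → ℝ) (S : Finset ι) :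
    ‖∑ i ∈ S, c i • e i‖ ^ 2 = ∑ i ∈ S, c i ^ 2 := by
  have := he.orthogonalFamily.norm_sum c S
  simpa using this

variable [CompleteSpace H]

theorem summable_smul_orthonormal (he : Orthonormal ℝ e) {c : ι → ℝ}
    (hc : Summable fun i => c i ^ 2) : Summable fun i => c i • e i := by
  have := (he.orthogonalFamily.summable_iff_norm_sq_summable c).2 (by simpa using hc)
  simpa using this

/-- A series along an orthonormal family with continuous coefficients is continuous if the squares
of the coefficients are locally uniformly summable. -/
theorem exists_continuous_hasSum (he : Orthonormal ℝ e) {c : ι → ℝ≥0 → ℝ}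
    (hc : ∀ i, Continuous (c i)) {a : ℕ → ι → ℝ} (ha : ∀ T, Summable (a T))
    (hca : ∀ T : ℕ, ∀ s : ℝ≥0, s < T → ∀ i, c i s ^ 2 ≤ a T i) :
    ∃ n : C(ℝ≥0, H), (∀ s, HasSum (fun i => c i s • e i) (n s)) ∧
      ∀ T : ℕ, ∀ s : ℝ≥0, s < T → ‖n s‖ ^ 2 ≤ ∑' i, a T i := by
  have hsum : ∀ s, Summable fun i => c i s • e i := fun s => by
    obtain ⟨T, hT⟩ := exists_nat_gt s
    exact summable_smul_orthonormal he
      ((ha T).of_nonneg_of_le (fun i => sq_nonneg _) (hca T s hT))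
  have ha0 : ∀ T : ℕ, ∀ s : ℝ≥0, s < T → ∀ i, 0 ≤ a T i := fun T s hs i =>
    (sq_nonneg _).trans (hca T s hs i)
  have hcont : Continuous fun s => ∑' i, c i s • e i := by
    refine continuous_of_locally_uniform_approx_of_continuousAt fun s₀ A hA => ?_
    obtain ⟨ε, hε, hεA⟩ := Metric.mem_uniformity_dist.1 hA
    obtain ⟨T, hT⟩ := exists_nat_gt s₀
    obtain ⟨S, hS⟩ := summable_iff_vanishing_norm.1 (ha T) ((ε / 2) ^ 2) (by positivity)
    refine ⟨Set.Iio (T : ℝ≥0), Iio_mem_nhds hT, fun s => ∑ i ∈ S, c i s • e i,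
      (continuous_finsetSum _ fun i _ => (hc i).smul continuous_const).continuousAt,
      fun s hs => hεA ?_⟩
    have hlim : Tendsto (fun S' => ‖∑ i ∈ S', c i s • e i - ∑ i ∈ S, c i s • e i‖) atTop
        (𝓝 ‖∑' i, c i s • e i - ∑ i ∈ S, c i s • e i‖) := by
      have h : Tendsto (fun S' => ∑ i ∈ S', c i s • e i) atTop (𝓝 (∑' i, c i s • e i)) :=
        (hsum s).hasSum
      exact (h.sub tendsto_const_nhds).norm
    have hle : ‖∑' i, c i s • e i - ∑ i ∈ S, c i s • e i‖ ≤ ε / 2 := by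
      refine le_of_tendsto hlim ?_
      filter_upwards [eventually_ge_atTop S] with S' hS'
      classical
      rw [← Finset.sum_sdiff hS', add_sub_cancel_right]
      refine (sq_le_sq₀ (norm_nonneg _) (by positivity)).1 ?_
      rw [norm_sq_sum_smul_orthonormal he]
      calc _ ≤ ∑ i ∈ S' \ S, a T i := Finset.sum_le_sum fun i _ => hca T s hs i
        _ ≤ ‖∑ i ∈ S' \ S, a T i‖ := le_abs_self _
        _ ≤ _ := (hS _ Finset.sdiff_disjoint).le
    rw [dist_eq_norm]
    linarith
  refine ⟨⟨_, hcont⟩, fun s => (hsum s).hasSum, fun T s hs => ?_⟩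
  refine le_of_tendsto ((hsum s).hasSum.norm.pow 2) (Eventually.of_forall fun S => ?_)
  rw [norm_sq_sum_smul_orthonormal he]
  exact (Finset.sum_le_sum fun i _ => hca T s hs i).trans
    ((ha T).sum_le_tsum _ fun i _ => ha0 T s hs i)

/-- The noise series converges, outside one null set for all times, to a random continuous path. The
bound of its maximum comes from the chaining bounds of the coordinates, whose weighted sum has a
finite expectation because `λ` is summable. -/
theorem exists_noise [SecondCountableTopology H] [MeasurableSpace H] [BorelSpace H]
    {Ω : Type*} [MeasurableSpace Ω] {P : Measure Ω} [IsProbabilityMeasure P] [Countable ι]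
    (he : Orthonormal ℝ e) {lam : ι → ℝ} (hlam : ∀ i, 0 ≤ lam i) (hlam_sum : Summable lam)
    {W : ι → ℝ≥0 → Ω → ℝ} (hW_meas : ∀ i s, Measurable (W i s))
    (hW : ∀ i, IsBrownianReal (W i) P) :
    ∃ N : Ω → C(ℝ≥0, H), Measurable N ∧ IsIntegrableNoise P N ∧
      ∀ᵐ ω ∂P, ∀ s, HasSum (fun i => (√(2 * lam i) * W i s ω) • e i) (N ω s) := by
  set Q : ℕ → Ω → ℝ≥0∞ := fun T ω =>
    ∑' i, ENNReal.ofReal (2 * lam i) * (10 * chainingBound T (fun s => W i s ω)) with hQ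
  have hchain : ∀ (T : ℕ) i, Measurable fun ω => chainingBound T (fun s => W i s ω) := by
    intro T i
    have hD : ∀ n, Measurable fun ω => dyadicVariation T (fun s => W i s ω) n := fun n => by
      have := hW_meas i
      unfold dyadicVariation
      fun_prop
    exact Measurable.tsum fun n => (((hD n).const_mul _).const_add _).ennreal_ofReal
  have hQm : ∀ T, Measurable (Q T) := fun T =>
    Measurable.tsum fun i => ((hchain T i).const_mul _).const_mul _
  have hQint : ∀ T, ∫⁻ ω, Q T ω ∂P ≠ ∞ := by
    intro T
    rw [hQ, lintegral_tsum fun i => (((hchain T i).const_mul _).const_mul _).aemeasurable]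
    have hle : ∀ i, ∫⁻ ω, ENNReal.ofReal (2 * lam i) *
        (10 * chainingBound T (fun s => W i s ω)) ∂P ≤ ENNReal.ofReal (2 * lam i) *
        (10 * ∑' n : ℕ, (ENNReal.ofReal ((33 / 40) ^ n) +
        ENNReal.ofReal ((11 / 15) ^ n * (T : ℝ≥0) ^ 2) * fourthMoment)) := fun i => by
      rw [lintegral_const_mul _ ((hchain T i).const_mul _), lintegral_const_mul _ (hchain T i)]
      gcongr
      exact lintegral_chainingBound_le (hW_meas i) (hW i).toIsPreBrownianReal T
    refine ((ENNReal.tsum_le_tsum hle).trans_lt ?_).ne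
    rw [ENNReal.tsum_mul_right]
    exact ENNReal.mul_lt_top (hlam_sum.mul_left 2).tsum_ofReal_lt_top
      (ENNReal.mul_lt_top (by simp) (tsum_chaining_lt_top _))
  -- On a measurable set of full measure everything is finite and continuous.
  have hgood : ∀ᵐ ω ∂P, (∀ i, Continuous fun s => W i s ω) ∧ (∀ i, W i 0 ω = 0) ∧
      ∀ T, Q T ω < ∞ :=
    (ae_all_iff.2 fun i => (hW i).cont).and ((ae_all_iff.2 fun i =>
      (hW i).toIsPreBrownianReal.eval_zero_ae_eq_zero).and
      (ae_all_iff.2 fun T => ae_lt_top (hQm T) (hQint T)))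
  obtain ⟨A, hAsub, hAm, hAP⟩ : ∃ A, A ⊆ {ω | (∀ i, Continuous fun s => W i s ω) ∧
      (∀ i, W i 0 ω = 0) ∧ ∀ T, Q T ω < ∞} ∧ MeasurableSet A ∧ ∀ᵐ ω ∂P, ω ∈ A := by
    refine ⟨(toMeasurable P {ω | (∀ i, Continuous fun s => W i s ω) ∧
      (∀ i, W i 0 ω = 0) ∧ ∀ T, Q T ω < ∞}ᶜ)ᶜ, ?_, (measurableSet_toMeasurable _ _).compl, ?_⟩
    · exact Set.compl_subset_comm.1 (subset_toMeasurable _ _)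
    · rw [ae_iff]
      simp only [Set.mem_compl_iff, not_not]
      change P (toMeasurable P _) = 0
      rw [measure_toMeasurable]
      exact hgood
  have hpath : ∀ ω, ∃ n : C(ℝ≥0, H), (ω ∈ A →
      (∀ s, HasSum (fun i => (√(2 * lam i) * W i s ω) • e i) (n s)) ∧
      ∀ T : ℕ, ∀ s : ℝ≥0, s < T → ‖n s‖ ^ 2 ≤ (Q T ω).toReal) ∧ (ω ∉ A → n = 0) := by
    intro ω
    by_cases hω : ω ∈ A
    · obtain ⟨hc, h0, hfin⟩ := hAsub hω
      obtain ⟨n, hn, hb⟩ := exists_continuous_hasSum he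
        (c := fun i s => √(2 * lam i) * W i s ω) (fun i => continuous_const.mul (hc i))
        (a := fun T i => (ENNReal.ofReal (2 * lam i) *
          (10 * chainingBound T (fun s => W i s ω))).toReal)
        (fun T => ENNReal.summable_toReal (hfin T).ne) (fun T s hs i => by
          have h1 := ofReal_sq_le_chainingBound (hc i) (h0 i) hs
          rw [mul_pow, Real.sq_sqrt (by linarith [hlam i])]
          refine (ENNReal.ofReal_le_iff_le_toReal ?_).1 ?_
          · exact ENNReal.ne_top_of_tsum_ne_top (hfin T).ne i
          · rw [ENNReal.ofReal_mul (by linarith [hlam i])]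
            gcongr)
      refine ⟨n, fun _ => ⟨hn, fun T s hs => (hb T s hs).trans (le_of_eq ?_)⟩,
        fun h => absurd hω h⟩
      exact (ENNReal.tsum_toReal_eq fun i => ENNReal.ne_top_of_tsum_ne_top (hfin T).ne i).symm
    · exact ⟨0, fun h => absurd h hω, fun _ => rfl⟩
  choose N hNA hN0 using hpath
  have hNm : Measurable N := by
    refine measurable_path_iff.2 fun s => ?_
    refine measurable_of_tendsto_metrizable' (atTop : Filter (Finset ι))
      (f := fun S => A.indicator fun ω => ∑ i ∈ S, (√(2 * lam i) * W i s ω) • e i)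
      (fun S => ?_) (tendsto_pi_nhds.2 fun ω => ?_)
    · refine Measurable.indicator (Finset.measurable_sum _ fun i _ => ?_) hAm
      exact ((hW_meas i s).const_mul _).smul_const _
    · by_cases hω : ω ∈ A
      · simpa only [Set.indicator_of_mem hω] using! ((hNA ω hω).1 s)
      · simp [Set.indicator_of_notMem hω, hN0 ω hω]
  refine ⟨N, hNm, ⟨hNm.aestronglyMeasurable, fun T => ?_⟩, ?_⟩
  · obtain ⟨n, hn⟩ := exists_nat_gt T
    refine ⟨fun ω => 1 + (Q n ω).toReal, (integrable_const _).add
      (integrable_toReal_of_lintegral_ne_top (hQm n).aemeasurable (hQint n)),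
      fun ω => by positivity, ?_⟩
    filter_upwards [hAP] with ω hω s hs
    have hsn : s.toNNReal < (n : ℝ≥0) := by
      rw [Real.toNNReal_lt_iff_lt_coe hs.1]
      exact hs.2.trans_lt hn
    have h := (hNA ω hω).2 n _ hsn
    nlinarith [sq_nonneg (‖N ω s.toNNReal‖ - 1)]
  · filter_upwards [hAP] with ω hω using (hNA ω hω).1

end Noise

/-! ### Law and independence of the increments of the noise -/

section Law

variable {Ω : Type*} [MeasurableSpace Ω] {P : Measure Ω} [IsProbabilityMeasure P]
  {ι : Type*}

theorem iIndepFun_bool_of_indepFun {E : Type*} [MeasurableSpace E] {X : Bool → Ω → E}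
    (h : IndepFun (X true) (X false) P) : iIndepFun X P := by
  refine iIndepFun_iff_measure_inter_preimage_eq_mul.2 fun S A hA => ?_
  have hS : ∀ S : Finset Bool, S = ∅ ∨ S = {true} ∨ S = {false} ∨ S = {true, false} := by decide
  rcases hS S with rfl | rfl | rfl | rfl
  · simp
  · simp
  · simp
  · have := h.measure_inter_preimage_eq_mul _ _ (hA true (by simp)) (hA false (by simp))
    rw [Finset.prod_pair (by simp), ← this]
    congr 1
    ext ω
    simp [and_comm]

/-- The family of the increments of `W` after time `r`. -/
def shiftNoise (W : ι → ℝ≥0 → Ω → ℝ) (r : ℝ≥0) (i : ι) (s : ℝ≥0) (ω : Ω) : ℝ :=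
  W i (r + s) ω - W i r ω

/-- The increments after time `r` are again a family of independent Brownian motions. -/
theorem map_shiftNoise_eq {W : ι → ℝ≥0 → Ω → ℝ} (hWm : ∀ i s, Measurable (W i s))
    (hW : ∀ i, IsPreBrownianReal (W i) P) (hind : iIndepFun (fun i ω s => W i s ω) P) (r : ℝ≥0) :
    P.map (fun ω i s => shiftNoise W r i s ω) = P.map (fun ω i s => W i s ω) := by
  have hm1 : ∀ i, Measurable fun ω s => W i s ω := fun i => measurable_pi_lambda _ (hWm i)
  have hm2 : ∀ i, Measurable fun ω s => shiftNoise W r i s ω := fun i =>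
    measurable_pi_lambda _ fun s => (hWm i _).sub (hWm i _)
  have hind2 : iIndepFun (fun i ω s => shiftNoise W r i s ω) P :=
    hind.comp (fun _ w s => w (r + s) - w r) fun _ => by fun_prop
  rw [hind2.map_fun_eq_infinitePi_map hm2, hind.map_fun_eq_infinitePi_map hm1]
  congr 1
  funext i
  rw [map_eq_iff_forall_finset_map_restrict_eq (X := fun s ω => shiftNoise W r i s ω)
    (Y := fun s ω => W i s ω) (hm2 i).aemeasurable (hm1 i).aemeasurable]
  intro I
  exact (((hW i).shift r).hasLaw I).map_eq.trans ((hW i).hasLaw I).map_eq.symm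

/-- The increments after time `r` are independent of the history up to time `r`, jointly for all
the coordinates of the noise. -/
theorem indep_shiftNoise_noiseHistory {W : ι → ℝ≥0 → Ω → ℝ} (hWm : ∀ i s, Measurable (W i s))
    (hW : ∀ i, IsPreBrownianReal (W i) P) (hind : iIndepFun (fun i ω s => W i s ω) P) (r : ℝ≥0) :
    Indep (MeasurableSpace.comap (fun ω i s => shiftNoise W r i s ω) inferInstance)
      (noiseHistory W r) P := by
  -- The future (`true`) and the past (`false`) of all the coordinates form one independent family.
  set X : ι → Bool → Ω → ℝ≥0 → ℝ := fun i b ω s =>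
    if b then shiftNoise W r i s ω else W i (min s r) ω with hX
  have hXm : ∀ i b, Measurable (X i b) := by
    intro i b
    refine measurable_pi_lambda _ fun s => ?_
    cases b
    · simpa [hX] using hWm i _
    · exact (hWm i (r + s)).sub (hWm i r)
  have h1 : iIndepFun (fun i ω => (X i · ω)) P := by
    refine hind.comp
      (fun _ w (b : Bool) s => if b then w (r + s) - w r else w (min s r)) fun _ => ?_
    refine measurable_pi_lambda _ fun b => measurable_pi_lambda _ fun s => ?_
    cases b
    · exact measurable_pi_apply (min s r)
    · exact (measurable_pi_apply (r + s)).sub (measurable_pi_apply r)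
  have h2 : ∀ i, iIndepFun (X i) P := by
    intro i
    refine iIndepFun_bool_of_indepFun ?_
    have := ((hW i).indepFun_shift r).comp (φ := id)
      (ψ := fun (w : Set.Iic r → ℝ) (s : ℝ≥0) => w ⟨min s r, Set.mem_Iic.2 (min_le_right _ _)⟩)
      measurable_id (measurable_pi_lambda _ fun s => measurable_pi_apply _)
    exact this
  have h3 := iIndepFun_uncurry' hXm h1 h2
  have h4 := indep_iSup_of_disjoint
    (m := fun p : ι × Bool => MeasurableSpace.comap (X p.1 p.2) inferInstance)
    (S := {p : ι × Bool | p.2 = true}) (T := {p | p.2 = false})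
    (fun p => (hXm p.1 p.2).comap_le) h3
    (Set.disjoint_left.2 fun p hp hp' => by simp_all)
  refine indep_of_indep_of_le_left (indep_of_indep_of_le_right h4 ?_) ?_
  · refine iSup_le fun i => iSup_le fun s => iSup_le fun hs => ?_
    have hs' : s ≤ r := by exact_mod_cast hs
    refine le_trans ?_ (le_iSup₂_of_le (i, false) rfl le_rfl)
    rintro _ ⟨B, hB, rfl⟩
    refine ⟨(fun w => w s) ⁻¹' B, measurable_pi_apply s hB, ?_⟩
    ext ω
    simp [hX, min_eq_left hs']
  · refine Measurable.comap_le (@measurable_pi_lambda Ω ι (fun _ => ℝ≥0 → ℝ)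
      (⨆ p ∈ {p : ι × Bool | p.2 = true}, MeasurableSpace.comap (X p.1 p.2) inferInstance)
      _ _ fun i => ?_)
    have : @Measurable Ω (ℝ≥0 → ℝ) (MeasurableSpace.comap (X i true) inferInstance) _ (X i true) :=
      comap_measurable _
    refine Measurable.mono (f := X i true) this ?_ le_rfl
    exact le_iSup₂_of_le (f := fun (p : ι × Bool) (_ : p ∈ {p : ι × Bool | p.2 = true}) =>
      MeasurableSpace.comap (X p.1 p.2) inferInstance) (i, true) rfl le_rfl

variable {H : Type*} [NormedAddCommGroup H] [NormedSpace ℝ H] [CompleteSpace H]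
  [SecondCountableTopology H] [MeasurableSpace H] [BorelSpace H] [Countable ι]

/-- The sum of the noise series at all times, as a functional of its coefficients. -/
noncomputable def noiseSeries (e : ι → H) (lam : ι → ℝ) (w : ι → ℝ≥0 → ℝ) (s : ℝ≥0) : H :=
  ∑' i, (√(2 * lam i) * w i s) • e i

theorem measurable_noiseSeries (e : ι → H) (lam : ι → ℝ) : Measurable (noiseSeries e lam) := by
  refine measurable_pi_lambda _ fun s => ?_
  unfold noiseSeries
  exact Measurable.tsum fun i => by fun_prop

/-- The law of the noise path is determined by the joint law of its coordinates. -/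
theorem map_noise_eq {P : Measure Ω} {e : ι → H} {lam : ι → ℝ} {W W' : ι → ℝ≥0 → Ω → ℝ}
    (hW : ∀ i s, Measurable (W i s)) (hW' : ∀ i s, Measurable (W' i s))
    (hlaw : P.map (fun ω i s => W' i s ω) = P.map (fun ω i s => W i s ω))
    {N N' : Ω → C(ℝ≥0, H)} (hN : Measurable N) (hN' : Measurable N')
    (h : ∀ᵐ ω ∂P, ∀ s, HasSum (fun i => (√(2 * lam i) * W i s ω) • e i) (N ω s))
    (h' : ∀ᵐ ω ∂P, ∀ s, HasSum (fun i => (√(2 * lam i) * W' i s ω) • e i) (N' ω s)) :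
    P.map N' = P.map N := by
  have hm1 : Measurable fun ω i s => W i s ω :=
    measurable_pi_lambda _ fun i => measurable_pi_lambda _ (hW i)
  have hm2 : Measurable fun ω i s => W' i s ω :=
    measurable_pi_lambda _ fun i => measurable_pi_lambda _ (hW' i)
  refine map_path_eq hN' hN ?_
  have e1 : (fun ω (s : ℝ≥0) => N ω s) =ᵐ[P]
      noiseSeries e lam ∘ fun ω i s => W i s ω := by
    filter_upwards [h] with ω hω
    funext s
    exact (hω s).tsum_eq.symm
  have e2 : (fun ω (s : ℝ≥0) => N' ω s) =ᵐ[P]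
      noiseSeries e lam ∘ fun ω i s => W' i s ω := by
    filter_upwards [h'] with ω hω
    funext s
    exact (hω s).tsum_eq.symm
  rw [Measure.map_congr e1, Measure.map_congr e2,
    ← Measure.map_map (measurable_noiseSeries e lam) hm1,
    ← Measure.map_map (measurable_noiseSeries e lam) hm2, hlaw]

/-- The path of the increments of `n` after time `r`. -/
def shiftPath {H : Type*} [NormedAddCommGroup H] (r : ℝ≥0) (n : C(ℝ≥0, H)) : C(ℝ≥0, H) :=
  ⟨fun s => n (r + s) - n r, by fun_prop⟩

theorem measurable_shiftPath {H : Type*} [NormedAddCommGroup H]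
    [SecondCountableTopology H] [MeasurableSpace H] [BorelSpace H] (r : ℝ≥0) :
    Measurable (shiftPath r : C(ℝ≥0, H) → C(ℝ≥0, H)) :=
  measurable_path_iff.2 fun s =>
    (continuous_eval_const (r + s)).measurable.sub (continuous_eval_const r).measurable

theorem hasSum_shiftPath {Ω ι H : Type*} [NormedAddCommGroup H] [NormedSpace ℝ H]
    {e : ι → H} {lam : ι → ℝ} {W : ι → ℝ≥0 → Ω → ℝ} {n : C(ℝ≥0, H)} {ω : Ω}
    (h : ∀ s, HasSum (fun i => (√(2 * lam i) * W i s ω) • e i) (n s)) (r s : ℝ≥0) :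
    HasSum (fun i => (√(2 * lam i) * shiftNoise W r i s ω) • e i) (shiftPath r n s) := by
  have := (h (r + s)).sub (h r)
  simpa only [← sub_smul, ← mul_sub] using! this

/-- The increments of the noise path after time `r` are independent of every random variable that
is known at time `r`. -/
theorem indepFun_shiftPath {e : ι → H} {lam : ι → ℝ} {W : ι → ℝ≥0 → Ω → ℝ}
    (hWm : ∀ i s, Measurable (W i s)) (hW : ∀ i, IsPreBrownianReal (W i) P)
    (hind : iIndepFun (fun i ω s => W i s ω) P) {N : Ω → C(ℝ≥0, H)}
    (h : ∀ᵐ ω ∂P, ∀ s, HasSum (fun i => (√(2 * lam i) * W i s ω) • e i) (N ω s)) (r : ℝ≥0)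
    {Z : Ω → H} (hZ : AEStronglyMeasurable[noiseHistory W r] Z P) :
    IndepFun (fun ω => shiftPath r (N ω)) Z P := by
  obtain ⟨Z', hZ', hZZ'⟩ := hZ
  have h1 : IndepFun (fun ω i s => shiftNoise W r i s ω) Z' P :=
    indep_of_indep_of_le_right (indep_shiftNoise_noiseHistory hWm hW hind r)
      hZ'.measurable.comap_le
  have h2 : IndepFun (fun ω s => noiseSeries e lam (fun i s => shiftNoise W r i s ω) s) Z' P :=
    h1.comp (measurable_noiseSeries e lam) measurable_id
  have h3 : IndepFun (fun ω (s : ℝ≥0) => shiftPath r (N ω) s) Z' P := by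
    refine IndepFun.process_congr_left
      (X := fun s ω => noiseSeries e lam (fun i s => shiftNoise W r i s ω) s)
      (X' := fun s ω => shiftPath r (N ω) s) h2 fun s => ?_
    filter_upwards [h] with ω hω
    exact (hasSum_shiftPath hω r s).tsum_eq
  have h4 : IndepFun (fun ω => shiftPath r (N ω)) Z' P := by
    refine indep_of_indep_of_le_left h3 ?_
    have := measurableSpace_path_eq_comap (H := H)
    change MeasurableSpace.comap _ (borel _) ≤ _
    rw [this, MeasurableSpace.comap_comp]
    rfl
  exact h4.congr Filter.EventuallyEq.rfl hZZ'.symm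

end Law

/-! ### The Markov property and continuation of mild solutions -/

section Pathwise

variable {H : Type*} [NormedAddCommGroup H] [NormedSpace ℝ H] [CompleteSpace H]
  {F G : H × H → H} {LF LG K K' K₀ : ℝ≥0} {U V : ℝ → H → H} {U₀ V₀ : H → H}

/-- The characteristics only depend on `U` through its values at the remaining times. -/
theorem flow_eq_flow (hF : LipschitzWith LF F) (hU : IsRegular K U) (hV : IsRegular K' V)
    {r t : ℝ} (x : H) (n : C(ℝ≥0, H)) (hUV : ∀ s ∈ Set.Icc 0 r, V (r - s) = U (t - s)) :
    ∀ s ∈ Set.Icc 0 r, flow F U t x n s = flow F V r x n s := by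
  have h := isPath_flow hF hU t x n r
  have hs : ∀ s, r - s + (t - r) = t - s := fun s => by ring
  have h' : IsPath F (fun q => U (q + (t - r))) r x n r (flow F U t x n) :=
    ⟨h.continuousOn, by simpa only [hs] using h.integrable, by simpa only [hs] using h.eq⟩
  exact h'.eq_flow hF hV (fun _ _ => rfl) fun s hs' y => by simp only [hUV s hs', hs]

theorem payoff_congr (hF : LipschitzWith LF F) (hU : IsRegular K U) (hV : IsRegular K' V)
    {t : ℝ} (ht : 0 ≤ t) (x : H) (n : C(ℝ≥0, H)) (hUV : ∀ s ∈ Set.Icc 0 t, U s = V s) :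
    payoff F G U U₀ t x n = payoff F G V U₀ t x n := by
  have hUV' : ∀ s ∈ Set.Icc 0 t, U (t - s) = V (t - s) := fun s hs =>
    hUV _ ⟨by linarith [hs.2], by linarith [hs.1]⟩
  have h := flow_eq_flow hF hU hV x n fun s hs => (hUV' s hs).symm
  rw [payoff, payoff, reward, reward, h t ⟨ht, le_rfl⟩]
  congr 1
  refine intervalIntegral.integral_congr fun s hs => ?_
  rw [Set.uIcc_of_le ht] at hs
  simp only [h s hs, hUV' s hs]

/-- Flow property: after time `r` a characteristic is the one that starts from its current position
and is driven by the increments of the noise. -/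
theorem flow_add (hF : LipschitzWith LF F) (hU : IsRegular K U) (r : ℝ≥0) {τ : ℝ} (hτ : 0 ≤ τ)
    (x : H) (n : C(ℝ≥0, H)) :
    ∀ s ∈ Set.Icc 0 τ, flow F U (r + τ) x n (r + s) =
      flow F U τ (flow F U (r + τ) x n r) (shiftPath r n) s := by
  set X := flow F U (r + τ) x n with hX
  have h : IsPath F U (r + τ) x n (r + τ) X := isPath_flow hF hU (r + τ) x n (r + τ)
  have hXc : Continuous X := continuous_flow_apply hF hU _ _ _
  have hr := r.coe_nonneg
  set f : ℝ → H := fun s => -F (X s, U (r + τ - s) (X s)) with hf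
  have hfc : Continuous f := (continuous_coeff_flow hF hF hU _ _ _).neg
  have hs : ∀ s, (r : ℝ) + τ - (r + s) = τ - s := fun s => by ring
  have hf' : (fun s => -F (X (r + s), U (τ - s) (X (r + s)))) = fun s => f (r + s) := by
    ext s
    simp only [hf, hs]
  have hpath : IsPath F U τ (X r) (shiftPath r n) τ (fun s => X (r + s)) := by
    refine ⟨by fun_prop, ?_, fun s hs' => ?_⟩
    · rw [hf']
      exact (hfc.comp (by fun_prop : Continuous fun s : ℝ => (r : ℝ) + s)).intervalIntegrable _ _
    · have e1 := h.eq (r + s) ⟨by have := hs'.1; positivity, by linarith [hs'.2]⟩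
      have e2 := h.eq r ⟨r.coe_nonneg, by linarith⟩
      have e3 : (r + s).toNNReal = r + s.toNNReal := by
        rw [Real.toNNReal_add r.coe_nonneg hs'.1, Real.toNNReal_coe]
      have e4 := intervalIntegral.integral_add_adjacent_intervals
        (hfc.intervalIntegrable (μ := volume) 0 r) (hfc.intervalIntegrable r (r + s))
      have e5 := intervalIntegral.integral_comp_add_left f (r : ℝ) (a := 0) (b := s)
      rw [add_zero] at e5
      change X (r + s) = X r + (n (r + s.toNNReal) - n r) + ∫ u in (0 : ℝ)..s, _
      rw [show (∫ u in (0 : ℝ)..s, -F (X (r + u), U (τ - u) (X (r + u)))) =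
        ∫ u in (0 : ℝ)..s, f (r + u) from by rw [hf'], e5, e1, e2, e3, Real.toNNReal_coe]
      change _ + (∫ u in (0 : ℝ)..(r + s), f u) = _ + (∫ u in (0 : ℝ)..r, f u) + _ + _
      rw [← e4]
      abel
  exact hpath.eq_flow hF hU (fun _ _ => rfl) fun _ _ _ => rfl

/-- Decomposition of the payoff at an intermediate time `r`. The function `V` is `U` shifted in time
by the remaining time `τ`. -/
theorem payoff_add (hF : LipschitzWith LF F) (hG : LipschitzWith LG G) (hU : IsRegular K U)
    (hV : IsRegular K' V) (r : ℝ≥0) {τ : ℝ} (hτ : 0 ≤ τ)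
    (hUV : ∀ s ∈ Set.Icc 0 (r : ℝ), V s = U (τ + s)) (x : H) (n : C(ℝ≥0, H)) :
    payoff F G U U₀ (r + τ) x n = payoff F G V V₀ r x n - V₀ (flow F V r x n r) +
      payoff F G U U₀ τ (flow F V r x n r) (shiftPath r n) := by
  have hr := r.coe_nonneg
  have hUV' : ∀ s ∈ Set.Icc 0 (r : ℝ), V (r - s) = U (r + τ - s) := fun s hs => by
    rw [hUV _ ⟨by linarith [hs.2], by linarith [hs.1]⟩]
    congr 1
    ring
  have h1 := flow_eq_flow hF hU hV x n hUV'
  have h2 := flow_add hF hU r hτ x n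
  have hc := continuous_coeff_flow hF hG hU (r + τ) x n
  rw [h1 r ⟨r.coe_nonneg, le_rfl⟩] at h2
  simp only [payoff, reward]
  rw [h2 τ ⟨hτ, le_rfl⟩, ← intervalIntegral.integral_add_adjacent_intervals
    (hc.intervalIntegrable 0 (r : ℝ)) (hc.intervalIntegrable r (r + τ))]
  have e1 : (∫ s in (0 : ℝ)..r, G (flow F U (r + τ) x n s, U (r + τ - s) (flow F U (r + τ) x n s)))
      = ∫ s in (0 : ℝ)..r, G (flow F V r x n s, V (r - s) (flow F V r x n s)) := by
    refine intervalIntegral.integral_congr fun s hs => ?_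
    rw [Set.uIcc_of_le r.coe_nonneg] at hs
    simp only [h1 s hs, hUV' s hs]
  have e2 := intervalIntegral.integral_comp_add_left (fun s =>
    G (flow F U (r + τ) x n s, U (r + τ - s) (flow F U (r + τ) x n s))) (r : ℝ) (a := 0) (b := τ)
  rw [add_zero] at e2
  rw [e1, ← e2]
  have e3 : (∫ s in (0 : ℝ)..τ, G (flow F U (r + τ) x n (r + s),
      U (r + τ - (r + s)) (flow F U (r + τ) x n (r + s)))) =
      ∫ s in (0 : ℝ)..τ, G (flow F U τ (flow F V r x n r) (shiftPath r n) s,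
        U (τ - s) (flow F U τ (flow F V r x n r) (shiftPath r n) s)) := by
    refine intervalIntegral.integral_congr fun s hs => ?_
    rw [Set.uIcc_of_le hτ] at hs
    simp only [h2 s hs, show (r : ℝ) + τ - (r + s) = τ - s by ring]
  rw [e3]
  abel

/-- The path `n` stopped at time `s`. -/
def stopPath {H : Type*} [NormedAddCommGroup H] (s : ℝ≥0) (n : C(ℝ≥0, H)) : C(ℝ≥0, H) :=
  ⟨fun r => n (min r s), by fun_prop⟩

/-- The characteristics are non-anticipating. -/
theorem flow_stopPath (hF : LipschitzWith LF F) (hU : IsRegular K U) (t : ℝ) (x : H)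
    (n : C(ℝ≥0, H)) (s : ℝ≥0) : flow F U t x (stopPath s n) s = flow F U t x n s := by
  refine ((isPath_flow hF hU t x n s).eq_flow hF hU (fun r hr => ?_) (fun _ _ _ => rfl) s
    ⟨s.coe_nonneg, le_rfl⟩).symm
  have : r.toNNReal ≤ s := Real.toNNReal_le_iff_le_coe.2 hr.2
  change n (min _ _) = _
  rw [min_eq_left this]

end Pathwise

section Markov

variable {H : Type*} [NormedAddCommGroup H] [NormedSpace ℝ H] [CompleteSpace H]
  [SecondCountableTopology H] [MeasurableSpace H] [BorelSpace H]
  {Ω : Type*} [MeasurableSpace Ω] {P : Measure Ω} [IsProbabilityMeasure P]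
  {ι : Type*} [Countable ι] {e : ι → H} {lam : ι → ℝ} {W : ι → ℝ≥0 → Ω → ℝ}
  {N : Ω → C(ℝ≥0, H)} {F G : H × H → H} {LF LG K K' K₀ : ℝ≥0} {U V : ℝ → H → H} {U₀ : H → H}

/-- The `H`-valued noise `N` is the sum of the series with the independent Brownian motions `W i`,
and its maxima are integrable. -/
structure IsDrivingNoise (P : Measure Ω) (e : ι → H) (lam : ι → ℝ) (W : ι → ℝ≥0 → Ω → ℝ)
    (N : Ω → C(ℝ≥0, H)) : Prop where
  measurable_coord : ∀ i s, Measurable (W i s)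
  brownian : ∀ i, IsPreBrownianReal (W i) P
  indep : iIndepFun (fun i ω s => W i s ω) P
  measurable : Measurable N
  integrable : IsIntegrableNoise P N
  hasSum : ∀ᵐ ω ∂P, ∀ s, HasSum (fun i => (√(2 * lam i) * W i s ω) • e i) (N ω s)

theorem IsDrivingNoise.zero {H : Type*} [NormedAddCommGroup H] [NormedSpace ℝ H] {P : Measure Ω}
    {e : ι → H} {N : Ω → C(ℝ≥0, H)} (hN : IsDrivingNoise P e lam W N) : ∀ᵐ ω ∂P, N ω 0 = 0 := by
  have h0 : ∀ᵐ ω ∂P, ∀ i, W i 0 ω = 0 :=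
    ae_all_iff.2 fun i => (hN.brownian i).eval_zero_ae_eq_zero
  filter_upwards [hN.hasSum, h0] with ω h1 h2
  have := h1 0
  simp only [h2, mul_zero, zero_smul] at this
  exact this.unique hasSum_zero

/-- Up to null sets the stopped noise path is known at time `s`. -/
theorem IsDrivingNoise.measurable_stopPath {P : Measure Ω} (hN : IsDrivingNoise P e lam W N)
    (s : ℝ≥0) :
    Measurable[eventuallyMeasurableSpace (noiseHistory W s) (ae P)]
      fun ω => stopPath s (N ω) := by
  refine (@measurable_path_iff H _ _ _ _ Ω (eventuallyMeasurableSpace (noiseHistory W s) (ae P))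
    _).2 fun r => ?_
  have hW : ∀ i r, Measurable[noiseHistory W s] (W i (min r s)) := fun i r =>
    Measurable.mono (comap_measurable _) (le_iSup_of_le i (le_iSup_of_le (min r s)
      (le_iSup_of_le (by exact_mod_cast min_le_right r s) le_rfl))) le_rfl
  have hm : Measurable[noiseHistory W s]
      fun ω => noiseSeries e lam (fun i r => W i (min r s) ω) r :=
    ((measurable_pi_apply r).comp (measurable_noiseSeries e lam)).comp
      (@measurable_pi_lambda _ _ _ (noiseHistory W s) _ _ fun i =>
        @measurable_pi_lambda _ _ _ (noiseHistory W s) _ _ fun r => hW i r)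
  refine Measurable.eventuallyMeasurable_of_eventuallyEq hm ?_
  filter_upwards [hN.hasSum] with ω hω
  exact (hω (min r s)).tsum_eq.symm

/-- The characteristics driven by the noise are adapted to its history. -/
theorem IsDrivingNoise.aestronglyMeasurable_flow {P : Measure Ω} (hN : IsDrivingNoise P e lam W N)
    (hF : LipschitzWith LF F) (hU : IsRegular K U) (t : ℝ) (x : H) (s : ℝ≥0) :
    AEStronglyMeasurable[noiseHistory W s] (fun ω => flow F U t x (N ω) s) P := by
  have hc : Continuous fun n : C(ℝ≥0, H) => flow F U t x n s :=
    (continuous_flow hF hU).comp (by fun_prop : Continuous fun n : C(ℝ≥0, H) => (t, x, n, (s : ℝ)))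
  refine aestronglyMeasurable_of_eventuallyMeasurable ?_
  have := hc.measurable.comp (hN.measurable_stopPath s)
  simpa only [Function.comp_def, flow_stopPath hF hU] using this

theorem integrable_flow {H : Type*} [NormedAddCommGroup H] [NormedSpace ℝ H] [CompleteSpace H]
    {N : Ω → C(ℝ≥0, H)} {F : H × H → H} {U : ℝ → H → H}
    (hN : IsIntegrableNoise P N) (hF : LipschitzWith LF F) (hU : IsRegular K U) {t s : ℝ}
    (hs : s ∈ Set.Icc 0 t) (x : H) :
    Integrable (fun ω => flow F U t x (N ω) s) P := by
  have ht : 0 ≤ t := hs.1.trans hs.2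
  obtain ⟨c₀, hc₀, hUc⟩ := hU.exists_bound t
  obtain ⟨R, hR, hb⟩ := exists_growth_bound hF (LipschitzWith.const (0 : H))
    (LipschitzWith.const (0 : H)) K ht hc₀
  obtain ⟨M, hM, -, hMN⟩ := hN.bound t
  have hc : Continuous fun n : C(ℝ≥0, H) => flow F U t x n s :=
    (continuous_flow hF hU).comp (by fun_prop : Continuous fun n : C(ℝ≥0, H) => (t, x, n, s))
  refine Integrable.mono' (g := fun ω => R * (1 + ‖x‖ + M ω))
    (((integrable_const _).add hM).const_mul R)
    (hc.comp_aestronglyMeasurable hN.aestronglyMeasurable) ?_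
  filter_upwards [hMN] with ω hω
  exact (hb U hU hUc t ⟨ht, le_rfl⟩ x (N ω) (M ω) hω).1 s hs

theorem integrable_payoff_shiftPath {H : Type*} [NormedAddCommGroup H] [NormedSpace ℝ H]
    [CompleteSpace H] {N : Ω → C(ℝ≥0, H)} {F G : H × H → H} {U : ℝ → H → H} {U₀ : H → H}
    (hN : IsIntegrableNoise P N) (hF : LipschitzWith LF F) (hG : LipschitzWith LG G)
    (hU₀ : LipschitzWith K₀ U₀) (hU : IsRegular K U) {τ : ℝ} (hτ : 0 ≤ τ) (r : ℝ≥0) {Z : Ω → H}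
    (hZ : Integrable Z P) :
    Integrable (fun ω => payoff F G U U₀ τ (Z ω) (shiftPath r (N ω))) P := by
  obtain ⟨c₀, hc₀, hUc⟩ := hU.exists_bound τ
  obtain ⟨R, hR, hb⟩ := exists_growth_bound hF hG hU₀ K hτ hc₀
  obtain ⟨M, hM, -, hMN⟩ := hN.bound (r + τ)
  have hsc : Continuous (shiftPath r : C(ℝ≥0, H) → C(ℝ≥0, H)) := by
    refine ContinuousMap.continuous_of_continuous_uncurry _ ?_
    change Continuous fun q : C(ℝ≥0, H) × ℝ≥0 => q.1 (r + q.2) - q.1 r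
    fun_prop
  refine Integrable.mono' (g := fun ω => R * (1 + ‖Z ω‖ + 2 * M ω))
    ((((integrable_const _).add hZ.norm).add (hM.const_mul 2)).const_mul R) ?_ ?_
  · exact (continuous_payoff hF hG hU₀ hU).comp_aestronglyMeasurable
      (aestronglyMeasurable_const.prodMk (hZ.aestronglyMeasurable.prodMk
        (hsc.comp_aestronglyMeasurable hN.aestronglyMeasurable)))
  · filter_upwards [hMN] with ω hω
    refine (hb U hU hUc τ ⟨hτ, le_rfl⟩ (Z ω) _ (2 * M ω) fun s hs => ?_).2
    change ‖N ω (r + s.toNNReal) - N ω r‖ ≤ _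
    have e3 : (r + s).toNNReal = r + s.toNNReal := by
      rw [Real.toNNReal_add r.coe_nonneg hs.1, Real.toNNReal_coe]
    have h1 := hω (r + s) ⟨by have := hs.1; positivity, by linarith [hs.2]⟩
    have h2 := hω r ⟨r.coe_nonneg, by linarith⟩
    rw [e3] at h1
    rw [Real.toNNReal_coe] at h2
    exact (norm_sub_le _ _).trans (by linarith)

/-- Markov property: given the history up to time `r`, the increments of the noise after time `r`
are a fresh copy of the noise. -/
theorem IsDrivingNoise.integral_payoff_shiftPath (hN : IsDrivingNoise P e lam W N)
    (hF : LipschitzWith LF F) (hG : LipschitzWith LG G) (hU₀ : LipschitzWith K₀ U₀)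
    (hU : IsRegular K U) {τ : ℝ} (hτ : 0 ≤ τ) (r : ℝ≥0) {Z : Ω → H}
    (hZ : AEStronglyMeasurable[noiseHistory W r] Z P) (hZi : Integrable Z P) :
    ∫ ω, payoff F G U U₀ τ (Z ω) (shiftPath r (N ω)) ∂P =
      ∫ ω, (∫ ω', payoff F G U U₀ τ (Z ω) (N ω') ∂P) ∂P := by
  have hZm : AEMeasurable Z P := hZi.aemeasurable
  have hsm : Measurable fun ω => shiftPath r (N ω) := (measurable_shiftPath r).comp hN.measurable
  have hlaw : P.map (fun ω => shiftPath r (N ω)) = P.map N := by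
    refine map_noise_eq hN.measurable_coord
      (fun i s => (hN.measurable_coord i (r + s)).sub (hN.measurable_coord i r))
      (map_shiftNoise_eq hN.measurable_coord hN.brownian hN.indep r)
      hN.measurable hsm hN.hasSum ?_
    filter_upwards [hN.hasSum] with ω hω s using hasSum_shiftPath hω r s
  have hind := indepFun_shiftPath hN.measurable_coord hN.brownian hN.indep hN.hasSum r hZ
  have hprod := (indepFun_iff_map_prod_eq_prod_map_map hsm.aemeasurable hZm).1 hind
  rw [hlaw] at hprod
  have hc : Continuous fun q : C(ℝ≥0, H) × H => payoff F G U U₀ τ q.2 q.1 :=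
    (continuous_payoff hF hG hU₀ hU).comp (by fun_prop : Continuous fun q : C(ℝ≥0, H) × H =>
      (τ, q.2, q.1))
  have hcm : StronglyMeasurable fun q : C(ℝ≥0, H) × H => payoff F G U U₀ τ q.2 q.1 :=
    hc.measurable.stronglyMeasurable
  have hpm : AEMeasurable (fun ω => (shiftPath r (N ω), Z ω)) P := hsm.aemeasurable.prodMk hZm
  have hint := integrable_payoff_shiftPath hN.integrable hF hG hU₀ hU hτ r hZi
  have hint' : Integrable (fun q : C(ℝ≥0, H) × H => payoff F G U U₀ τ q.2 q.1)
      ((P.map N).prod (P.map Z)) := by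
    rw [← hprod]
    exact (integrable_map_measure hcm.aestronglyMeasurable hpm).2 hint
  have := Measure.isProbabilityMeasure_map hN.measurable.aemeasurable (μ := P)
  have := Measure.isProbabilityMeasure_map hZm (μ := P)
  calc _ = ∫ q, payoff F G U U₀ τ q.2 q.1 ∂(P.map fun ω => (shiftPath r (N ω), Z ω)) :=
        (integral_map hpm hcm.aestronglyMeasurable).symm
    _ = ∫ z, (∫ n, payoff F G U U₀ τ z n ∂(P.map N)) ∂(P.map Z) := by
        rw [hprod, integral_prod_symm _ hint']
    _ = ∫ ω, (∫ n, payoff F G U U₀ τ (Z ω) n ∂(P.map N)) ∂P :=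
        integral_map hZm hcm.integral_prod_left.aestronglyMeasurable
    _ = _ := by
        congr 1
        ext ω
        exact integral_map hN.measurable.aemeasurable
          (hcm.comp_measurable measurable_prodMk_right).aestronglyMeasurable

theorem IsMild.zero {H : Type*} [NormedAddCommGroup H] [NormedSpace ℝ H] [CompleteSpace H]
    {e : ι → H} {N : Ω → C(ℝ≥0, H)} {F G : H × H → H} {U : ℝ → H → H} {U₀ : H → H}
    (hN : IsDrivingNoise P e lam W N) (hF : LipschitzWith LF F) {α : ℝ}
    (hα : 0 ≤ α) (hU : IsMild P N F G U₀ α K U) : U 0 = U₀ := by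
  funext x
  rw [hU.eq 0 ⟨le_rfl, hα⟩ x]
  have : (fun ω => payoff F G U U₀ 0 x (N ω)) =ᵐ[P] fun _ => U₀ x := by
    filter_upwards [hN.zero] with ω hω
    have := (isPath_flow hF hU.regular 0 x (N ω) 0).eq 0 ⟨le_rfl, le_rfl⟩
    simp [payoff, reward, this, hω]
  rw [integral_congr_ae this]
  simp

/-- Concatenation of a mild solution `U` on `[0, α]` with a mild solution `V` that starts from
`U α`. -/
theorem IsMild.append (hN : IsDrivingNoise P e lam W N) (hF : LipschitzWith LF F)
    (hG : LipschitzWith LG G) (hU₀ : LipschitzWith K₀ U₀) {α h : ℝ} (hα : 0 ≤ α) (hh : 0 ≤ h)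
    (hU : IsMild P N F G U₀ α K U) (hV : IsMild P N F G (U α) h K' V) :
    IsMild P N F G U₀ (α + h) (max K K') fun t x => if t ≤ α then U t x else V (t - α) x := by
  set A : ℝ → H → H := fun t x => if t ≤ α then U t x else V (t - α) x with hA
  have hV0 : V 0 = U α := hV.zero hN hF hh
  have hAU : ∀ t ≤ α, A t = U t := fun t ht => by
    funext x
    simp [hA, ht]
  have hAV : ∀ s, 0 ≤ s → V s = A (α + s) := fun s hs => by
    funext x
    rcases hs.eq_or_lt with rfl | hs
    · simp [hA, hV0]
    · simp [hA, hs]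
  have hreg : IsRegular (max K K') A := by
    refine ⟨?_, fun t => ?_⟩
    · refine Continuous.if_le hU.regular.continuous (hV.regular.continuous.comp
        (by fun_prop : Continuous fun q : ℝ × H => (q.1 - α, q.2))) continuous_fst
        continuous_const fun q hq => ?_
      simp [hq, hV0]
    · rcases le_or_gt t α with ht | ht
      · rw [hAU t ht]
        exact (hU.regular.lipschitz t).weaken (le_max_left _ _)
      · have : A t = V (t - α) := by
          funext x
          simp [hA, ht]
        rw [this]
        exact (hV.regular.lipschitz _).weaken (le_max_right _ _)
  have hAmild : ∀ t ∈ Set.Icc 0 α, ∀ x, A t x = ∫ ω, payoff F G A U₀ t x (N ω) ∂P := by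
    intro t ht x
    rw [hAU t ht.2, hU.eq t ht x]
    congr 1
    ext ω
    exact payoff_congr hF hU.regular hreg ht.1 x (N ω)
      fun s hs => (hAU s (hs.2.trans ht.2)).symm
  refine ⟨hreg, fun t ht x => ?_⟩
  rcases le_or_gt t α with htα | htα
  · exact hAmild t ⟨ht.1, htα⟩ x
  obtain ⟨r, rfl⟩ : ∃ r : ℝ≥0, t = r + α :=
    ⟨(t - α).toNNReal, by rw [Real.coe_toNNReal _ (by linarith)]; ring⟩
  have hr : (r : ℝ) ∈ Set.Icc 0 h := ⟨r.coe_nonneg, by linarith [ht.2]⟩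
  have hVr := hV.regular
  have hUα : LipschitzWith K (U α) := hU.regular.lipschitz α
  have hZm := hN.aestronglyMeasurable_flow hF hVr r x r
  have hZ := integrable_flow hN.integrable hF hVr (s := (r : ℝ)) ⟨r.coe_nonneg, le_rfl⟩ x
  have hUZ : Integrable (fun ω => U α (flow F V r x (N ω) r)) P := by
    refine Integrable.mono' (g := fun ω => ‖U α 0‖ + K * ‖flow F V r x (N ω) r‖)
      ((integrable_const _).add (hZ.norm.const_mul _))
      (hUα.continuous.comp_aestronglyMeasurable hZ.aestronglyMeasurable)
      (Eventually.of_forall fun ω => ?_)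
    have h1 := hUα.norm_sub_le (flow F V r x (N ω) r) 0
    have h2 := norm_le_norm_add_norm_sub' (U α (flow F V r x (N ω) r)) (U α 0)
    rw [sub_zero] at h1
    linarith
  simp only [payoff_add hF hG hreg hVr r hα (fun s hs => hAV s hs.1) x (V₀ := U α)]
  have hP := integrable_payoff hN.integrable hF hG hUα hVr r.coe_nonneg x
  rw [integral_add (f := fun ω => payoff F G V (U α) r x (N ω) - U α (flow F V r x (N ω) r))
      (hP.sub hUZ)
      (integrable_payoff_shiftPath hN.integrable hF hG hU₀ hreg hα r hZ), integral_sub hP hUZ,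
    hN.integral_payoff_shiftPath hF hG hU₀ hreg hα r hZm hZ, ← hV.eq r hr x]
  simp only [← hAmild α ⟨hα, le_rfl⟩, hAU α le_rfl]
  rw [hAV r r.coe_nonneg, add_comm α]
  abel

/-- Continuation of mild solutions by a time that only depends on the Lipschitz constant of the
current value. -/
theorem IsDrivingNoise.exists_continuation (hN : IsDrivingNoise P e lam W N)
    (hF : LipschitzWith LF F) (hG : LipschitzWith LG G) (C : ℝ≥0) :
    ∃ h : ℝ, 0 < h ∧ ∀ (U₀ : H → H) (K₀ : ℝ≥0), LipschitzWith K₀ U₀ →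
      ∀ (α : ℝ) (K : ℝ≥0) (U : ℝ → H → H), 0 ≤ α → IsMild P N F G U₀ α K U →
        LipschitzWith C (U α) → ∃ K' U', IsMild P N F G U₀ (α + h) K' U' := by
  obtain ⟨h, hh, hex⟩ := exists_isMild hN.integrable hF hG C
  refine ⟨h, hh, fun U₀ K₀ hU₀ α K U hα hU hC => ?_⟩
  obtain ⟨V, hV⟩ := hex (U α) hC
  exact ⟨_, _, hU.append hN hF hG hU₀ hα hh.le hV⟩

end Markov

/-! ### Uniqueness, and mild solutions as Lipschitz solutions -/

section Uniqueness

variable {H : Type*} [NormedAddCommGroup H] [NormedSpace ℝ H] {Ω : Type*} [MeasurableSpace Ω]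

/-- The Feynman-Kac formula for `V` at the point `(t, x)`, along
paths that solve the characteristic equation for almost every noise path. Neither measurability nor
adaptedness of the paths is required. -/
def HasRepresentation (P : Measure Ω) (N : Ω → C(ℝ≥0, H)) (F G : H × H → H) (U₀ : H → H)
    (V : ℝ → H → H) (t : ℝ) (x : H) : Prop :=
  ∃ X : ℝ → Ω → H, (∀ᵐ ω ∂P, IsPath F V t x (N ω) t fun s => X s ω) ∧
    (∀ᵐ ω ∂P, IntervalIntegrable (fun s => G (X s ω, V (t - s) (X s ω))) volume 0 t) ∧
    Integrable (fun ω => reward G V U₀ t fun s => X s ω) P ∧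
    V t x = ∫ ω, reward G V U₀ t (fun s => X s ω) ∂P

/-- If a coefficient is integrable along one single path that ends at time `α`, then its values at
the origin are integrable in time, which gives uniform bounds for all earlier times `t`. -/
theorem exists_coeff_bound {H : Type*} [NormedAddCommGroup H] {F : H × H → H} {L K : ℝ≥0}
    (hF : LipschitzWith L F) {V : ℝ → H → H} {α : ℝ} (hα : 0 ≤ α)
    (hV : ∀ t ∈ Set.Icc 0 α, LipschitzWith K (V t)) {Y : ℝ → H}
    (hY : ContinuousOn Y (Set.Icc 0 α))
    (hi : IntervalIntegrable (fun s => F (Y s, V (α - s) (Y s))) volume 0 α) :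
    ∃ Φ, 0 ≤ Φ ∧ ∀ t ∈ Set.Icc 0 α, ∃ φ : ℝ → ℝ, IntervalIntegrable φ volume 0 t ∧
      (∀ r ∈ Set.Icc 0 t, ‖F (0, V (t - r) 0)‖ ≤ φ r) ∧ ∫ r in (0 : ℝ)..t, φ r ≤ Φ := by
  obtain ⟨R, hR⟩ := isCompact_Icc.exists_bound_of_continuousOn hY
  have hR0 : 0 ≤ R := (norm_nonneg _).trans (hR 0 ⟨le_rfl, hα⟩)
  set ψ : ℝ → ℝ := fun s => ‖F (Y s, V (α - s) (Y s))‖ + L * ((1 + K) * R) with hψ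
  have hψ0 : ∀ s, 0 ≤ ψ s := fun s => by positivity
  have hψi : IntervalIntegrable ψ volume 0 α := hi.norm.add intervalIntegrable_const
  refine ⟨∫ s in (0 : ℝ)..α, ψ s, intervalIntegral.integral_nonneg hα fun s _ => hψ0 s,
    fun t ht => ⟨fun r => ψ (α - t + r), ?_, fun r hr => ?_, ?_⟩⟩
  · have h1 : IntervalIntegrable ψ volume (α - t) α := hψi.mono_set (by
      rw [Set.uIcc_of_le hα, Set.uIcc_of_le (by linarith [ht.1])]
      exact Set.Icc_subset_Icc (by linarith [ht.2]) le_rfl)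
    simpa using h1.comp_add_left (α - t)
  · have hs : α - t + r ∈ Set.Icc 0 α := ⟨by linarith [ht.2, hr.1], by linarith [hr.2]⟩
    have hq : α - (α - t + r) = t - r := by ring
    have h1 := norm_coeff_sub_le hF (hV (t - r) ⟨by linarith [hr.2], by linarith [hr.1, ht.2]⟩)
      (g := V (t - r)) 0 (Y (α - t + r))
    have h2 := norm_le_norm_add_norm_sub' (F (0, V (t - r) 0))
      (F (Y (α - t + r), V (t - r) (Y (α - t + r))))
    have h3 := hR _ hs
    simp only [hψ, hq]
    rw [sub_self, norm_zero, add_zero, zero_sub, norm_neg] at h1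
    have h4 : (L : ℝ) * ((1 + K) * ‖Y (α - t + r)‖) ≤ L * ((1 + K) * R) := by gcongr
    linarith
  · rw [intervalIntegral.integral_comp_add_left ψ, add_zero, sub_add_cancel]
    exact intervalIntegral.integral_mono_interval (by linarith [ht.2]) (by linarith [ht.1]) le_rfl
      (Eventually.of_forall hψ0) hψi

variable {P : Measure Ω} [IsProbabilityMeasure P] {N : Ω → C(ℝ≥0, H)}
  {F G : H × H → H} {LF LG K K' K₀ : ℝ≥0} {U V : ℝ → H → H} {U₀ : H → H}

/-- No continuity in time is needed to see that a function with a Feynman-Kac representation is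
bounded at the origin, uniformly in time. -/
theorem exists_bound_of_hasRepresentation (hN : IsIntegrableNoise P N) (hF : LipschitzWith LF F)
    (hG : LipschitzWith LG G) (hU₀ : LipschitzWith K₀ U₀) {α : ℝ} (hα : 0 ≤ α)
    (hV : ∀ t ∈ Set.Icc 0 α, LipschitzWith K (V t))
    (hrep : ∀ t ∈ Set.Icc 0 α, ∀ x, HasRepresentation P N F G U₀ V t x) :
    ∃ B, 0 ≤ B ∧ ∀ t ∈ Set.Icc 0 α, ‖V t 0‖ ≤ B := by
  obtain ⟨X, hX, hXi, -, -⟩ := hrep α ⟨hα, le_rfl⟩ 0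
  obtain ⟨ω₀, hω₀, hω₀'⟩ := (hX.and hXi).exists
  obtain ⟨Φ, hΦ0, hΦ⟩ := exists_coeff_bound hF hα hV hω₀.continuousOn
    (by simpa [Pi.neg_def] using hω₀.integrable.neg)
  obtain ⟨Γ, hΓ0, hΓ⟩ := exists_coeff_bound hG hα hV hω₀.continuousOn hω₀'
  obtain ⟨M, hM, hM0, hMN⟩ := hN.bound α
  set E := Real.exp (LF * (1 + K) * α) with hE
  set Q := (LG * (1 + K) * α + K₀ : ℝ) with hQ
  have hμ0 : 0 ≤ ∫ ω, M ω ∂P := integral_nonneg hM0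
  refine ⟨Γ + ‖U₀ 0‖ + Q * (Φ * E) + Q * E * ∫ ω, M ω ∂P, by positivity, fun t ht => ?_⟩
  obtain ⟨Y, hY, hYi, -, hYV⟩ := hrep t ht 0
  obtain ⟨φ, hφi, hφ, hφΦ⟩ := hΦ t ht
  obtain ⟨γ, hγi, hγ, hγΓ⟩ := hΓ t ht
  have hVt : ∀ r ∈ Set.Icc 0 t, LipschitzWith K (V (t - r)) := fun r hr =>
    hV _ ⟨by linarith [hr.2], by linarith [hr.1, ht.2]⟩
  rw [hYV, ← integral_const_add_const_mul hM]
  refine norm_integral_le_of_norm_le ((integrable_const _).add (hM.const_mul _)) ?_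
  filter_upwards [hY, hYi, hMN] with ω h1 h2 h3
  have h4 : ∀ s ∈ Set.Icc 0 t, ‖Y s ω‖ ≤ (M ω + Φ) * E := by
    intro s hs
    refine (h1.norm_le hF hVt (fun s hs => h3 s ⟨hs.1, hs.2.trans ht.2⟩) hφi hφ s hs).trans ?_
    have hs' : s ≤ α := hs.2.trans ht.2
    have hMω := hM0 ω
    rw [norm_zero, zero_add, hE]
    gcongr
  refine (norm_reward_le hG hU₀ ht.1 hVt h4 hγi hγ).trans ?_
  have hMω := hM0 ω
  have h5 : LG * (1 + K) * ((M ω + Φ) * E) * t ≤ LG * (1 + K) * ((M ω + Φ) * E) * α := by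
    have := ht.2
    gcongr
  calc _ ≤ Γ + LG * (1 + K) * ((M ω + Φ) * E) * α + (‖U₀ 0‖ + K₀ * ((M ω + Φ) * E)) := by
        gcongr
    _ = _ := by
        rw [hQ]
        ring

variable [CompleteSpace H]

theorem IsMild.hasRepresentation (hN : IsIntegrableNoise P N) (hF : LipschitzWith LF F)
    (hG : LipschitzWith LG G) (hU₀ : LipschitzWith K₀ U₀) {α : ℝ} (hU : IsMild P N F G U₀ α K U)
    {t : ℝ} (ht : t ∈ Set.Icc 0 α) (x : H) : HasRepresentation P N F G U₀ U t x :=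
  ⟨fun s ω => flow F U t x (N ω) s,
    Eventually.of_forall fun ω => isPath_flow hF hU.regular t x (N ω) t,
    Eventually.of_forall fun ω =>
      (continuous_coeff_flow hF hG hU.regular t x (N ω)).intervalIntegrable _ _,
    integrable_payoff hN hF hG hU₀ hU.regular ht.1 x, hU.eq t ht x⟩

/-- A mild solution coincides with every function that is Lipschitz in space and has a
Feynman-Kac representation. -/
theorem IsMild.eq_of_hasRepresentation (hN : IsIntegrableNoise P N) (hF : LipschitzWith LF F)
    (hG : LipschitzWith LG G) (hU₀ : LipschitzWith K₀ U₀) {α : ℝ}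
    (hU : IsMild P N F G U₀ α K' U) (hV : ∀ t ∈ Set.Icc 0 α, LipschitzWith K (V t))
    (hrep : ∀ t ∈ Set.Icc 0 α, ∀ x, HasRepresentation P N F G U₀ V t x) :
    ∀ t ∈ Set.Icc 0 α, V t = U t := by
  intro t₀ ht₀
  have hα : 0 ≤ α := ht₀.1.trans ht₀.2
  obtain ⟨B, hB0, hB⟩ := exists_bound_of_hasRepresentation hN hF hG hU₀ hα hV hrep
  obtain ⟨c₀, hc₀, hUc⟩ := hU.regular.exists_bound α
  obtain ⟨l, hl0, hcontr⟩ := exists_contraction hN hF hG hU₀ K K' hα hc₀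
  set c := B + c₀ + K + K' with hc
  have hc0 : 0 ≤ c := by positivity
  -- The a priori bound for the weighted distance improves by the factor `2` in each step.
  have key : ∀ k : ℕ, ∀ t ∈ Set.Icc 0 α, ∀ y,
      ‖V t y - U t y‖ ≤ c / 2 ^ k * (Real.exp (l * t) * (1 + ‖y‖)) := by
    intro k
    induction k with
    | zero =>
      intro t ht y
      have h1 := (hV t ht).norm_sub_le y 0
      have h2 := (hU.regular.lipschitz t).norm_sub_le y 0
      have h3 := norm_le_norm_add_norm_sub' (V t y) (V t 0)
      have h4 := norm_le_norm_add_norm_sub' (U t y) (U t 0)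
      have h5 := norm_sub_le (V t y) (U t y)
      have h6 := hB t ht
      have h7 := hUc t ht
      have h8 : 1 ≤ Real.exp (l * t) := Real.one_le_exp (mul_nonneg hl0 ht.1)
      rw [sub_zero] at h1 h2
      have hy := norm_nonneg y
      calc _ ≤ c * (1 * (1 + ‖y‖)) := by
            have j1 := mul_nonneg (add_nonneg hB0 hc₀) hy
            have j2 := K.coe_nonneg
            have j3 := K'.coe_nonneg
            simp only [hc]
            nlinarith
        _ ≤ _ := by
            rw [pow_zero, div_one]
            gcongr
    | succ k ih =>
      intro t ht y
      obtain ⟨X, hX, hXi, hXint, hXV⟩ := hrep t ht y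
      rw [hXV, hU.eq t ht y, pow_succ, ← div_div]
      exact hcontr V U t ht (fun r hr => hV r ⟨hr.1, hr.2.trans ht.2⟩) hU.regular hUc y X hX hXi
        hXint (c / 2 ^ k) (by positivity) fun r hr => ih r ⟨hr.1, hr.2.trans ht.2⟩
  funext y
  have hlim : Tendsto (fun k : ℕ => c / 2 ^ k * (Real.exp (l * t₀) * (1 + ‖y‖))) atTop (𝓝 0) := by
    have := (tendsto_pow_atTop_nhds_zero_of_lt_one (r := (1 / 2 : ℝ)) (by norm_num)
      (by norm_num)).const_mul c |>.mul_const (Real.exp (l * t₀) * (1 + ‖y‖))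
    simpa [div_eq_mul_inv] using this
  exact sub_eq_zero.1 (norm_le_zero_iff.1 (ge_of_tendsto' hlim fun k => key k t₀ ht₀ y))

end Uniqueness

section Bridge

variable {H : Type*} [NormedAddCommGroup H] [InnerProductSpace ℝ H] [CompleteSpace H]
  {Ω : Type*} [MeasurableSpace Ω] {P : Measure Ω}
  {ι : Type*} {e : ι → H} {lam : ι → ℝ} {W : ι → ℝ≥0 → Ω → ℝ}
  {N : Ω → C(ℝ≥0, H)} {F G : H × H → H} {LF LG K K' K₀ : ℝ≥0} {U V : ℝ → H → H} {U₀ : H → H}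

theorem IsLipschitzSolution.hasRepresentation {H : Type*} [NormedAddCommGroup H]
    [InnerProductSpace ℝ H] {ι : Type*} {e : ι → H} {W : ι → ℝ≥0 → Ω → ℝ} {N : Ω → C(ℝ≥0, H)}
    {F G : H × H → H} {V : ℝ → H → H} {U₀ : H → H} {lam : ι → ℝ}
    (hN : ∀ᵐ ω ∂P, ∀ s, HasSum (fun i => (√(2 * lam i) * W i s ω) • e i) (N ω s)) {T : ℝ≥0∞}
    (hV : IsLipschitzSolution P e lam W F G U₀ T V) {t : ℝ} (ht : 0 ≤ t)
    (htT : ENNReal.ofReal t < T) (x : H) : HasRepresentation P N F G U₀ V t x := by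
  obtain ⟨X, hX, hXi, hXint, hXV⟩ := hV.feynmanKac t ht htT x
  refine ⟨X, ?_, hXi, hXint, hXV⟩
  filter_upwards [hX.continuous_paths, hX.integrable_drift, hX.equation, hN] with ω h1 h2 h3 h4
  refine ⟨h1, h2, fun s hs => ?_⟩
  rw [← (h3 s hs).unique (h4 s.toNNReal)]
  abel

variable [IsProbabilityMeasure P]

theorem IsMild.eq_of_isLipschitzSolution (hN : IsDrivingNoise P e lam W N)
    (hF : LipschitzWith LF F) (hG : LipschitzWith LG G) (hU₀ : LipschitzWith K₀ U₀) {α : ℝ}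
    (hU : IsMild P N F G U₀ α K' U) {T : ℝ≥0∞}
    (hV : IsLipschitzSolution P e lam W F G U₀ T V) (hα : ENNReal.ofReal α < T) :
    ∀ t ∈ Set.Icc 0 α, V t = U t := by
  intro t ht
  obtain ⟨K, hK⟩ := hV.lipschitz α (ht.1.trans ht.2) hα
  exact hU.eq_of_hasRepresentation hN.integrable hF hG hU₀ hK (fun s hs =>
    hV.hasRepresentation hN.hasSum hs.1 ((ENNReal.ofReal_le_ofReal hs.2).trans_lt hα)) t ht

variable [SecondCountableTopology H] [MeasurableSpace H] [BorelSpace H] [Countable ι]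

/-- A function that coincides on every compact subinterval of `[0, T)` with a mild solution is a
Lipschitz solution. -/
theorem isLipschitzSolution_of_isMild (hN : IsDrivingNoise P e lam W N)
    (hF : LipschitzWith LF F) (hG : LipschitzWith LG G) (hU₀ : LipschitzWith K₀ U₀) {T : ℝ≥0∞}
    (hT : 0 < T) (hU : ∀ α : ℝ, 0 ≤ α → ENNReal.ofReal α < T →
      ∃ K A, IsMild P N F G U₀ α K A ∧ ∀ t ∈ Set.Icc 0 α, U t = A t) :
    IsLipschitzSolution P e lam W F G U₀ T U := by
  refine ⟨hT, fun α hα hαT => ?_, fun t ht htT x => ?_⟩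
  · obtain ⟨K, A, hA, hUA⟩ := hU α hα hαT
    exact ⟨K, fun t ht => hUA t ht ▸ hA.regular.lipschitz t⟩
  obtain ⟨K, A, hA, hUA⟩ := hU t ht htT
  have hA' := hA.regular
  have hUA' : ∀ s ∈ Set.Icc 0 t, U (t - s) = A (t - s) := fun s hs =>
    hUA _ ⟨by linarith [hs.2], by linarith [hs.1]⟩
  have hIoc : ∀ s ∈ Set.uIoc 0 t, s ∈ Set.Icc 0 t := fun s hs => by
    rw [Set.uIoc_of_le ht] at hs
    exact Set.Ioc_subset_Icc_self hs
  have hrew : ∀ ω, ((∫ s in (0 : ℝ)..t,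
      G (flow F A t x (N ω) s, U (t - s) (flow F A t x (N ω) s))) +
      U₀ (flow F A t x (N ω) t)) = payoff F G A U₀ t x (N ω) := by
    intro ω
    rw [payoff, reward]
    congr 1
    refine intervalIntegral.integral_congr fun s hs => ?_
    rw [Set.uIcc_of_le ht] at hs
    simp only [hUA' s hs]
  refine ⟨fun s ω => flow F A t x (N ω) s, ⟨fun s hs => ?_, ?_, ?_, ?_⟩, ?_, ?_, ?_⟩
  · lift s to ℝ≥0 using hs.1
    exact hN.aestronglyMeasurable_flow hF hA' t x s
  · exact Eventually.of_forall fun ω => (continuous_flow_apply hF hA' t x (N ω)).continuousOn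
  · refine Eventually.of_forall fun ω => (isPath_flow hF hA' t x (N ω) t).integrable.congr ?_
    intro s hs
    simp only [hUA' s (hIoc s hs)]
  · filter_upwards [hN.hasSum] with ω hω s hs
    have h1 := (isPath_flow hF hA' t x (N ω) t).eq s hs
    have h2 : (∫ r in (0 : ℝ)..s, -F (flow F A t x (N ω) r, U (t - r) (flow F A t x (N ω) r))) =
        ∫ r in (0 : ℝ)..s, -F (flow F A t x (N ω) r, A (t - r) (flow F A t x (N ω) r)) := by
      refine intervalIntegral.integral_congr fun r hr => ?_
      rw [Set.uIcc_of_le hs.1] at hr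
      simp only [hUA' r ⟨hr.1, hr.2.trans hs.2⟩]
    have h3 : flow F A t x (N ω) s - x - (∫ r in (0 : ℝ)..s,
        -F (flow F A t x (N ω) r, U (t - r) (flow F A t x (N ω) r))) = N ω s.toNNReal := by
      rw [h2, h1]
      abel
    rw [h3]
    exact hω s.toNNReal
  · refine Eventually.of_forall fun ω =>
      ((continuous_coeff_flow hF hG hA' t x (N ω)).intervalIntegrable 0 t).congr ?_
    intro s hs
    simp only [hUA' s (hIoc s hs)]
  · simp only [hrew]
    exact integrable_payoff hN.integrable hF hG hU₀ hA' ht x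
  · simp only [hrew]
    rw [hUA t ⟨ht, le_rfl⟩, hA.eq t ⟨ht, le_rfl⟩ x]

end Bridge

/-! ### The maximal solution and its blow-up -/

theorem lipschitzWith_of_lipSeminorm_le {H : Type*} [NormedAddCommGroup H] [InnerProductSpace ℝ H]
    {f : H → H} {C : ℝ≥0} (h : lipSeminorm f ≤ C) : LipschitzWith C f := by
  intro x y
  rcases eq_or_ne x y with rfl | hxy
  · simp
  · have h1 : edist (f x) (f y) / edist x y ≤ C :=
      (le_iSup₂ (f := fun x y => edist (f x) (f y) / edist x y) x y).trans h
    exact (ENNReal.div_le_iff (edist_pos.2 hxy).ne' (edist_ne_top x y)).1 h1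

theorem IsMild.mono {H : Type*} [NormedAddCommGroup H] [NormedSpace ℝ H] {Ω : Type*}
    [MeasurableSpace Ω] {P : Measure Ω} {N : Ω → C(ℝ≥0, H)} {F G : H × H → H} {U₀ : H → H}
    {α β : ℝ} {K : ℝ≥0} {U : ℝ → H → H} (hU : IsMild P N F G U₀ α K U) (hβ : β ≤ α) :
    IsMild P N F G U₀ β K U :=
  ⟨hU.regular, fun t ht => hU.eq t ⟨ht.1, ht.2.trans hβ⟩⟩

section Maximal

variable {H : Type*} [NormedAddCommGroup H] [InnerProductSpace ℝ H] [CompleteSpace H]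
  [SecondCountableTopology H] [MeasurableSpace H] [BorelSpace H]
  {Ω : Type*} [MeasurableSpace Ω] {P : Measure Ω} [IsProbabilityMeasure P]
  {ι : Type*} [Countable ι] {e : ι → H} {lam : ι → ℝ} {W : ι → ℝ≥0 → Ω → ℝ}
  {N : Ω → C(ℝ≥0, H)} {F G : H × H → H} {LF LG K₀ : ℝ≥0} {U₀ : H → H}

theorem IsDrivingNoise.exists_unique_solution (hN : IsDrivingNoise P e lam W N)
    (hF : LipschitzWith LF F) (hG : LipschitzWith LG G) (hU₀ : LipschitzWith K₀ U₀) :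
    ∃ T : ℝ, 0 < T ∧ ∃ U : ℝ → H → H,
      IsLipschitzSolution P e lam W F G U₀ (ENNReal.ofReal T) U ∧
      ∀ V : ℝ → H → H, IsLipschitzSolution P e lam W F G U₀ (ENNReal.ofReal T) V →
        ∀ t ∈ Set.Ico 0 T, V t = U t := by
  obtain ⟨h, hh, hex⟩ := exists_isMild hN.integrable hF hG K₀
  obtain ⟨U, hU⟩ := hex U₀ hU₀
  refine ⟨h, hh, U, isLipschitzSolution_of_isMild hN hF hG hU₀ (ENNReal.ofReal_pos.2 hh)
    fun α hα hαh => ⟨_, U, hU.mono ((ENNReal.ofReal_lt_ofReal_iff hh).1 hαh).le, fun _ _ => rfl⟩,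
    fun V hV t ht => ?_⟩
  exact (hU.mono ht.2.le).eq_of_isLipschitzSolution hN hF hG hU₀ hV
    ((ENNReal.ofReal_lt_ofReal_iff hh).2 ht.2) t ⟨ht.1, le_rfl⟩

theorem IsDrivingNoise.exists_maximal_solution (hN : IsDrivingNoise P e lam W N)
    (hF : LipschitzWith LF F) (hG : LipschitzWith LG G) (hU₀ : LipschitzWith K₀ U₀) :
    ∃ (Tc : ℝ≥0∞) (U : ℝ → H → H),
      IsLipschitzSolution P e lam W F G U₀ Tc U ∧
      (∀ (T : ℝ≥0∞) (V : ℝ → H → H), IsLipschitzSolution P e lam W F G U₀ T V →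
        T ≤ Tc ∧ ∀ t : ℝ, 0 ≤ t → ENNReal.ofReal t < T → V t = U t) ∧
      (Tc < ∞ → Tendsto (fun t => lipSeminorm (U t)) (𝓝[<] Tc.toReal) (𝓝 ∞)) := by
  set D : Set ℝ := {α | ∃ K A, IsMild P N F G U₀ α K A} with hD
  set Tc : ℝ≥0∞ := ⨆ α ∈ D, ENNReal.ofReal α with hTc
  have hle : ∀ α ∈ D, ENNReal.ofReal α ≤ Tc := fun α hα => le_iSup₂ (f := fun α (_ : α ∈ D) =>
    ENNReal.ofReal α) α hα
  have hDlt : ∀ α : ℝ, ENNReal.ofReal α < Tc → α ∈ D := by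
    intro α hα
    obtain ⟨β, hβ⟩ := lt_iSup_iff.1 hα
    obtain ⟨⟨K, A, hA⟩, hαβ⟩ := lt_iSup_iff.1 hβ
    exact ⟨K, A, hA.mono (ENNReal.ofReal_lt_ofReal_iff'.1 hαβ).1.le⟩
  have hex : ∀ α : ℝ, ∃ A : ℝ → H → H, α ∈ D → ∃ K, IsMild P N F G U₀ α K A := by
    intro α
    by_cases hα : α ∈ D
    · obtain ⟨K, A, hA⟩ := hα
      exact ⟨A, fun _ => ⟨K, hA⟩⟩
    · exact ⟨0, fun h => absurd h hα⟩
  choose A hA using hex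
  -- The mild solution on `[0, t]`, evaluated at its last time `t`.
  set U : ℝ → H → H := fun t => A t t with hU
  have hUA : ∀ α ∈ D, ∀ t ∈ Set.Icc 0 α, U t = A α t := by
    intro α hα t ht
    obtain ⟨K, hK⟩ := hA α hα
    obtain ⟨K', hK'⟩ := hA t ⟨K, A α, hK.mono ht.2⟩
    exact (hK.mono ht.2).eq_of_hasRepresentation hN.integrable hF hG hU₀
      (fun s _ => hK'.regular.lipschitz s)
      (fun s hs x => hK'.hasRepresentation hN.integrable hF hG hU₀ hs x) t ⟨ht.1, le_rfl⟩
  have hTc0 : 0 < Tc := by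
    obtain ⟨h, hh, hex⟩ := exists_isMild hN.integrable hF hG K₀
    obtain ⟨V, hV⟩ := hex U₀ hU₀
    exact (ENNReal.ofReal_pos.2 hh).trans_le (hle h ⟨_, V, hV⟩)
  -- Close to a finite `Tc` no solution has a value with a given Lipschitz constant.
  have hblow : Tc < ∞ → ∀ C : ℝ≥0, ∃ t₀ < Tc.toReal, 0 ≤ t₀ ∧ ∀ t, t₀ < t → t < Tc.toReal →
      ¬ LipschitzWith C (U t) := by
    intro hfin C
    obtain ⟨h, hh, hcont⟩ := hN.exists_continuation hF hG C
    have hτ := ENNReal.toReal_pos hTc0.ne' hfin.ne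
    refine ⟨max 0 (Tc.toReal - h), max_lt hτ (by linarith), le_max_left _ _,
      fun t ht ht' hlip => ?_⟩
    have ht0 : 0 ≤ t := (le_max_left _ _).trans ht.le
    have htD : t ∈ D := hDlt t ((ENNReal.ofReal_lt_iff_lt_toReal ht0 hfin.ne).2 ht')
    obtain ⟨K, hK⟩ := hA t htD
    obtain ⟨K', U', hU'⟩ := hcont U₀ K₀ hU₀ t K (A t) ht0 hK hlip
    have h1 := (ENNReal.ofReal_le_iff_le_toReal hfin.ne).1 (hle _ ⟨K', U', hU'⟩)
    have h2 := (le_max_right 0 (Tc.toReal - h)).trans_lt ht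
    linarith
  have hUV : ∀ (T : ℝ≥0∞) (V : ℝ → H → H), IsLipschitzSolution P e lam W F G U₀ T V →
      ∀ t : ℝ, 0 ≤ t → ENNReal.ofReal t < T → ENNReal.ofReal t < Tc → V t = U t := by
    intro T V hV t ht htT htTc
    obtain ⟨K, hK⟩ := hA t (hDlt t htTc)
    exact hK.eq_of_isLipschitzSolution hN hF hG hU₀ hV htT t ⟨ht, le_rfl⟩
  refine ⟨Tc, U, isLipschitzSolution_of_isMild hN hF hG hU₀ hTc0 fun α hα hαT => ?_,
    fun T V hV => ?_, fun hfin => ?_⟩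
  · obtain ⟨K, hK⟩ := hA α (hDlt α hαT)
    exact ⟨K, A α, hK, hUA α (hDlt α hαT)⟩
  · have hT : T ≤ Tc := by
      by_contra! hlt
      have hfin : Tc < ∞ := hlt.trans_le le_top
      obtain ⟨C, hC⟩ := hV.lipschitz Tc.toReal ENNReal.toReal_nonneg
        (by rwa [ENNReal.ofReal_toReal hfin.ne])
      obtain ⟨t₀, ht₀, h0, hnot⟩ := hblow hfin C
      obtain ⟨t, ht, ht'⟩ := exists_between ht₀
      have htTc := (ENNReal.ofReal_lt_iff_lt_toReal (h0.trans ht.le) hfin.ne).2 ht'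
      refine hnot t ht ht' ?_
      rw [← hUV T V hV t (h0.trans ht.le) (htTc.trans hlt) htTc]
      exact hC t ⟨h0.trans ht.le, ht'.le⟩
    exact ⟨hT, fun t ht htT => hUV T V hV t ht htT (htT.trans_le hT)⟩
  · refine ENNReal.tendsto_nhds_top fun n => ?_
    obtain ⟨t₀, ht₀, -, hnot⟩ := hblow hfin n
    filter_upwards [Ioo_mem_nhdsLT ht₀] with t ht
    by_contra! hle
    exact hnot t ht.1 ht.2 (lipschitzWith_of_lipSeminorm_le (by simpa using hle))

end Maximal

end HilbertMaster

theorem mainTheorem3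
    {H : Type*} [NormedAddCommGroup H] [InnerProductSpace ℝ H] [CompleteSpace H]
    [TopologicalSpace.SeparableSpace H]
    {Ω : Type*} [MeasurableSpace Ω] (P : Measure Ω) [IsProbabilityMeasure P]
    {ι : Type*} [Countable ι] (e : ι → H) (he : Orthonormal ℝ e)
    (lam : ι → ℝ) (hlam : ∀ i, 0 ≤ lam i) (hlam_sum : Summable lam)
    (W : ι → ℝ≥0 → Ω → ℝ) (hW_meas : ∀ i s, Measurable (W i s))
    (hW : ∀ i, IsBrownianReal (W i) P)
    (hW_indep : iIndepFun (fun i ω s => W i s ω) P)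
    (F G : H × H → H) (hF : ∃ K, LipschitzWith K F) (hG : ∃ K, LipschitzWith K G)
    (U₀ : H → H) (hU₀ : ∃ K, LipschitzWith K U₀) :
    -- short time existence and uniqueness
    (∃ T : ℝ, 0 < T ∧ ∃ U : ℝ → H → H,
      HilbertMaster.IsLipschitzSolution P e lam W F G U₀ (ENNReal.ofReal T) U ∧
      ∀ V : ℝ → H → H,
        HilbertMaster.IsLipschitzSolution P e lam W F G U₀ (ENNReal.ofReal T) V →
        ∀ t ∈ Set.Ico 0 T, V t = U t) ∧
    -- maximal solution, and blow-up if the maximal time is finite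
    (∃ (Tc : ℝ≥0∞) (U : ℝ → H → H),
      HilbertMaster.IsLipschitzSolution P e lam W F G U₀ Tc U ∧
      (∀ (T : ℝ≥0∞) (V : ℝ → H → H),
        HilbertMaster.IsLipschitzSolution P e lam W F G U₀ T V →
        T ≤ Tc ∧ ∀ t : ℝ, 0 ≤ t → ENNReal.ofReal t < T → V t = U t) ∧
      (Tc < ∞ → Tendsto (fun t => HilbertMaster.lipSeminorm (U t)) (𝓝[<] Tc.toReal) (𝓝 ∞))) := by
  obtain ⟨LF, hF⟩ := hF
  obtain ⟨LG, hG⟩ := hG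
  obtain ⟨K₀, hU₀⟩ := hU₀
  borelize H
  have := UniformSpace.secondCountable_of_separable H
  obtain ⟨N, hNm, hNi, hNs⟩ := HilbertMaster.exists_noise he hlam hlam_sum hW_meas hW
  have hN : HilbertMaster.IsDrivingNoise P e lam W N :=
    ⟨hW_meas, fun i => (hW i).toIsPreBrownianReal, hW_indep, hNm, hNi, hNs⟩
  exact ⟨hN.exists_unique_solution hF hG hU₀, hN.exists_maximal_solution hF hG hU₀⟩
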